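/- A \emph{fullerene} is a simple convex $3$-polytope in $\mathbb R^3$ all of whose facets are pentagons and hexagons. A \emph{$5$-belt} of a simple $3$-polytope is a cyclic sequence $(F_1,\dots,F_5)$ of facets (considered up to rotation and reversal, or equivalently as a set of facets) such that $F_1\cap F_2,\ F_2\cap F_3,\ F_3\cap F_4,\ F_4\cap F_5,\ F_5\cap F_1$ are edges, no other two of the five facets intersect, and $F_1\cap\dots\cap F_5=\varnothing$. The belt \emph{surrounds} a facet $F$ if its members are exactly the facets that share an edge with $F$. Two polytopes are \emph{combinatorially equivalent} if there is a bijection between their sets of faces that preserves inclusion in both directions. For $k\ge 0$ let $D_k$ be the combinatorial simple $3$-polytope obtained as follows: cut the surface of the dodecahedron along a zigzag cycle into two caps, each consisting of a pentagon and the five pentagons adjacent to it, and insert between the caps $k$ successive $5$-belts of hexagons, each hexagon meeting its two neighbours in the same belt in opposite edges. Explicitly, the facets of $D_k$ are $b$, $t$ and $f_{r,i}$ with $0\le r\le k+1$, $i\in\mathbb Z/5$, and its vertices correspond to the triples $\{b,f_{0,i},f_{0,i+1}\}$, $\{t,f_{k+1,i},f_{k+1,i+1}\}$, and, for $0\le r\le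 k$, $\{f_{r,i},f_{r,i+1},f_{r+1,i+1}\}$ and $\{f_{r,i},f_{r+1,i},f_{r+1,i+1}\}$ of facets that meet there; its faces are the intersections of facets. \textbf{Theorem.} Let $P$ be a fullerene. I. Every pentagonal facet of $P$ is surrounded by a $5$-belt, and there are exactly $12$ $5$-belts that surround a pentagonal facet. II. If $P$ has a $5$-belt that does not surround a pentagonal facet, then (1) every such belt consists only of hexagons; (2) $P$ is combinatorially equivalent to $D_k$ for some $k\ge 1$; and (3) for this $k$, the number of all $5$-belts of $P$ is exactly $12+k$. -/

import Mathlib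

/-- A convex polytope in `ℝⁿ`: a bounded set `{x | ⟪aᵢ, x⟫ + bᵢ ≥ 0, i = 1, …, m}`, given by an
irredundant system of inequalities (deleting any one of them changes the set). -/
structure ConvexPolytope (n : ℕ) where
  /-- the number of inequalities -/
  m : ℕ
  /-- the normal vectors -/
  a : Fin m → EuclideanSpace ℝ (Fin n)
  /-- the constant terms -/
  b : Fin m → ℝ
  bounded : Bornology.IsBounded {x : EuclideanSpace ℝ (Fin n) | ∀ i, 0 ≤ inner ℝ (a i) x + b i}
  irredundant : ∀ i, {x : EuclideanSpace ℝ (Fin n) | ∀ j, j ≠ i → 0 ≤ inner ℝ (a j) x + b j} ≠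
    {x : EuclideanSpace ℝ (Fin n) | ∀ j, 0 ≤ inner ℝ (a j) x + b j}

/-- Combinatorial equivalence of two families of faces: an inclusion-preserving (in both
directions) bijection. -/
def CombEquiv {α β : Type*} (A : Set (Set α)) (B : Set (Set β)) : Prop :=
  Nonempty (A ≃o B)

namespace ConvexPolytope

variable {n : ℕ} (P : ConvexPolytope n)

/-- The set of points of the polytope. -/
def carrier : Set (EuclideanSpace ℝ (Fin n)) :=
  {x | ∀ i, 0 ≤ inner ℝ (P.a i) x + P.b i}

/-- The facet `Fᵢ = P ∩ Hᵢ`, where `Hᵢ` is the hyperplane `⟪aᵢ, x⟫ + bᵢ = 0`. -/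
def facet (i : Fin P.m) : Set (EuclideanSpace ℝ (Fin n)) :=
  {x | x ∈ P.carrier ∧ inner ℝ (P.a i) x + P.b i = 0}

/-- The faces of `P`: the intersections of facets (the empty intersection being `P` itself). -/
def faces : Set (Set (EuclideanSpace ℝ (Fin n))) :=
  {G | ∃ S : Set (Fin P.m), G = P.carrier ∩ ⋂ i ∈ S, P.facet i}

/-- `P` is an `n`-polytope: it has full dimension in `ℝⁿ`. -/
def IsFullDim : Prop := (interior P.carrier).Nonempty

/-- `G` is a nonempty face of dimension `d`. -/
def IsFaceOfDim (d : ℕ) (G : Set (EuclideanSpace ℝ (Fin n))) : Prop :=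
  G ∈ P.faces ∧ G.Nonempty ∧ Module.finrank ℝ (vectorSpan ℝ G) = d

/-- Vertices of `P`, as one-point faces. -/
def IsVertex (G : Set (EuclideanSpace ℝ (Fin n))) : Prop := P.IsFaceOfDim 0 G

/-- Edges of `P`. -/
def IsEdge (G : Set (EuclideanSpace ℝ (Fin n))) : Prop := P.IsFaceOfDim 1 G

/-- A simple `n`-polytope: an `n`-polytope each vertex of which lies in exactly `n` facets. -/
def IsSimple : Prop :=
  P.IsFullDim ∧ ∀ v, P.IsVertex v → {i : Fin P.m | v ⊆ P.facet i}.ncard = n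

end ConvexPolytope

namespace ConvexPolytope

variable (P : ConvexPolytope 3)

/-- The facet `Fᵢ` of a `3`-polytope is a `k`-gon: it has exactly `k` edges. -/
def IsGon (k : ℕ) (i : Fin P.m) : Prop :=
  {e | P.IsEdge e ∧ e ⊆ P.facet i}.ncard = k

/-- A fullerene: a simple `3`-polytope with all facets pentagons and hexagons. -/
def IsFullerene : Prop :=
  P.IsSimple ∧ ∀ i, P.IsGon 5 i ∨ P.IsGon 6 i

/-- A `k`-loop (`k ≥ 1`): a cyclic sequence of `k` facets, successive ones meeting in an edge. -/
def IsLoop {k : ℕ} (L : ZMod k → Fin P.m) : Prop :=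
  ∀ p, P.IsEdge (P.facet (L p) ∩ P.facet (L (p + 1)))

/-- A `k`-loop which is a `k`-belt: the facets have no common point, and two facets at different
positions meet if and only if their positions are successive in the cyclic order. -/
def IsBeltLoop {k : ℕ} (L : ZMod k → Fin P.m) : Prop :=
  P.IsLoop L ∧ (⋂ p, P.facet (L p)) = ∅ ∧
    ∀ p q, p ≠ q → ((P.facet (L p) ∩ P.facet (L q)).Nonempty ↔ q = p + 1 ∨ p = q + 1)

/-- `B` is the set of facets of a `k`-belt. The cyclic order of the belt is determined by `B` up to
rotation and reversal, so belts are counted as such sets. -/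
def IsBelt (k : ℕ) (B : Set (Fin P.m)) : Prop :=
  ∃ L : ZMod k → Fin P.m, P.IsBeltLoop L ∧ Set.range L = B

/-- The facets in `B` surround the facet `Fᵢ`: they are the facets that one meets on the other side
when walking along the boundary of `Fᵢ`, that is, those which have a common edge with `Fᵢ`. -/
def Surrounds (B : Set (Fin P.m)) (i : Fin P.m) : Prop :=
  B = {j | P.IsEdge (P.facet j ∩ P.facet i)}

/-- `B` surrounds some pentagonal facet. -/
def SurroundsPentagon (B : Set (Fin P.m)) : Prop :=
  ∃ i, P.IsGon 5 i ∧ P.Surrounds B i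

end ConvexPolytope

/-! The combinatorial polytopes `D_k`. The dodecahedron `D_0` is cut along a zigzag cycle into two
caps, each a pentagon (`bottom`, `top`) surrounded by five pentagons, and `k` successive belts of
five hexagons are inserted between them. This gives `k + 2` rings of five facets; rings `0` and
`k + 1` are the pentagons of the two caps, rings `1, …, k` are hexagons. The facet `side r i` meets
its neighbours `side r (i ± 1)` in the ring, and the facets `side (r + 1) i`,
`side (r + 1) (i + 1)` of the next ring. -/

namespace DPolytope

/-- The facets of `D_k`. -/
inductive Facet (k : ℕ) : Type
  | bottom : Facet k
  | top : Facet k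
  | side (r : Fin (k + 2)) (i : ZMod 5) : Facet k

/-- The `20 + 10 k` vertices of `D_k`. -/
inductive Vertex (k : ℕ) : Type
  | bottom (i : ZMod 5) : Vertex k
  | top (i : ZMod 5) : Vertex k
  | lower (r : Fin (k + 1)) (i : ZMod 5) : Vertex k
  | upper (r : Fin (k + 1)) (i : ZMod 5) : Vertex k

/-- The three facets of `D_k` which meet in a given vertex. -/
def facetsAt {k : ℕ} : Vertex k → Set (Facet k)
  | .bottom i => {.bottom, .side 0 i, .side 0 (i + 1)}
  | .top i => {.top, .side (Fin.last (k + 1)) i, .side (Fin.last (k + 1)) (i + 1)}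
  | .lower r i => {.side r.castSucc i, .side r.castSucc (i + 1), .side r.succ (i + 1)}
  | .upper r i => {.side r.castSucc i, .side r.succ i, .side r.succ (i + 1)}

/-- The faces of `D_k`, each given by its set of vertices: the intersections of facets (the empty
intersection being `D_k` itself). -/
def faces (k : ℕ) : Set (Set (Vertex k)) :=
  {G | ∃ S : Set (Facet k), G = ⋂ f ∈ S, {v : Vertex k | f ∈ facetsAt v}}

end DPolytope

/-! Pass to the dual: the facets of `P` become the vertices of a triangulated sphere, and the
vertices of `P` its triangles. A `k`-belt becomes an induced `k`-cycle that does not bound a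
triangle. By mod 2 homology, which reduces to Euler characteristic and ranks (`exists_bd_eq`), such
a cycle bounds exactly two sets of triangles, complementary to each other, and each satisfies
Euler's formula for a disc (`card_add_two_eq`).

Sort the triangles of such a disc by how many of their three facets are inside. None has zero,
exactly `k` have one, say n₂ have two, and those with three form the core. Counting incidences with
degrees 5 and 6 gives p + k = 6 + n₂, where p is the number of pentagons inside. A fullerene has
twelve pentagons, so one side has p ≤ 6, hence n₂ ≤ k. The boundary of the core has at most n₂
edges, so for k ≤ 5 it is empty or a cycle of length at most 5. It is empty only if k = 5 and there
is a single facet inside. A cycle that is not a belt bounds too few triangles to enclose the core or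
its complement. So it is a belt, and in the absence of shorter belts its length is `k` and p = 6
(`dichotomy`). For k = 3, 4 this repeats forever on smaller discs, so there are no 3- or 4-belts;
consequently the neighbours of each pentagon form a 5-belt, and different pentagons give different
belts.

For k = 5 the descent ends at a single pentagon. `isFlat` shows that every belt facet has exactly
three vertices in a disc with several inner facets (two if there is one), which forces the layer
between the belt and the core to be one zigzag ring (`exists_ring`). The disc is thus a tower of
rings of five facets around a pentagon. The outside of that innermost cap again has six pentagons,
so it is a tower too, and the sphere is a tube of rings between two pentagons, that is `D_k`
(`exists_tube`).

If a belt surrounds no pentagon, both sides contain six pentagons, so the belt is hexagonal with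
three vertices of each facet on either side. In the tube, look at the last ring it meets: leaving
that ring would put four successive vertices of a facet on one side. So the belt is the whole ring
(`eq_ring`), which gives the count `12 + k`.

For the convex geometry, a vertex of a simple polytope has a basis of edge directions dual to its
facet normals. A generic linear functional therefore has exactly one local maximum on each face.
This gives connectedness of face graphs and Euler's formula. -/

open Finset symmDiff

/-! ### Triangulated spheres and mod 2 boundaries. -/

/-- A triangulated `2`-sphere, given by the sets of facets meeting in the vertices of the dual
simple polytope: `inc v` is the triangle dual to the vertex `v`. -/
structure TriangulatedSphere (F V : Type*) [Fintype F] [Fintype V] [DecidableEq F]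
    [DecidableEq V] where
  inc : V → Finset F
  card_inc : ∀ v, #(inc v) = 3
  inc_injective : Function.Injective inc
  card_cofaces : ∀ v e, e ⊆ inc v → #e = 2 → #{w | e ⊆ inc w} = 2
  -- Connectedness is phrased by predicates that propagate across common edges, so that no paths are
  -- needed; the same form is used for `connected`.
  star_connected : ∀ (x : F) (Q : V → Prop),
    (∀ v w, x ∈ inc v → x ∈ inc w → 2 ≤ #(inc v ∩ inc w) → Q v → Q w) →
      ∀ v w, x ∈ inc v → x ∈ inc w → Q v → Q w
  connected : ∀ Q : V → Prop, (∀ v w, 2 ≤ #(inc v ∩ inc w) → Q v → Q w) → ∀ v w, Q v → Q w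
  exists_mem_inc : ∀ x, ∃ v, x ∈ inc v
  -- Euler's formula V - E + F = 2 with 2E = 3V. This is the only place where the surface is
  -- required to be a sphere.
  euler : Fintype.card V + 4 = 2 * Fintype.card F

namespace TriangulatedSphere

variable {F V : Type*} [Fintype F] [Fintype V] [DecidableEq F] [DecidableEq V]
  (K : TriangulatedSphere F V)

/-- The edges lying in an odd number of triangles of `T`. -/
def bd (T : Finset V) : Finset (Finset F) :=
  {e | #e = 2 ∧ Odd #{v ∈ T | e ⊆ K.inc v}}

/-- The triangles containing `x`. -/
def star (x : F) : Finset V := {v | x ∈ K.inc v}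

/-- The facets all of whose vertices lie in `T`. -/
def inner (T : Finset V) : Finset F := {x | K.star x ⊆ T}

/-- Two different facets with a common vertex. -/
def Adj (x y : F) : Prop := x ≠ y ∧ ∃ v, x ∈ K.inc v ∧ y ∈ K.inc v

/-- The number of vertices of a facet. -/
def deg (x : F) : ℕ := #(K.star x)

variable {K}

lemma mem_star {x : F} {v : V} : v ∈ K.star x ↔ x ∈ K.inc v := by simp [star]

lemma mem_inner {x : F} {T : Finset V} : x ∈ K.inner T ↔ K.star x ⊆ T := by simp [inner]

lemma mem_bd {T : Finset V} {e : Finset F} :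
    e ∈ K.bd T ↔ #e = 2 ∧ Odd #{v ∈ T | e ⊆ K.inc v} := by simp [bd]

lemma Adj.symm {x y : F} (h : K.Adj x y) : K.Adj y x :=
  ⟨h.1.symm, h.2.imp fun _ hv => ⟨hv.2, hv.1⟩⟩

lemma eq_or_eq_of_subset_inc {e : Finset F} (he : #e = 2) {v w u : V} (hvw : v ≠ w)
    (hv : e ⊆ K.inc v) (hw : e ⊆ K.inc w) (hu : e ⊆ K.inc u) : u = v ∨ u = w := by
  have h2 := K.card_cofaces v e hv he
  have hsub : ({v, w} : Finset V) ⊆ ({w | e ⊆ K.inc w} : Finset V) := by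
    intro z hz
    simp only [mem_insert, mem_singleton] at hz
    rcases hz with rfl | rfl <;> simp [hv, hw]
  have heq := eq_of_subset_of_card_le hsub (by rw [h2, card_pair hvw])
  have : u ∈ ({v, w} : Finset V) := by rw [heq]; simp [hu]
  simpa using this

lemma exists_other {e : Finset F} (he : #e = 2) {v : V} (hv : e ⊆ K.inc v) :
    ∃ w, w ≠ v ∧ e ⊆ K.inc w := by
  have h2 := K.card_cofaces v e hv he
  obtain ⟨w, hw, hne⟩ := exists_mem_ne (s := ({w | e ⊆ K.inc w} : Finset V)) (by omega) v
  exact ⟨w, hne, by simpa using hw⟩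

lemma filter_cofaces_eq {e : Finset F} (he : #e = 2) {v w : V} (hvw : v ≠ w)
    (hv : e ⊆ K.inc v) (hw : e ⊆ K.inc w) (T : Finset V) :
    ({u ∈ T | e ⊆ K.inc u} : Finset V) = {u ∈ ({v, w} : Finset V) | u ∈ T} := by
  ext u
  simp only [mem_filter, mem_insert, mem_singleton]
  constructor
  · rintro ⟨h1, h2⟩
    exact ⟨eq_or_eq_of_subset_inc he hvw hv hw h2, h1⟩
  · rintro ⟨rfl | rfl, h⟩ <;> simp [*]

/-- With just two triangles on an edge, an odd number in `T` means one inside and one outside. -/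
lemma mem_bd_iff {e : Finset F} (he : #e = 2) {v w : V} (hvw : v ≠ w)
    (hv : e ⊆ K.inc v) (hw : e ⊆ K.inc w) (T : Finset V) :
    e ∈ K.bd T ↔ ¬ (v ∈ T ↔ w ∈ T) := by
  rw [mem_bd, filter_cofaces_eq he hvw hv hw]
  by_cases h1 : v ∈ T <;> by_cases h2 : w ∈ T <;>
    simp [h1, h2, he, filter_insert, filter_singleton, hvw]

lemma exists_of_mem_bd {e : Finset F} {T : Finset V} (h : e ∈ K.bd T) :
    ∃ v ∈ T, ∃ w ∉ T, e ⊆ K.inc v ∧ e ⊆ K.inc w := by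
  obtain ⟨he, hodd⟩ := mem_bd.1 h
  obtain ⟨v, hv⟩ := card_pos.1 hodd.pos
  simp only [mem_filter] at hv
  obtain ⟨w, hwv, hw⟩ := exists_other he hv.2
  have := (mem_bd_iff he hwv.symm hv.2 hw T).1 h
  exact ⟨v, hv.1, w, by tauto, hv.2, hw⟩

lemma card_eq_two_of_mem_bd {e : Finset F} {T : Finset V} (h : e ∈ K.bd T) : #e = 2 :=
  (mem_bd.1 h).1

lemma mem_iff_mem_of_notMem_bd {e : Finset F} (he : #e = 2) {v w : V}
    (hv : e ⊆ K.inc v) (hw : e ⊆ K.inc w) {T : Finset V} (hT : e ∉ K.bd T) :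
    v ∈ T ↔ w ∈ T := by
  by_cases hvw : v = w
  · rw [hvw]
  · by_contra h
    exact hT ((mem_bd_iff he hvw hv hw T).2 h)

lemma bd_symmDiff (S T : Finset V) : K.bd (S ∆ T) = K.bd S ∆ K.bd T := by
  ext e
  by_cases he : #e = 2
  · by_cases hex : ∃ v, e ⊆ K.inc v
    · obtain ⟨v, hv⟩ := hex
      obtain ⟨w, hwv, hw⟩ := exists_other he hv
      simp only [mem_symmDiff, mem_bd_iff he hwv.symm hv hw]
      tauto
    · push Not at hex
      simp [mem_symmDiff, mem_bd, hex]
  · simp [mem_symmDiff, mem_bd, he]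

lemma bd_univ : K.bd univ = ∅ := by
  ext e
  simp only [notMem_empty, iff_false]
  intro h
  obtain ⟨v, -, w, hw, -⟩ := exists_of_mem_bd h
  simp at hw

lemma bd_compl (T : Finset V) : K.bd Tᶜ = K.bd T := by
  have : Tᶜ = T ∆ univ := by ext; simp [mem_symmDiff]
  rw [this, bd_symmDiff, bd_univ]
  ext; simp [mem_symmDiff]

/-- Membership in `T` can only change across a boundary edge, and any two triangles are joined
through edges. This is the vanishing of 2-cycles other than the whole sphere. -/
lemma eq_empty_or_univ_of_bd_eq_empty {T : Finset V} (h : K.bd T = ∅) : T = ∅ ∨ T = univ := by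
  rcases T.eq_empty_or_nonempty with h0 | ⟨v, hv⟩
  · exact Or.inl h0
  · right
    ext w
    simp only [mem_univ, iff_true]
    refine K.connected (· ∈ T) ?_ v w hv
    intro v w hvw hv
    obtain ⟨e, he, hcard⟩ := exists_subset_card_eq hvw
    exact (mem_iff_mem_of_notMem_bd hcard (he.trans inter_subset_left)
      (he.trans inter_subset_right) (by simp [h])).1 hv

/-- The symmetric difference has no boundary, so a cycle determines its region up to complement. -/
lemma eq_or_eq_compl_of_bd_eq {S T : Finset V} (h : K.bd S = K.bd T) : S = T ∨ S = Tᶜ := by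
  have h0 : K.bd (S ∆ T) = ∅ := by rw [bd_symmDiff, h]; simp
  rcases eq_empty_or_univ_of_bd_eq_empty h0 with h1 | h1
  · exact Or.inl (symmDiff_eq_bot.1 h1)
  · right
    ext v
    have : v ∈ S ∆ T := by simp [h1]
    simp only [mem_symmDiff, mem_compl] at this ⊢
    tauto

lemma star_nonempty (x : F) : (K.star x).Nonempty :=
  (K.exists_mem_inc x).imp fun _ h => mem_star.2 h

/-- A facet which does not meet `bd T` is on one side of it. -/
lemma star_subset_or_disjoint {T : Finset V} {x : F} (h : ∀ e ∈ K.bd T, x ∉ e) :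
    K.star x ⊆ T ∨ K.star x ⊆ Tᶜ := by
  have key : ∀ v w, x ∈ K.inc v → x ∈ K.inc w → v ∈ T → w ∈ T := by
    refine K.star_connected x (· ∈ T) ?_
    intro v w hv hw hvw hT
    obtain ⟨e, hxe, he, hcard⟩ := exists_subsuperset_card_eq (s := {x}) (t := K.inc v ∩ K.inc w)
      (n := 2) (by simp [hv, hw]) (by simp) hvw
    refine (mem_iff_mem_of_notMem_bd hcard (he.trans inter_subset_left)
      (he.trans inter_subset_right) (fun h' => h e h' (by simpa using hxe))).1 hT
  by_cases h0 : ∃ v ∈ K.star x, v ∈ T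
  · obtain ⟨v, hv, hvT⟩ := h0
    exact Or.inl fun w hw => key v w (mem_star.1 hv) (mem_star.1 hw) hvT
  · push Not at h0
    exact Or.inr fun w hw => by simpa using h0 w hw

/-! ### The count of edges -/

/-- The edges of the triangles in `T`. -/
def edges (K : TriangulatedSphere F V) (T : Finset V) : Finset (Finset F) :=
  T.biUnion fun v => (K.inc v).powersetCard 2

lemma mem_edges {T : Finset V} {e : Finset F} :
    e ∈ K.edges T ↔ #e = 2 ∧ ∃ v ∈ T, e ⊆ K.inc v := by
  simp only [edges, mem_biUnion, mem_powersetCard]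
  constructor
  · rintro ⟨v, hv, h1, h2⟩
    exact ⟨h2, v, hv, h1⟩
  · rintro ⟨h2, v, hv, h1⟩
    exact ⟨v, hv, h1, h2⟩

lemma bd_subset_edges (T : Finset V) : K.bd T ⊆ K.edges T := fun e he => by
  obtain ⟨v, hv, w, -, h, -⟩ := exists_of_mem_bd he
  exact mem_edges.2 ⟨card_eq_two_of_mem_bd he, v, hv, h⟩

/-- Double counting: an edge of `T` lies in two triangles of `T`, except that a boundary edge lies
in one and needs a correction of 1. -/
lemma two_mul_card_edges (T : Finset V) : 2 * #(K.edges T) = 3 * #T + #(K.bd T) := by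
  have h1 : ∑ v ∈ T, #{e ∈ K.edges T | e ⊆ K.inc v} = 3 * #T := by
    rw [mul_comm, ← smul_eq_mul, ← sum_const]
    refine sum_congr rfl fun v hv => ?_
    have : ({e ∈ K.edges T | e ⊆ K.inc v} : Finset (Finset F)) = (K.inc v).powersetCard 2 := by
      ext e
      simp only [mem_filter, mem_edges, mem_powersetCard]
      exact ⟨fun h => ⟨h.2, h.1.1⟩, fun h => ⟨⟨h.2, v, hv, h.1⟩, h.1⟩⟩
    rw [this, card_powersetCard, K.card_inc]
    rfl
  have h2 : ∑ v ∈ T, #{e ∈ K.edges T | e ⊆ K.inc v} =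
      ∑ e ∈ K.edges T, #{v ∈ T | e ⊆ K.inc v} :=
    sum_card_bipartiteAbove_eq_sum_card_bipartiteBelow (fun v e => e ⊆ K.inc v)
  have h3 : ∑ e ∈ K.edges T, (#{v ∈ T | e ⊆ K.inc v} + if e ∈ K.bd T then 1 else 0) =
      2 * #(K.edges T) := by
    rw [mul_comm, ← smul_eq_mul, ← sum_const]
    refine sum_congr rfl fun e he => ?_
    obtain ⟨he, v, hv, hev⟩ := mem_edges.1 he
    obtain ⟨w, hwv, hw⟩ := exists_other he hev
    have h := mem_bd_iff he hwv.symm hev hw T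
    rw [filter_cofaces_eq he hwv.symm hev hw]
    by_cases hwT : w ∈ T <;> simp [hv, hwT, filter_insert, filter_singleton, hwv.symm, h]
  rw [sum_add_distrib, ← h2, h1, ← sum_filter, filter_mem_eq_inter,
    inter_eq_right.2 (bd_subset_edges T)] at h3
  simp only [sum_const, smul_eq_mul, mul_one] at h3
  exact h3.symm

/-! ### Mod 2 homology -/

/-- The incidence matrix of facets and edges, modulo `2`. -/
def facetMatrix (A : Finset F) (E : Finset (Finset F)) : Matrix A E (ZMod 2) :=
  Matrix.of fun x e => if x.1 ∈ e.1 then 1 else 0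

/-- The incidence matrix of edges and triangles, modulo `2`. -/
def edgeMatrix (K : TriangulatedSphere F V) (E : Finset (Finset F)) (T : Finset V) :
    Matrix E T (ZMod 2) :=
  Matrix.of fun e v => if e.1 ⊆ K.inc v.1 then 1 else 0

lemma card_edges_at {v : V} {x : F} (hx : x ∈ K.inc v) :
    #{e ∈ (K.inc v).powersetCard 2 | x ∈ e} = 2 := by
  obtain ⟨a, b, c, hab, hac, hbc, h⟩ := card_eq_three.1 (K.card_inc v)
  have h2 : ({e ∈ (K.inc v).powersetCard 2 | x ∉ e} : Finset _) =
      ((K.inc v).erase x).powersetCard 2 := by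
    ext e
    simp only [mem_filter, mem_powersetCard, subset_erase]
    tauto
  have h3 := card_filter_add_card_filter_not (s := (K.inc v).powersetCard 2) (fun e => x ∈ e)
  rw [h2, card_powersetCard, card_powersetCard, card_erase_of_mem hx, K.card_inc] at h3
  norm_num at h3
  have : Nat.choose 3 2 = 3 := rfl
  omega

/-- The square of the boundary operator vanishes, since a vertex of a triangle lies on two of its
edges. -/
lemma facetMatrix_mul_edgeMatrix (A : Finset F) (T : Finset V) :
    facetMatrix A (K.edges T) * K.edgeMatrix (K.edges T) T = 0 := by
  ext x v
  simp only [Matrix.mul_apply, facetMatrix, edgeMatrix, Matrix.of_apply, Matrix.zero_apply,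
    ← ite_and, mul_ite, mul_one, mul_zero]
  rw [sum_coe_sort (K.edges T) (fun e => if e ⊆ K.inc v.1 ∧ x.1 ∈ e then (1 : ZMod 2) else 0),
    sum_boole]
  have : ({e ∈ K.edges T | e ⊆ K.inc v.1 ∧ x.1 ∈ e} : Finset _) =
      {e ∈ (K.inc v.1).powersetCard 2 | x.1 ∈ e} := by
    ext e
    simp only [mem_filter, mem_edges, mem_powersetCard]
    exact ⟨fun h => ⟨⟨h.2.1, h.1.1⟩, h.2.2⟩, fun h => ⟨⟨h.1.2, v.1, v.2, h.1.1⟩, h.1.1, h.2⟩⟩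
  rw [this]
  by_cases hx : x.1 ∈ K.inc v.1
  · rw [card_edges_at hx]
    rfl
  · rw [filter_false_of_mem]
    · simp
    · intro e he hxe
      exact hx ((mem_powersetCard.1 he).1 hxe)

lemma zmod_two_eq_ite (a : ZMod 2) : a = if a = 1 then 1 else 0 := by
  revert a; decide

/-- Mod 2 chains are identified with their supports; the boundary coefficient at `e` is then a
parity. -/
lemma edgeMatrix_mulVec {E : Finset (Finset F)} {T : Finset V} (c : T → ZMod 2) (e : E) :
    (K.edgeMatrix E T).mulVec c e =
      (#{v ∈ ({v ∈ T.attach | c v = 1}.map (Function.Embedding.subtype _)) |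
        e.1 ⊆ K.inc v} : ℕ) := by
  rw [← sum_boole, sum_map, sum_filter]
  simp only [Matrix.mulVec, dotProduct, edgeMatrix, Matrix.of_apply, ite_mul, one_mul, zero_mul,
    Function.Embedding.subtype_apply]
  refine sum_congr rfl fun v _ => ?_
  rw [zmod_two_eq_ite (c v)]
  by_cases h1 : c v = 1
  · simp only [h1, if_true]
    rfl
  · simp [h1]

lemma bd_eq_empty_of_edgeMatrix_mulVec_eq_zero {T : Finset V} {c : T → ZMod 2}
    (h : (K.edgeMatrix (K.edges T) T).mulVec c = 0) :
    K.bd ({v ∈ T.attach | c v = 1}.map (Function.Embedding.subtype _)) = ∅ := by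
  ext e
  simp only [notMem_empty, iff_false]
  intro he
  have hT : e ∈ K.edges T := by
    obtain ⟨h1, v, h2, h3⟩ := mem_edges.1 (bd_subset_edges _ he)
    refine mem_edges.2 ⟨h1, v, ?_, h3⟩
    obtain ⟨w, -, rfl⟩ := mem_map.1 h2
    exact w.2
  have h2 := congrFun h ⟨e, hT⟩
  rw [edgeMatrix_mulVec] at h2
  have h3 := (ZMod.natCast_eq_zero_iff _ 2).1 h2
  have := (mem_bd.1 he).2
  rw [← Nat.not_even_iff_odd] at this
  exact this (even_iff_two_dvd.2 h3)

/-- The only nonzero 2-cycle is the sum of all triangles, available only when `T` is everything. -/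
lemma finrank_ker_edgeMatrix_le (T : Finset V) :
    Module.finrank (ZMod 2) (LinearMap.ker (K.edgeMatrix (K.edges T) T).mulVecLin) ≤
      if T = univ then 1 else 0 := by
  have key : ∀ c : T → ZMod 2, (K.edgeMatrix (K.edges T) T).mulVec c = 0 →
      c = 0 ∨ (T = univ ∧ c = 1) := by
    intro c hc
    rcases eq_empty_or_univ_of_bd_eq_empty (bd_eq_empty_of_edgeMatrix_mulVec_eq_zero hc) with h | h
    · left
      ext v
      have hv : v.1 ∉ ({v ∈ T.attach | c v = 1}.map (Function.Embedding.subtype _)) := by simp [h]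
      rw [zmod_two_eq_ite (c v)]
      simpa using hv
    · right
      have hv : ∀ v : V, ∃ h : v ∈ T, c ⟨v, h⟩ = 1 := by
        intro v
        have : v ∈ ({v ∈ T.attach | c v = 1}.map (Function.Embedding.subtype _)) := by simp [h]
        simpa using this
      refine ⟨eq_univ_iff_forall.2 fun v => (hv v).1, ?_⟩
      ext v
      exact (hv v.1).2
  split_ifs with hT
  · have hle : LinearMap.ker (K.edgeMatrix (K.edges T) T).mulVecLin ≤
        Submodule.span (ZMod 2) {(1 : T → ZMod 2)} := by
      intro c hc
      rcases key c (by simpa using hc) with rfl | ⟨-, rfl⟩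
      · exact Submodule.zero_mem _
      · exact Submodule.mem_span_singleton_self _
    exact (Submodule.finrank_mono hle).trans (finrank_span_le_card _ |>.trans (by simp))
  · have : LinearMap.ker (K.edgeMatrix (K.edges T) T).mulVecLin = ⊥ := by
      rw [eq_bot_iff]
      intro c hc
      rcases key c (by simpa using hc) with rfl | ⟨h, -⟩
      · exact Submodule.zero_mem _
      · exact absurd h hT
    rw [this, finrank_bot]

lemma card_le_rank_edgeMatrix (T : Finset V) :
    #T ≤ (K.edgeMatrix (K.edges T) T).rank + if T = univ then 1 else 0 := by
  have h1 := finrank_ker_edgeMatrix_le (K := K) T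
  have h2 := LinearMap.finrank_range_add_finrank_ker (K.edgeMatrix (K.edges T) T).mulVecLin
  rw [Module.finrank_fintype_fun_eq_card, Fintype.card_coe] at h2
  unfold Matrix.rank
  omega

/-- The kernel of the transpose consists of the functions constant along edges. By `H`, which
expresses connectedness, these are the constants, so the rank falls short of `#A` by at most one. -/
lemma card_le_rank_facetMatrix {A : Finset F} {E : Finset (Finset F)}
    (hE : ∀ e ∈ E, #e = 2 ∧ e ⊆ A)
    (H : ∀ g : F → ZMod 2, (∀ e ∈ E, ∀ x ∈ e, ∀ y ∈ e, g x = g y) → ∀ x ∈ A, ∀ y ∈ A, g x = g y) :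
    #A ≤ (facetMatrix A E).rank + 1 := by
  rw [← Matrix.rank_transpose]
  have h2 := LinearMap.finrank_range_add_finrank_ker (facetMatrix A E).transpose.mulVecLin
  rw [Module.finrank_fintype_fun_eq_card, Fintype.card_coe] at h2
  have h1 : Module.finrank (ZMod 2) (LinearMap.ker (facetMatrix A E).transpose.mulVecLin) ≤ 1 := by
    have hle : LinearMap.ker (facetMatrix A E).transpose.mulVecLin ≤
        Submodule.span (ZMod 2) {(1 : A → ZMod 2)} := by
      intro g hg
      have hg' : (facetMatrix A E).transpose.mulVec g = 0 := by
        rwa [LinearMap.mem_ker, Matrix.mulVecLin_apply] at hg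
      have hconst : ∀ x y : A, g x = g y := by
        intro x y
        have := H (fun z => if h : z ∈ A then g ⟨z, h⟩ else 0) ?_ x.1 x.2 y.1 y.2
        · simpa using this
        · intro e he z hz w hw
          by_cases hzw : z = w
          · rw [hzw]
          have hsub := (hE e he).2
          have heq : e = {z, w} := by
            refine (eq_of_subset_of_card_le ?_ ?_).symm
            · intro t ht
              simp only [mem_insert, mem_singleton] at ht
              rcases ht with rfl | rfl <;> assumption
            · rw [(hE e he).1, card_pair hzw]
          have h3 := congrFun hg' ⟨e, he⟩
          simp only [Matrix.mulVec, dotProduct, facetMatrix, Matrix.transpose_apply,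
            Matrix.of_apply, ite_mul, one_mul, zero_mul, Pi.zero_apply, heq, mem_insert,
            mem_singleton] at h3
          rw [← sum_filter] at h3
          have h4 : ({a : A | a.1 = z ∨ a.1 = w} : Finset A) = {⟨z, hsub hz⟩, ⟨w, hsub hw⟩} := by
            ext a
            simp [Subtype.ext_iff]
          rw [h4, sum_pair (by simpa using hzw)] at h3
          simp only [hsub hz, hsub hw, dif_pos]
          generalize g ⟨z, hsub hz⟩ = a at h3 ⊢
          generalize g ⟨w, hsub hw⟩ = b at h3 ⊢
          revert a b
          decide
      by_cases hA : Nonempty A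
      · obtain ⟨x⟩ := hA
        refine Submodule.mem_span_singleton.2 ⟨g x, ?_⟩
        ext y
        simp [hconst y x]
      · have : g = 0 := by
          ext x
          exact absurd ⟨x⟩ hA
        rw [this]
        exact Submodule.zero_mem _
    exact (Submodule.finrank_mono hle).trans (finrank_span_le_card _ |>.trans (by simp))
  unfold Matrix.rank
  omega

/-- The Euler characteristic of a connected proper subcomplex is at most one. -/
lemma card_add_card_le {T : Finset V} {A : Finset F} (hT : T ≠ univ)
    (hA : ∀ v ∈ T, K.inc v ⊆ A)
    (H : ∀ g : F → ZMod 2, (∀ e ∈ K.edges T, ∀ x ∈ e, ∀ y ∈ e, g x = g y) →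
      ∀ x ∈ A, ∀ y ∈ A, g x = g y) :
    #A + #T ≤ #(K.edges T) + 1 := by
  have h1 := card_le_rank_edgeMatrix (K := K) T
  have h2 := card_le_rank_facetMatrix (A := A) (E := K.edges T) (fun e he => by
    obtain ⟨he, v, hv, hev⟩ := mem_edges.1 he
    exact ⟨he, hev.trans (hA v hv)⟩) H
  -- The composite is zero, so the two ranks add up to at most the number of edges.
  have h3 := Matrix.rank_add_rank_le_card_of_mul_eq_zero (facetMatrix_mul_edgeMatrix (K := K) A T)
  rw [Fintype.card_coe] at h3
  rw [if_neg hT] at h1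
  omega

/-- A function on the facets is constant if it is so along edges. -/
lemma eq_of_forall_edge {α : Type*} (g : F → α)
    (hg : ∀ e ∈ K.edges univ, ∀ x ∈ e, ∀ y ∈ e, g x = g y) (x y : F) : g x = g y := by
  have h1 : ∀ v, ∀ x ∈ K.inc v, ∀ y ∈ K.inc v, g x = g y := by
    intro v x hx y hy
    by_cases hxy : x = y
    · rw [hxy]
    · refine hg {x, y} (mem_edges.2 ⟨card_pair hxy, v, mem_univ _, ?_⟩) x (by simp) y (by simp)
      simp [insert_subset_iff, hx, hy]
  obtain ⟨v, hv⟩ := K.exists_mem_inc x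
  obtain ⟨w, hw⟩ := K.exists_mem_inc y
  refine K.connected (fun w => ∀ y ∈ K.inc w, g x = g y) ?_ v w (h1 v x hv) y hw
  intro v w hvw h z hz
  obtain ⟨a, ha⟩ := card_pos.1 (by omega : 0 < #(K.inc v ∩ K.inc w))
  rw [mem_inter] at ha
  exact (h a ha.1).trans (h1 w a ha.2 z hz)

/-- Every cycle modulo `2` bounds. -/
lemma exists_bd_eq {S : Finset (Finset F)} (hS : S ⊆ K.edges univ)
    (heven : ∀ x, Even #{e ∈ S | x ∈ e}) : ∃ T, K.bd T = S := by
  set E := K.edges univ with hE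
  have h1 : _ ≤ (K.edgeMatrix E univ).rank + _ := card_le_rank_edgeMatrix (K := K) univ
  have h2 := card_le_rank_facetMatrix (A := univ) (E := E) (fun e he =>
    ⟨(mem_edges.1 he).1, subset_univ _⟩) (fun g hg x _ y _ => eq_of_forall_edge g hg x y)
  have hmul := facetMatrix_mul_edgeMatrix (K := K) univ univ
  have h3 : LinearMap.range (K.edgeMatrix E univ).mulVecLin ≤
      LinearMap.ker (facetMatrix univ E).mulVecLin := by
    rintro _ ⟨c, rfl⟩
    rw [LinearMap.mem_ker, Matrix.mulVecLin_apply, Matrix.mulVecLin_apply, Matrix.mulVec_mulVec,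
      hmul, Matrix.zero_mulVec]
  have h4 := LinearMap.finrank_range_add_finrank_ker (facetMatrix univ E).mulVecLin
  rw [Module.finrank_fintype_fun_eq_card, Fintype.card_coe] at h4
  have h5 := two_mul_card_edges (K := K) univ
  rw [bd_univ] at h5
  have h6 := K.euler
  simp only [if_true, card_univ, card_empty, ← hE] at h1 h2 h5
  -- Boundaries have dimension at least V - 1, cycles at most E - (F - 1), and Euler's formula makes
  -- these equal. So the first homology vanishes.
  have h7 : LinearMap.range (K.edgeMatrix E univ).mulVecLin =
      LinearMap.ker (facetMatrix univ E).mulVecLin := by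
    refine Submodule.eq_of_le_of_finrank_le h3 ?_
    unfold Matrix.rank at h1 h2
    omega
  have h8 : (fun e : E => if e.1 ∈ S then (1 : ZMod 2) else 0) ∈
      LinearMap.ker (facetMatrix univ E).mulVecLin := by
    rw [LinearMap.mem_ker, Matrix.mulVecLin_apply]
    ext x
    simp only [Matrix.mulVec, dotProduct, facetMatrix, Matrix.of_apply, Pi.zero_apply,
      ← ite_and, mul_ite, mul_one, mul_zero]
    rw [sum_coe_sort E (fun e => if e ∈ S ∧ x.1 ∈ e then (1 : ZMod 2) else 0), sum_boole]
    have : ({e ∈ E | e ∈ S ∧ x.1 ∈ e} : Finset _) = {e ∈ S | x.1 ∈ e} := by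
      ext e
      simp only [mem_filter]
      exact ⟨fun h => h.2, fun h => ⟨hS h.1, h⟩⟩
    rw [this]
    exact (ZMod.natCast_eq_zero_iff _ 2).2 (even_iff_two_dvd.1 (heven x.1))
  rw [← h7] at h8
  obtain ⟨c, hc⟩ := h8
  refine ⟨{v ∈ (univ : Finset V).attach | c v = 1}.map (Function.Embedding.subtype _), ?_⟩
  ext e
  by_cases he : e ∈ E
  · have h9 := congrFun hc ⟨e, he⟩
    rw [Matrix.mulVecLin_apply, edgeMatrix_mulVec] at h9
    rw [mem_bd]
    simp only [(mem_edges.1 he).1, true_and]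
    by_cases heS : e ∈ S
    · simp only [heS, if_true, iff_true] at h9 ⊢
      exact ZMod.natCast_eq_one_iff_odd.1 h9
    · simp only [heS, if_false, iff_false] at h9 ⊢
      rw [Nat.not_odd_iff_even]
      exact ZMod.natCast_eq_zero_iff_even.1 h9
  · exact ⟨fun h => absurd ((bd_subset_edges _ |>.trans (biUnion_subset_biUnion_of_subset_left _
      (subset_univ _))) h) he, fun h => absurd (hS h) he⟩

/-- The boundary of a chain is a cycle. -/
lemma even_card_bd_filter (T : Finset V) (x : F) : Even #{e ∈ K.bd T | x ∈ e} := by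
  have h1 : ∀ e ∈ {e ∈ K.edges T | x ∈ e},
      (if e ∈ K.bd T then (1 : ZMod 2) else 0) = (#{v ∈ T | e ⊆ K.inc v} : ℕ) := by
    intro e he
    have he2 := (mem_edges.1 (mem_filter.1 he).1).1
    split_ifs with h
    · exact (ZMod.natCast_eq_one_iff_odd.2 (mem_bd.1 h).2).symm
    · refine (ZMod.natCast_eq_zero_iff_even.2 ?_).symm
      rw [← Nat.not_odd_iff_even]
      exact fun h' => h (mem_bd.2 ⟨he2, h'⟩)
  have h2 := sum_congr rfl h1
  have h3 : ∑ e ∈ {e ∈ K.edges T | x ∈ e}, #{v ∈ T | e ⊆ K.inc v} =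
      ∑ v ∈ T, #{e ∈ {e ∈ K.edges T | x ∈ e} | e ⊆ K.inc v} :=
    (sum_card_bipartiteAbove_eq_sum_card_bipartiteBelow (fun v e => e ⊆ K.inc v)).symm
  have h4 : ∀ v ∈ T, Even #{e ∈ {e ∈ K.edges T | x ∈ e} | e ⊆ K.inc v} := by
    intro v hv
    have : ({e ∈ {e ∈ K.edges T | x ∈ e} | e ⊆ K.inc v} : Finset _) =
        {e ∈ (K.inc v).powersetCard 2 | x ∈ e} := by
      ext e
      simp only [mem_filter, mem_edges, mem_powersetCard]
      exact ⟨fun h => ⟨⟨h.2, h.1.1.1⟩, h.1.2⟩, fun h => ⟨⟨⟨h.1.2, v, hv, h.1.1⟩, h.2⟩, h.1.1⟩⟩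
    rw [this]
    by_cases hx : x ∈ K.inc v
    · rw [card_edges_at hx]
      exact even_two
    · rw [filter_false_of_mem]
      · simp
      · intro e he hxe
        exact hx ((mem_powersetCard.1 he).1 hxe)
  rw [sum_boole, ← Nat.cast_sum, h3, ZMod.natCast_eq_zero_iff_even.2 (even_sum _ h4),
    filter_filter, ZMod.natCast_eq_zero_iff_even] at h2
  convert h2 using 2
  ext e
  simp only [mem_filter]
  exact ⟨fun h => ⟨bd_subset_edges _ h.1, h.2, h.1⟩, fun h => ⟨h.2.2, h.2.1⟩⟩

end TriangulatedSphere

namespace TriangulatedSphere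

/-! ### Cycles -/

section Cycles

variable {F : Type*} [DecidableEq F]

/-- The edges of a closed walk. -/
def cycleEdges {k : ℕ} [NeZero k] (x : ZMod k → F) : Finset (Finset F) :=
  univ.image fun i => {x i, x (i + 1)}

lemma mem_cycleEdges {k : ℕ} [NeZero k] {x : ZMod k → F} {e : Finset F} :
    e ∈ cycleEdges x ↔ ∃ i, {x i, x (i + 1)} = e := by simp [cycleEdges]

lemma _root_.ZMod.natCast_ne_zero_of_lt {k n : ℕ} (hn : 0 < n) (hk : n < k) :
    (n : ZMod k) ≠ 0 := by
  rw [Ne, ZMod.natCast_eq_zero_iff]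
  exact fun h => absurd (Nat.le_of_dvd hn h) (by omega)

lemma cycle_ne {k : ℕ} [NeZero k] (hk : 3 ≤ k) (i : ZMod k) : i + 1 ≠ i := by
  have := ZMod.natCast_ne_zero_of_lt (n := 1) (k := k) one_pos (by omega)
  simpa using this

lemma cycle_ne_two {k : ℕ} [NeZero k] (hk : 3 ≤ k) (i : ZMod k) : i + 1 + 1 ≠ i := by
  have := ZMod.natCast_ne_zero_of_lt (n := 2) (k := k) two_pos (by omega)
  intro h
  apply this
  have h2 : i + ((2 : ℕ) : ZMod k) = i + 0 := by
    rw [add_zero]; push_cast; rw [← one_add_one_eq_two, ← add_assoc]; exact h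
  exact add_left_cancel h2

lemma pair_eq_pair_iff {α : Type*} [DecidableEq α] {a b c d : α} :
    ({a, b} : Finset α) = {c, d} ↔ a = c ∧ b = d ∨ a = d ∧ b = c := by
  rw [← coe_inj]
  simp [Set.pair_eq_pair_iff]

lemma cycle_edge_injective {k : ℕ} [NeZero k] (hk : 3 ≤ k) {x : ZMod k → F}
    (hx : Function.Injective x) :
    Function.Injective (fun i => ({x i, x (i + 1)} : Finset F)) := by
  intro i j h
  rcases pair_eq_pair_iff.1 h with h | h
  · exact hx h.1
  · have h1 := hx h.1
    have h2 := hx h.2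
    rw [h1] at h2
    exact absurd h2 (cycle_ne_two hk j)

lemma card_cycleEdges {k : ℕ} [NeZero k] (hk : 3 ≤ k) {x : ZMod k → F}
    (hx : Function.Injective x) : #(cycleEdges x) = k := by
  rw [cycleEdges, card_image_of_injective _ (cycle_edge_injective hk hx), card_univ, ZMod.card]

lemma card_of_mem_cycleEdges {k : ℕ} [NeZero k] (hk : 3 ≤ k) {x : ZMod k → F}
    (hx : Function.Injective x) {e : Finset F} (he : e ∈ cycleEdges x) : #e = 2 := by
  obtain ⟨i, rfl⟩ := mem_cycleEdges.1 he
  exact card_pair (fun h => cycle_ne hk i (hx h).symm)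

/-- A facet `x j` is on the edges with index `j` and `j - 1` and no others; a facet off the cycle is
on none. -/
lemma even_cycleEdges {k : ℕ} [NeZero k] (hk : 3 ≤ k) {x : ZMod k → F}
    (hx : Function.Injective x) (z : F) : Even #{e ∈ cycleEdges x | z ∈ e} := by
  have h : ({e ∈ cycleEdges x | z ∈ e} : Finset _) =
      ({i | z = x i ∨ z = x (i + 1)} : Finset (ZMod k)).image fun i => {x i, x (i + 1)} := by
    ext e
    simp only [mem_filter, mem_cycleEdges, mem_image, mem_univ, true_and]
    constructor
    · rintro ⟨⟨i, rfl⟩, hz⟩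
      exact ⟨i, by simpa using hz, rfl⟩
    · rintro ⟨i, hz, rfl⟩
      exact ⟨⟨i, rfl⟩, by simpa using hz⟩
  rw [h, card_image_of_injective _ (cycle_edge_injective hk hx)]
  by_cases hz : ∃ j, x j = z
  · obtain ⟨j, rfl⟩ := hz
    have : ({i | x j = x i ∨ x j = x (i + 1)} : Finset (ZMod k)) = {j, j - 1} := by
      ext i
      simp only [mem_filter, mem_univ, true_and, mem_insert, mem_singleton, hx.eq_iff]
      exact or_congr eq_comm ⟨fun h => eq_sub_of_add_eq h.symm, fun h => by rw [h]; simp⟩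
    rw [this, card_pair]
    · exact even_two
    · intro h
      exact cycle_ne hk j (by nth_rewrite 1 [h]; simp)
  · push Not at hz
    rw [filter_false_of_mem]
    · simp
    · rintro i - (h | h)
      · exact hz _ h.symm
      · exact hz _ h.symm

lemma cycleEdges_shift {k : ℕ} [NeZero k] (x : ZMod k → F) (a : ZMod k) :
    cycleEdges (fun i => x (i + a)) = cycleEdges x := by
  ext e
  simp only [mem_cycleEdges]
  constructor
  · rintro ⟨i, rfl⟩
    exact ⟨i + a, by rw [add_right_comm]⟩
  · rintro ⟨i, rfl⟩
    exact ⟨i - a, by rw [add_right_comm, sub_add_cancel]⟩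

/-- By parity there is a second edge of `S` at `b`, so a walk can always be continued without
backtracking. -/
lemma exists_next {S : Finset (Finset F)} (h2 : ∀ e ∈ S, #e = 2)
    (heven : ∀ z, Even #{e ∈ S | z ∈ e}) {a b : F} (hab : ({a, b} : Finset F) ∈ S) :
    ∃ c, c ≠ a ∧ c ≠ b ∧ ({b, c} : Finset F) ∈ S := by
  have hmem : ({a, b} : Finset F) ∈ ({e ∈ S | b ∈ e} : Finset _) := by simp [hab]
  have h1 : 2 ≤ #{e ∈ S | b ∈ e} := by
    obtain ⟨m, hm⟩ := heven b
    have := card_pos.2 ⟨_, hmem⟩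
    omega
  obtain ⟨e, he, hne⟩ := exists_mem_ne (s := ({e ∈ S | b ∈ e} : Finset _)) (by omega)
    ({a, b} : Finset F)
  simp only [mem_filter] at he
  obtain ⟨p, q, hpq, rfl⟩ := card_eq_two.1 (h2 e he.1)
  have hb := he.2
  simp only [mem_insert, mem_singleton] at hb
  rcases hb with rfl | rfl
  · refine ⟨q, ?_, hpq.symm, he.1⟩
    rintro rfl
    exact hne (pair_comm _ _)
  · refine ⟨p, ?_, hpq, by rw [pair_comm]; exact he.1⟩
    rintro rfl
    exact hne rfl

/-- Continuing an edge twice by `exists_next` produces three different edges. -/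
lemma eq_empty_of_even_of_card_le_two {S : Finset (Finset F)} (h2 : ∀ e ∈ S, #e = 2)
    (heven : ∀ z, Even #{e ∈ S | z ∈ e}) (hS : #S ≤ 2) : S = ∅ := by
  by_contra hne
  obtain ⟨e, he⟩ := nonempty_iff_ne_empty.2 hne
  obtain ⟨a, b, hab, rfl⟩ := card_eq_two.1 (h2 e he)
  obtain ⟨c, hca, hcb, hc⟩ := exists_next h2 heven he
  obtain ⟨d, hdb, hdc, hd⟩ := exists_next h2 heven hc
  have h3 : ({{a, b}, {b, c}, {c, d}} : Finset (Finset F)) ⊆ S := by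
    intro e he'
    simp only [mem_insert, mem_singleton] at he'
    rcases he' with rfl | rfl | rfl <;> assumption
  have h4 : #({{a, b}, {b, c}, {c, d}} : Finset (Finset F)) = 3 := by
    rw [card_eq_three]
    refine ⟨_, _, _, ?_, ?_, ?_, rfl⟩ <;> rw [Ne, pair_eq_pair_iff] <;> grind
  have := card_le_card h3
  omega

/-- An even edge set containing a cycle with at most two more edges is that cycle. -/
lemma eq_cycleEdges {k : ℕ} [NeZero k] (hk : 3 ≤ k) {x : ZMod k → F}
    (hx : Function.Injective x) {S : Finset (Finset F)} (h2 : ∀ e ∈ S, #e = 2)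
    (heven : ∀ z, Even #{e ∈ S | z ∈ e}) (hsub : ∀ i, ({x i, x (i + 1)} : Finset F) ∈ S)
    (hS : #S ≤ k + 2) : S = cycleEdges x := by
  have hsub' : cycleEdges x ⊆ S := by
    intro e he
    obtain ⟨i, rfl⟩ := mem_cycleEdges.1 he
    exact hsub i
  have h0 : S \ cycleEdges x = ∅ := by
    refine eq_empty_of_even_of_card_le_two (fun e he => h2 e (mem_sdiff.1 he).1) (fun z => ?_) ?_
    · have h3 : ({e ∈ S \ cycleEdges x | z ∈ e} : Finset _) =
          ({e ∈ S | z ∈ e} : Finset _) \ ({e ∈ cycleEdges x | z ∈ e} : Finset _) := by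
        ext e
        simp only [mem_filter, mem_sdiff]
        grind
      rw [h3, card_sdiff_of_subset (filter_subset_filter _ hsub')]
      exact (heven z).tsub (even_cycleEdges hk hx z)
    · rw [card_sdiff_of_subset hsub', card_cycleEdges hk hx]
      omega
  exact (sdiff_eq_empty_iff_subset.1 h0).antisymm hsub'

omit [DecidableEq F] in
lemma exists_three_cycle {a b c : F} (hab : a ≠ b) (hbc : b ≠ c) (hca : c ≠ a) :
    ∃ x : ZMod 3 → F, Function.Injective x ∧ x 0 = a ∧ x 1 = b ∧ x 2 = c := by
  refine ⟨(![a, b, c] : Fin 3 → F), ?_, rfl, rfl, rfl⟩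
  intro i j hij
  fin_cases i <;> fin_cases j <;> first | rfl | (exfalso; revert hij; simp [*, Ne.symm])

omit [DecidableEq F] in
lemma exists_four_cycle {a b c d : F} (hab : a ≠ b) (hbc : b ≠ c) (hcd : c ≠ d) (hda : d ≠ a)
    (hac : a ≠ c) (hbd : b ≠ d) :
    ∃ x : ZMod 4 → F, Function.Injective x ∧ x 0 = a ∧ x 1 = b ∧ x 2 = c ∧ x 3 = d := by
  refine ⟨(![a, b, c, d] : Fin 4 → F), ?_, rfl, rfl, rfl, rfl⟩
  intro i j hij
  fin_cases i <;> fin_cases j <;> first | rfl | (exfalso; revert hij; simp [*, Ne.symm])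

omit [DecidableEq F] in
lemma exists_five_cycle {a b c d e : F} (h : [a, b, c, d, e].Nodup) :
    ∃ x : ZMod 5 → F, Function.Injective x ∧ x 0 = a ∧ x 1 = b ∧ x 2 = c ∧ x 3 = d ∧ x 4 = e := by
  refine ⟨(![a, b, c, d, e] : Fin 5 → F), ?_, rfl, rfl, rfl, rfl, rfl⟩
  simp only [List.nodup_cons, List.mem_cons, not_or, List.not_mem_nil] at h
  obtain ⟨⟨h1, h2, h3, h4, -⟩, ⟨h5, h6, h7, -⟩, ⟨h8, h9, -⟩, ⟨h10, -⟩, -⟩ := h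
  intro i j hij
  fin_cases i <;> fin_cases j <;> first | rfl | (exfalso; revert hij; simp [*, Ne.symm])

lemma zmod_three_cases (i : ZMod 3) : i = 0 ∨ i = 1 ∨ i = 2 := by revert i; decide

lemma zmod_four_cases (i : ZMod 4) : i = 0 ∨ i = 1 ∨ i = 2 ∨ i = 3 := by revert i; decide

lemma cycleEdges_three (x : ZMod 3 → F) :
    cycleEdges x = {{x 0, x 1}, {x 1, x 2}, {x 2, x 0}} := by
  have : (univ : Finset (ZMod 3)) = {0, 1, 2} := by decide
  rw [cycleEdges, this]
  simp only [image_insert, image_singleton]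
  rfl

lemma cycleEdges_four (x : ZMod 4 → F) :
    cycleEdges x = {{x 0, x 1}, {x 1, x 2}, {x 2, x 3}, {x 3, x 0}} := by
  have : (univ : Finset (ZMod 4)) = {0, 1, 2, 3} := by decide
  rw [cycleEdges, this]
  simp only [image_insert, image_singleton]
  rfl

lemma cycleEdges_five (x : ZMod 5 → F) :
    cycleEdges x = {{x 0, x 1}, {x 1, x 2}, {x 2, x 3}, {x 3, x 4}, {x 4, x 0}} := by
  have : (univ : Finset (ZMod 5)) = {0, 1, 2, 3, 4} := by decide
  rw [cycleEdges, this]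
  simp only [image_insert, image_singleton]
  rfl

lemma forall_cycle_edge_mem {k : ℕ} [NeZero k] {x : ZMod k → F} {S : Finset (Finset F)}
    (h : cycleEdges x ⊆ S) (i : ZMod k) : {x i, x (i + 1)} ∈ S :=
  h (mem_cycleEdges.2 ⟨i, rfl⟩)

set_option maxHeartbeats 1000000 in
/-- A nonempty even edge set with at most five edges is a cycle. -/
lemma exists_cycle_of_even {S : Finset (Finset F)} (h2 : ∀ e ∈ S, #e = 2)
    (heven : ∀ z, Even #{e ∈ S | z ∈ e}) (hne : S.Nonempty) (hS : #S ≤ 5) :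
    (∃ x : ZMod 3 → F, Function.Injective x ∧ S = cycleEdges x) ∨
    (∃ x : ZMod 4 → F, Function.Injective x ∧ S = cycleEdges x) ∨
    (∃ x : ZMod 5 → F, Function.Injective x ∧ S = cycleEdges x) := by
  have tri : ∀ a b c : F, a ≠ b → b ≠ c → c ≠ a → {a, b} ∈ S → {b, c} ∈ S → {c, a} ∈ S →
      ∃ x : ZMod 3 → F, Function.Injective x ∧ S = cycleEdges x ∧
        S = {{a, b}, {b, c}, {c, a}} := by
    intro a b c hab hbc hca h1 h3 h4
    obtain ⟨x, hx, rfl, rfl, rfl⟩ := exists_three_cycle hab hbc hca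
    have heq := eq_cycleEdges (k := 3) le_rfl hx h2 heven
      (forall_cycle_edge_mem (by simp [cycleEdges_three, insert_subset_iff, *])) (by omega)
    exact ⟨x, hx, heq, by rw [← cycleEdges_three]; exact heq⟩
  have quad : ∀ a b c d : F, a ≠ b → b ≠ c → c ≠ d → d ≠ a → a ≠ c → b ≠ d →
      {a, b} ∈ S → {b, c} ∈ S → {c, d} ∈ S → {d, a} ∈ S →
      ∃ x : ZMod 4 → F, Function.Injective x ∧ S = cycleEdges x ∧
        S = {{a, b}, {b, c}, {c, d}, {d, a}} := by
    intro a b c d hab hbc hcd hda hac hbd h1 h3 h4 h5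
    obtain ⟨x, hx, rfl, rfl, rfl, rfl⟩ := exists_four_cycle hab hbc hcd hda hac hbd
    have heq := eq_cycleEdges (k := 4) (by omega) hx h2 heven
      (forall_cycle_edge_mem (by simp [cycleEdges_four, insert_subset_iff, *])) (by omega)
    exact ⟨x, hx, heq, by rw [← cycleEdges_four]; exact heq⟩
  obtain ⟨e, he⟩ := hne
  obtain ⟨a, b, hab, rfl⟩ := card_eq_two.1 (h2 e he)
  obtain ⟨c, hca, hcb, hc⟩ := exists_next h2 heven he
  obtain ⟨d, hdb, hdc, hd⟩ := exists_next h2 heven hc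
  by_cases hda : d = a
  · subst hda
    obtain ⟨x, hx, h, -⟩ := tri d b c hab hcb.symm hca he hc hd
    exact Or.inl ⟨x, hx, h⟩
  obtain ⟨e, hec, hed, he'⟩ := exists_next h2 heven hd
  by_cases hea : e = a
  · subst hea
    obtain ⟨x, hx, h, -⟩ := quad e b c d hab hcb.symm hdc.symm hda hca.symm hdb.symm he hc hd he'
    exact Or.inr (Or.inl ⟨x, hx, h⟩)
  -- If the walk closes up behind its start, the cycle found is already all of `S`, and the starting
  -- edge `{a, b}` is not on it. The later cases of this kind are alike.
  by_cases heb : e = b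
  · subst heb
    obtain ⟨x, hx, -, h⟩ := tri e c d hcb.symm hdc.symm hdb hc hd he'
    rw [h] at he
    simp only [mem_insert, mem_singleton, pair_eq_pair_iff] at he
    grind
  obtain ⟨f, hfd, hfe, hf⟩ := exists_next h2 heven he'
  by_cases hfb : f = b
  · subst hfb
    obtain ⟨x, hx, -, h⟩ := quad f c d e hcb.symm hdc.symm hed.symm heb hdb.symm hec.symm hc hd
      he' hf
    rw [h] at he
    simp only [mem_insert, mem_singleton, pair_eq_pair_iff] at he
    grind
  by_cases hfc : f = c
  · subst hfc
    obtain ⟨x, hx, -, h⟩ := tri f d e hdc.symm hed.symm hec hd he' hf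
    rw [h] at he
    simp only [mem_insert, mem_singleton, pair_eq_pair_iff] at he
    grind
  by_cases hfa : f = a
  · subst hfa
    obtain ⟨x, hx, rfl, rfl, rfl, rfl, rfl⟩ := exists_five_cycle (a := f) (b := b) (c := c)
      (d := d) (e := e) (by simp; grind)
    refine Or.inr (Or.inr ⟨x, hx, ?_⟩)
    exact eq_cycleEdges (k := 5) (by omega) hx h2 heven
      (forall_cycle_edge_mem (by simp [cycleEdges_five, insert_subset_iff, *])) (by omega)
  exfalso
  -- An open path of five edges uses up `S`, yet parity at its start `a` demands another edge there.
  obtain ⟨g, hgb, hga, hg⟩ := exists_next h2 heven (by rwa [pair_comm] : ({b, a} : Finset F) ∈ S)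
  have h5 : ({{a, b}, {b, c}, {c, d}, {d, e}, {e, f}} : Finset (Finset F)) ⊆ S := by
    simp [insert_subset_iff, *]
  have h6 : #({{a, b}, {b, c}, {c, d}, {d, e}, {e, f}} : Finset (Finset F)) = 5 := by
    rw [card_insert_of_notMem, card_insert_of_notMem, card_insert_of_notMem, card_pair] <;>
    simp only [mem_insert, mem_singleton, pair_eq_pair_iff, Ne] <;> grind
  rw [← eq_of_subset_of_card_le h5 (by omega)] at hg
  simp only [mem_insert, mem_singleton, pair_eq_pair_iff] at hg
  grind

end Cycles

variable {F V : Type*} [Fintype F] [Fintype V] [DecidableEq F] [DecidableEq V]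
  {K : TriangulatedSphere F V}

/-! ### Regions bounded by a cycle -/

section Region

variable {k : ℕ} [NeZero k] {x : ZMod k → F} {T : Finset V}

lemma exists_mem_notMem_of_cycle (hT : K.bd T = cycleEdges x) (i : ZMod k) :
    ∃ v ∈ T, ∃ w ∉ T, {x i, x (i + 1)} ⊆ K.inc v ∧ {x i, x (i + 1)} ⊆ K.inc w :=
  exists_of_mem_bd (by rw [hT]; exact mem_cycleEdges.2 ⟨i, rfl⟩)

lemma notMem_inner_of_cycle (hT : K.bd T = cycleEdges x) (i : ZMod k) : x i ∉ K.inner T := by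
  intro h
  obtain ⟨v, -, w, hw, -, hiw⟩ := exists_mem_notMem_of_cycle hT i
  exact hw (mem_inner.1 h (mem_star.2 (hiw (by simp))))

/-- The triangles around `y` are linked through edges at `y`, none of which is on the cycle; hence
they are all on one side. -/
lemma mem_inner_or_of_notMem_cycle (hT : K.bd T = cycleEdges x) {y : F} (hy : ∀ i, x i ≠ y) :
    y ∈ K.inner T ∨ y ∈ K.inner Tᶜ := by
  rw [mem_inner, mem_inner]
  refine star_subset_or_disjoint fun e he hye => ?_
  rw [hT] at he
  obtain ⟨i, rfl⟩ := mem_cycleEdges.1 he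
  simp only [mem_insert, mem_singleton] at hye
  rcases hye with rfl | rfl
  · exact hy _ rfl
  · exact hy _ rfl

lemma mem_inner_or_of_mem (hT : K.bd T = cycleEdges x) {v : V} (hv : v ∈ T) {y : F}
    (hy : y ∈ K.inc v) : y ∈ K.inner T ∨ ∃ i, x i = y := by
  by_cases h : ∃ i, x i = y
  · exact Or.inr h
  · push Not at h
    refine Or.inl ((mem_inner_or_of_notMem_cycle hT h).resolve_right fun h' => ?_)
    have := mem_inner.1 h' (mem_star.2 hy)
    simp [hv] at this

lemma disjoint_inner_image (hT : K.bd T = cycleEdges x) :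
    Disjoint (K.inner T) (univ.image x) := by
  rw [disjoint_left]
  intro y hy hy'
  obtain ⟨i, -, rfl⟩ := mem_image.1 hy'
  exact notMem_inner_of_cycle hT i hy

lemma disjoint_inner_inner_compl (T : Finset V) : Disjoint (K.inner T) (K.inner Tᶜ) := by
  rw [disjoint_left]
  intro y hy hy'
  obtain ⟨v, hv⟩ := star_nonempty (K := K) y
  have := mem_inner.1 hy' hv
  simp [mem_inner.1 hy hv] at this

lemma card_inner_add_card_inner_compl (hx : Function.Injective x) (hT : K.bd T = cycleEdges x) :
    #(K.inner T) + #(K.inner Tᶜ) + k = Fintype.card F := by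
  have hT' : K.bd Tᶜ = cycleEdges x := by rw [bd_compl, hT]
  have h : (univ : Finset F) = (K.inner T ∪ K.inner Tᶜ) ∪ univ.image x := by
    ext y
    simp only [mem_univ, mem_union, mem_image, true_and, true_iff]
    by_cases hy : ∃ i, x i = y
    · exact Or.inr hy
    · push Not at hy
      exact Or.inl (mem_inner_or_of_notMem_cycle hT hy)
  rw [← card_univ, h, card_union_of_disjoint, card_union_of_disjoint,
    card_image_of_injective _ hx, card_univ, ZMod.card]
  · exact disjoint_inner_inner_compl T
  · exact disjoint_union_left.2 ⟨disjoint_inner_image hT, disjoint_inner_image hT'⟩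

/-- One half of Euler's formula for a disc: the complex of inner and cycle facets is connected and
proper, so `card_add_card_le` applies. -/
lemma two_mul_card_inner_add_le (hk : 3 ≤ k) (hx : Function.Injective x)
    (hT : K.bd T = cycleEdges x) : 2 * #(K.inner T) + k ≤ #T + 2 := by
  have h1 : #(K.inner T ∪ univ.image x) + #T ≤ #(K.edges T) + 1 := by
    refine card_add_card_le ?_ ?_ ?_
    · obtain ⟨v, -, w, hw, -⟩ := exists_mem_notMem_of_cycle hT 0
      rintro rfl
      simp at hw
    · intro v hv y hy
      simpa using mem_inner_or_of_mem hT hv hy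
    · intro g hg
      have hstep : ∀ i, g (x (i + 1)) = g (x i) := by
        intro i
        obtain ⟨v, hv, w, hw, hiv, -⟩ := exists_mem_notMem_of_cycle hT i
        refine hg {x i, x (i + 1)} (mem_edges.2 ⟨?_, v, hv, hiv⟩) _ (by simp) _ (by simp)
        exact card_of_mem_cycleEdges hk hx (mem_cycleEdges.2 ⟨i, rfl⟩)
      have hx0 : ∀ i, g (x i) = g (x 0) := by
        have : ∀ n : ℕ, g (x n) = g (x 0) := by
          intro n
          induction n with
          | zero => simp
          | succ n ih => rw [Nat.cast_succ, hstep, ih]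
        intro i
        rw [← ZMod.natCast_zmod_val i]
        exact this _
      -- To see that the region is connected, extend `g` by its common value on the cycle to all
      -- facets outside; the extension is constant along every edge of the sphere.
      have hg' := eq_of_forall_edge (K := K)
        (fun z => if z ∈ K.inner T then g z else g (x 0)) ?_
      · have key : ∀ z ∈ K.inner T ∪ univ.image x, g z = g (x 0) := by
          intro z hz
          simp only [mem_union, mem_image, mem_univ, true_and] at hz
          rcases hz with hz | ⟨i, rfl⟩
          · have := hg' z (x 0)
            simpa [hz, notMem_inner_of_cycle hT] using this
          · exact hx0 i
        intro y hy z hz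
        rw [key y hy, key z hz]
      · have half : ∀ e ∈ K.edges univ, ∀ z ∈ e, ∀ w ∈ e, z ∈ K.inner T →
            g z = if w ∈ K.inner T then g w else g (x 0) := by
          intro e he z hz w hw hzT
          obtain ⟨he2, v, -, hev⟩ := mem_edges.1 he
          have hv : v ∈ T := mem_inner.1 hzT (mem_star.2 (hev hz))
          rw [hg e (mem_edges.2 ⟨he2, v, hv, hev⟩) z hz w hw]
          split_ifs with hwT
          · rfl
          · obtain ⟨i, rfl⟩ := (mem_inner_or_of_mem hT hv (hev hw)).resolve_left hwT
            exact hx0 i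
        intro e he z hz w hw
        by_cases hzT : z ∈ K.inner T
        · simp only [hzT, if_true]
          exact half e he z hz w hw hzT
        · by_cases hwT : w ∈ K.inner T
          · simp only [hwT, if_true]
            exact (half e he w hw z hz hwT).symm
          · simp [hzT, hwT]
  rw [card_union_of_disjoint (disjoint_inner_image hT), card_image_of_injective _ hx, card_univ,
    ZMod.card] at h1
  have h2 := two_mul_card_edges (K := K) T
  rw [hT, card_cycleEdges hk hx] at h2
  omega

/-- Euler's formula for a disc. -/
lemma card_add_two_eq (hk : 3 ≤ k) (hx : Function.Injective x)
    (hT : K.bd T = cycleEdges x) : #T + 2 = 2 * #(K.inner T) + k := by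
  -- The inequalities for the two sides add up to Euler's formula of the sphere, so both are
  -- equalities.
  have h1 := two_mul_card_inner_add_le hk hx hT
  have h2 := two_mul_card_inner_add_le hk hx (T := Tᶜ) (K := K) (by rw [bd_compl, hT])
  have h3 := card_inner_add_card_inner_compl hx hT
  have h4 := K.euler
  have h5 := card_add_card_compl T
  omega

end Region

end TriangulatedSphere

namespace TriangulatedSphere

variable {F V : Type*} [Fintype F] [Fintype V] [DecidableEq F] [DecidableEq V]
  {K : TriangulatedSphere F V}

/-! ### Belts -/

/-- A belt: an induced cycle which is not the boundary of a triangle. -/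
structure IsBelt (K : TriangulatedSphere F V) {k : ℕ} (x : ZMod k → F) : Prop where
  injective : Function.Injective x
  adj : ∀ i, K.Adj (x i) (x (i + 1))
  chordless : ∀ i j, K.Adj (x i) (x j) → j = i + 1 ∨ i = j + 1
  not_common : ¬ ∃ v, ∀ i, x i ∈ K.inc v

/-- The vertices of `T` at which exactly `j` facets are inside `T`. -/
def level (K : TriangulatedSphere F V) (T : Finset V) (j : ℕ) : Finset V :=
  {v ∈ T | #(K.inc v ∩ K.inner T) = j}

/-- The vertices all of whose facets are inside `T`. -/
def core (K : TriangulatedSphere F V) (T : Finset V) : Finset V :=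
  {v | K.inc v ⊆ K.inner T}

lemma mem_core {T : Finset V} {v : V} : v ∈ K.core T ↔ K.inc v ⊆ K.inner T := by simp [core]

lemma exists_mem_inc_of_vertex (v : V) : ∃ x, x ∈ K.inc v :=
  card_pos.1 (by rw [K.card_inc]; omega)

lemma core_subset (T : Finset V) : K.core T ⊆ T := fun v hv => by
  obtain ⟨x, hx⟩ := exists_mem_inc_of_vertex (K := K) v
  exact mem_inner.1 (mem_core.1 hv hx) (mem_star.2 hx)

lemma level_three_eq_core (T : Finset V) : K.level T 3 = K.core T := by
  ext v
  simp only [level, mem_filter, mem_core]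
  constructor
  · rintro ⟨-, h⟩
    have := eq_of_subset_of_card_le (inter_subset_left (s₁ := K.inc v) (s₂ := K.inner T))
      (by rw [K.card_inc, h])
    exact this ▸ inter_subset_right
  · intro h
    exact ⟨core_subset T (mem_core.2 h), by rw [inter_eq_left.2 h, K.card_inc]⟩

lemma adj_of_mem {v : V} {x y : F} (h : x ≠ y) (hx : x ∈ K.inc v) (hy : y ∈ K.inc v) :
    K.Adj x y := ⟨h, v, hx, hy⟩

lemma adj_of_mem_edges {T : Finset V} {x y : F} (h : {x, y} ∈ K.edges T) : K.Adj x y := by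
  obtain ⟨h2, v, -, hv⟩ := mem_edges.1 h
  refine ⟨?_, v, hv (by simp), hv (by simp)⟩
  rintro rfl
  simp at h2

lemma Adj.pair_mem_edges {x y : F} (h : K.Adj x y) : {x, y} ∈ K.edges univ := by
  obtain ⟨hne, v, hx, hy⟩ := h
  exact mem_edges.2 ⟨card_pair hne, v, mem_univ _, by simp [insert_subset_iff, hx, hy]⟩

/-- A boundary edge of the core has both facets inside `T`, so its triangle outside the core is
still in `T` and has exactly these two facets inside. This bounds the boundary length by the number
of triangles of level 2. -/
lemma bd_core_subset (T : Finset V) :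
    K.bd (K.core T) ⊆ (K.level T 2).image fun v => K.inc v ∩ K.inner T := by
  intro e he
  obtain ⟨w, hw, u, hu, hew, heu⟩ := exists_of_mem_bd he
  have he2 := card_eq_two_of_mem_bd he
  have hei := hew.trans (mem_core.1 hw)
  obtain ⟨z, hz⟩ := card_pos.1 (by omega : 0 < #e)
  have huT : u ∈ T := mem_inner.1 (hei hz) (mem_star.2 (heu hz))
  have hsub : e ⊆ K.inc u ∩ K.inner T := subset_inter heu hei
  have h3 : #(K.inc u ∩ K.inner T) ≠ 3 := by
    intro h
    refine hu ?_
    rw [← level_three_eq_core]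
    simp [level, huT, h]
  have h4 := card_le_card (inter_subset_left (s₁ := K.inc u) (s₂ := K.inner T))
  rw [K.card_inc] at h4
  have h5 := card_le_card hsub
  refine mem_image.2 ⟨u, ?_, (eq_of_subset_of_card_le hsub (by omega)).symm⟩
  simp only [level, mem_filter, huT, true_and]
  omega

lemma card_bd_core_le (T : Finset V) : #(K.bd (K.core T)) ≤ #(K.level T 2) :=
  (card_le_card (bd_core_subset T)).trans card_image_le

lemma sum_deg_inner (T : Finset V) :
    ∑ y ∈ K.inner T, K.deg y = ∑ v ∈ T, #(K.inc v ∩ K.inner T) := by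
  have h := sum_card_bipartiteAbove_eq_sum_card_bipartiteBelow (s := K.inner T) (t := T)
    (fun y v => y ∈ K.inc v)
  calc _ = ∑ y ∈ K.inner T, #{v ∈ T | y ∈ K.inc v} := by
        refine sum_congr rfl fun y hy => ?_
        rw [deg]
        congr 1
        ext v
        simp only [mem_star, mem_filter]
        exact ⟨fun h => ⟨mem_inner.1 hy (mem_star.2 h), h⟩, fun h => h.2⟩
    _ = _ := by
        refine h.trans (sum_congr rfl fun v _ => ?_)
        rw [bipartiteBelow]
        congr 1
        ext y
        simp [and_comm]

section Belt

variable {k : ℕ} [NeZero k] {x : ZMod k → F} {T : Finset V}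

/-- Three belt facets at one vertex would be pairwise successive. This forces `k = 3`, and then the
vertex lies on the whole belt. -/
lemma IsBelt.not_subset_range (hk : 3 ≤ k) (hx : K.IsBelt x) (v : V) :
    ∃ y ∈ K.inc v, ∀ i, x i ≠ y := by
  by_contra! h
  obtain ⟨a, b, c, hab, hac, hbc, habc⟩ := card_eq_three.1 (K.card_inc v)
  obtain ⟨i, rfl⟩ := h a (by simp [habc])
  obtain ⟨j, rfl⟩ := h b (by simp [habc])
  obtain ⟨l, rfl⟩ := h c (by simp [habc])
  have h1 := hx.chordless i j (adj_of_mem (v := v) hab (by simp [habc]) (by simp [habc]))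
  have h2 := hx.chordless i l (adj_of_mem (v := v) hac (by simp [habc]) (by simp [habc]))
  have h3 := hx.chordless j l (adj_of_mem (v := v) hbc (by simp [habc]) (by simp [habc]))
  have hij : i ≠ j := fun h => hab (by rw [h])
  have hil : i ≠ l := fun h => hac (by rw [h])
  have hjl : j ≠ l := fun h => hbc (by rw [h])
  -- The three differences are ±1 and sum to zero around the triangle; mixed signs would give `1 =
  -- 0`.
  have h30 : ((3 : ℕ) : ZMod k) = 0 := by
    push_cast
    rcases h1 with h1 | h1 <;> rcases h2 with h2 | h2 <;> rcases h3 with h3 | h3 <;> grind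
  have hk3 : k = 3 := by
    have := Nat.le_of_dvd (by omega) ((ZMod.natCast_eq_zero_iff 3 k).1 h30)
    omega
  subst hk3
  refine hx.not_common ⟨v, fun m => ?_⟩
  rw [habc]
  have key : ∀ i j l m : ZMod 3, i ≠ j → i ≠ l → j ≠ l → m = i ∨ m = j ∨ m = l := by decide
  have := key i j l m hij hil hjl
  rcases this with rfl | rfl | rfl <;> simp

lemma IsBelt.exists_inner (hk : 3 ≤ k) (hx : K.IsBelt x) (hT : K.bd T = cycleEdges x) {v : V}
    (hv : v ∈ T) : ∃ y ∈ K.inc v, y ∈ K.inner T := by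
  obtain ⟨y, hy, hne⟩ := hx.not_subset_range hk v
  refine ⟨y, hy, (mem_inner_or_of_mem hT hv hy).resolve_right ?_⟩
  rintro ⟨i, hi⟩
  exact hne i hi

/-- Removing the inner facet from such a triangle leaves two adjacent belt facets, which by
chordlessness form a belt edge. Conversely each belt edge lies on one triangle of `T`, whose third
facet is inside. -/
lemma IsBelt.card_level_one (hk : 3 ≤ k) (hx : K.IsBelt x) (hT : K.bd T = cycleEdges x) :
    #(K.level T 1) = k := by
  rw [← card_cycleEdges hk hx.injective, ← hT]
  have hcard : ∀ v, #(K.inc v \ K.inner T) + #(K.inc v ∩ K.inner T) = 3 := by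
    intro v
    rw [card_sdiff_add_card_inter, K.card_inc]
  refine card_bij (fun v _ => K.inc v \ K.inner T) ?_ ?_ ?_
  · intro v hv
    simp only [level, mem_filter] at hv
    have h2 : #(K.inc v \ K.inner T) = 2 := by have := hcard v; omega
    obtain ⟨a, b, hab, heq⟩ := card_eq_two.1 h2
    have ha : a ∈ K.inc v \ K.inner T := by simp [heq]
    have hb : b ∈ K.inc v \ K.inner T := by simp [heq]
    rw [mem_sdiff] at ha hb
    obtain ⟨i, rfl⟩ := (mem_inner_or_of_mem hT hv.1 ha.1).resolve_left ha.2
    obtain ⟨j, rfl⟩ := (mem_inner_or_of_mem hT hv.1 hb.1).resolve_left hb.2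
    rw [heq, hT, mem_cycleEdges]
    rcases hx.chordless i j (adj_of_mem hab ha.1 hb.1) with rfl | rfl
    · exact ⟨i, rfl⟩
    · exact ⟨j, pair_comm _ _⟩
  · intro v hv w hw h
    simp only [level, mem_filter] at hv hw
    by_contra hne
    have h2 : #(K.inc v \ K.inner T) = 2 := by have := hcard v; omega
    have hmem : K.inc v \ K.inner T ∈ K.bd T := by
      obtain ⟨a, b, hab, heq⟩ := card_eq_two.1 h2
      have ha : a ∈ K.inc v \ K.inner T := by simp [heq]
      have hb : b ∈ K.inc v \ K.inner T := by simp [heq]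
      rw [mem_sdiff] at ha hb
      obtain ⟨i, rfl⟩ := (mem_inner_or_of_mem hT hv.1 ha.1).resolve_left ha.2
      obtain ⟨j, rfl⟩ := (mem_inner_or_of_mem hT hv.1 hb.1).resolve_left hb.2
      rw [heq, hT, mem_cycleEdges]
      rcases hx.chordless i j (adj_of_mem hab ha.1 hb.1) with rfl | rfl
      · exact ⟨i, rfl⟩
      · exact ⟨j, pair_comm _ _⟩
    have := (mem_bd_iff h2 hne sdiff_subset (h ▸ sdiff_subset) T).1 hmem
    simp [hv.1, hw.1] at this
  · intro e he
    obtain ⟨v, hv, -, -, hev, -⟩ := exists_of_mem_bd he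
    have h2 := card_eq_two_of_mem_bd he
    have hsub : e ⊆ K.inc v \ K.inner T := by
      rw [hT] at he
      obtain ⟨i, rfl⟩ := mem_cycleEdges.1 he
      intro z hz
      refine mem_sdiff.2 ⟨hev hz, ?_⟩
      simp only [mem_insert, mem_singleton] at hz
      rcases hz with rfl | rfl <;> exact notMem_inner_of_cycle hT _
    obtain ⟨y, hy, hyi⟩ := hx.exists_inner hk hT hv
    have h1 : 0 < #(K.inc v ∩ K.inner T) := card_pos.2 ⟨y, mem_inter.2 ⟨hy, hyi⟩⟩
    have h3 := hcard v
    have h4 := card_le_card hsub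
    refine ⟨v, ?_, (eq_of_subset_of_card_le hsub (by omega)).symm⟩
    simp only [level, mem_filter, hv, true_and]
    omega

lemma IsBelt.card_levels (hk : 3 ≤ k) (hx : K.IsBelt x) (hT : K.bd T = cycleEdges x) :
    #T = #(K.level T 1) + #(K.level T 2) + #(K.level T 3) ∧
    ∑ v ∈ T, #(K.inc v ∩ K.inner T) =
      #(K.level T 1) + 2 * #(K.level T 2) + 3 * #(K.level T 3) := by
  have h : ∀ v ∈ T, #(K.inc v ∩ K.inner T) = 1 ∨ #(K.inc v ∩ K.inner T) = 2 ∨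
      #(K.inc v ∩ K.inner T) = 3 := by
    intro v hv
    obtain ⟨y, hy, hyi⟩ := hx.exists_inner hk hT hv
    have h1 : 0 < #(K.inc v ∩ K.inner T) := card_pos.2 ⟨y, mem_inter.2 ⟨hy, hyi⟩⟩
    have h4 := card_le_card (inter_subset_left (s₁ := K.inc v) (s₂ := K.inner T))
    rw [K.card_inc] at h4
    omega
  simp only [level, card_filter, mul_sum, ← sum_add_distrib]
  constructor
  · rw [card_eq_sum_ones]
    refine sum_congr rfl fun v hv => ?_
    rcases h v hv with h | h | h <;> simp [h]
  · refine sum_congr rfl fun v hv => ?_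
    rcases h v hv with h | h | h <;> simp [h]

/-- The counts in a disc bounded by a belt. -/
lemma IsBelt.count (hk : 3 ≤ k) (hx : K.IsBelt x) (hT : K.bd T = cycleEdges x) :
    #(K.level T 2) + #(K.core T) + 2 = 2 * #(K.inner T) ∧
    ∑ y ∈ K.inner T, K.deg y = k + 2 * #(K.level T 2) + 3 * #(K.core T) := by
  obtain ⟨h1, h2⟩ := hx.card_levels hk hT
  have h3 := card_add_two_eq hk hx.injective hT
  rw [hx.card_level_one hk hT, level_three_eq_core] at h1 h2
  exact ⟨by omega, (sum_deg_inner T).trans h2⟩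

lemma IsBelt.exists_region (hk : 3 ≤ k) (hx : K.IsBelt x) : ∃ T, K.bd T = cycleEdges x := by
  refine exists_bd_eq ?_ (even_cycleEdges hk hx.injective)
  intro e he
  obtain ⟨i, rfl⟩ := mem_cycleEdges.1 he
  exact (hx.adj i).pair_mem_edges

end Belt

/-! ### Short cycles which are not belts -/

/-- There are no `k`-belts. -/
def NoBelt (K : TriangulatedSphere F V) (k : ℕ) : Prop := ∀ x : ZMod k → F, ¬ K.IsBelt x

/-- Any two positions of a 3-cycle are successive, so the only belt condition that can fail is the
absence of a common vertex. -/
lemma exists_vertex_of_not_isBelt {x : ZMod 3 → F} (hx : Function.Injective x)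
    (hadj : ∀ i, K.Adj (x i) (x (i + 1))) (hb : ¬ K.IsBelt x) :
    ∃ v, K.inc v = {x 0, x 1, x 2} := by
  by_contra hv
  refine hb ⟨hx, hadj, ?_, ?_⟩
  · intro i j hij
    have : i ≠ j := fun h => hij.1 (by rw [h])
    clear hij
    revert i j
    decide
  · rintro ⟨v, h⟩
    refine hv ⟨v, (eq_of_subset_of_card_le ?_ ?_).symm⟩
    · simp [insert_subset_iff, h]
    · have hne : ∀ i j : ZMod 3, i ≠ j → x i ≠ x j := fun i j h h' => h (hx h')
      rw [K.card_inc, card_eq_three.2 ⟨_, _, _, hne 0 1 (by decide), hne 0 2 (by decide),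
        hne 1 2 (by decide), rfl⟩]

lemma NoBelt.exists_vertex (h3 : K.NoBelt 3) {a b c : F} (hab : K.Adj a b) (hbc : K.Adj b c)
    (hca : K.Adj c a) : ∃ v, K.inc v = {a, b, c} := by
  obtain ⟨x, hx, rfl, rfl, rfl⟩ := exists_three_cycle hab.1 hbc.1 hca.1
  refine exists_vertex_of_not_isBelt hx ?_ (h3 x)
  intro i
  rcases zmod_three_cases i with rfl | rfl | rfl
  exacts [hab, hbc, hca]

lemma diagonal_of_not_isBelt {x : ZMod 4 → F} (hx : Function.Injective x)
    (hadj : ∀ i, K.Adj (x i) (x (i + 1))) (hb : ¬ K.IsBelt x) :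
    K.Adj (x 0) (x 2) ∨ K.Adj (x 1) (x 3) := by
  by_contra! hv
  have hch : ∀ i j, K.Adj (x i) (x j) → j = i + 1 ∨ i = j + 1 := by
    intro i j hij
    have h1 : i ≠ j := fun h => hij.1 (by rw [h])
    rcases zmod_four_cases i with rfl | rfl | rfl | rfl <;>
    rcases zmod_four_cases j with rfl | rfl | rfl | rfl <;>
    first
    | exact absurd rfl h1
    | exact absurd hij hv.1
    | exact absurd hij hv.2
    | exact absurd hij.symm hv.1
    | exact absurd hij.symm hv.2
    | decide
  refine hb ⟨hx, hadj, hch, ?_⟩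
  rintro ⟨v, h⟩
  exact hv.1 (adj_of_mem (fun h => absurd (hx h) (by decide)) (h 0) (h 2))

lemma bd_singleton (v : V) : K.bd {v} = (K.inc v).powersetCard 2 := by
  ext e
  rw [mem_bd, mem_powersetCard, filter_singleton]
  by_cases h : e ⊆ K.inc v <;> simp [h]

lemma pair_mem_bd_singleton {v : V} {a b c : F} (h : K.inc v = {a, b, c}) {p q : F}
    (hpq : p ≠ q) : {p, q} ∈ K.bd {v} ↔ (p = a ∨ p = b ∨ p = c) ∧ (q = a ∨ q = b ∨ q = c) := by
  rw [bd_singleton, mem_powersetCard, h, card_pair hpq]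
  simp [insert_subset_iff]

/-- The slack of two is what gluing needs: a triangle and a `(k - 1)`-cycle have `k + 2` edges
altogether, and the shared chord need not be tracked. -/
lemma bd_eq_cycleEdges {k : ℕ} [NeZero k] (hk : 3 ≤ k) {x : ZMod k → F}
    (hx : Function.Injective x) {T : Finset V} (hsub : cycleEdges x ⊆ K.bd T)
    (hT : #(K.bd T) ≤ k + 2) : K.bd T = cycleEdges x :=
  eq_cycleEdges hk hx (fun _ => card_eq_two_of_mem_bd) (even_card_bd_filter T)
    (forall_cycle_edge_mem hsub) hT

lemma card_bd_singleton (v : V) : #(K.bd {v}) = 3 := by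
  rw [bd_singleton, card_powersetCard, K.card_inc]
  rfl

lemma card_symmDiff_le' {α : Type*} [DecidableEq α] (A B : Finset α) : #(A ∆ B) ≤ #A + #B := by
  rw [symmDiff_def]
  exact (card_union_le _ _).trans (add_le_add (card_le_card sdiff_subset)
    (card_le_card sdiff_subset))

lemma exists_filling_three {x : ZMod 3 → F} (hx : Function.Injective x)
    (hadj : ∀ i, K.Adj (x i) (x (i + 1))) (hb : ¬ K.IsBelt x) :
    ∃ T, #T ≤ 1 ∧ K.bd T = cycleEdges x := by
  obtain ⟨v, hv⟩ := exists_vertex_of_not_isBelt hx hadj hb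
  refine ⟨{v}, by simp, bd_eq_cycleEdges le_rfl hx ?_ (by rw [card_bd_singleton]; omega)⟩
  have h01 := (hadj 0).1
  have h12 := (hadj 1).1
  have h20 := (hadj 2).1
  rw [cycleEdges_three]
  simp only [insert_subset_iff, singleton_subset_iff]
  change x 0 ≠ x 1 at h01
  change x 1 ≠ x 2 at h12
  change x 2 ≠ x 0 at h20
  rw [pair_mem_bd_singleton hv h01, pair_mem_bd_singleton hv h12, pair_mem_bd_singleton hv h20]
  simp

/-- The diagonal splits the 4-cycle into two 3-cycles, each bounding a triangle since there are no
3-belts. -/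
lemma exists_filling_four_aux (h3 : K.NoBelt 3) {x : ZMod 4 → F} (hx : Function.Injective x)
    (hadj : ∀ i, K.Adj (x i) (x (i + 1))) (h02 : K.Adj (x 0) (x 2)) :
    ∃ T, #T ≤ 2 ∧ K.bd T = cycleEdges x := by
  have h01 : K.Adj (x 0) (x 1) := hadj 0
  have h12 : K.Adj (x 1) (x 2) := hadj 1
  have h23 : K.Adj (x 2) (x 3) := hadj 2
  have h30 : K.Adj (x 3) (x 0) := hadj 3
  have h13 : x 1 ≠ x 3 := fun h => absurd (hx h) (by decide)
  obtain ⟨v, hv⟩ := h3.exists_vertex h01 h12 h02.symm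
  obtain ⟨w, hw⟩ := h3.exists_vertex h02 h23 h30
  refine ⟨{v} ∆ {w}, (card_symmDiff_le' _ _).trans (by simp),
    bd_eq_cycleEdges (by omega) hx ?_ ?_⟩
  · rw [cycleEdges_four, bd_symmDiff]
    simp only [insert_subset_iff, singleton_subset_iff, mem_symmDiff,
      pair_mem_bd_singleton hv h01.1, pair_mem_bd_singleton hv h12.1,
      pair_mem_bd_singleton hv h23.1, pair_mem_bd_singleton hv h30.1,
      pair_mem_bd_singleton hw h01.1, pair_mem_bd_singleton hw h12.1,
      pair_mem_bd_singleton hw h23.1, pair_mem_bd_singleton hw h30.1]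
    have := h01.1; have := h12.1; have := h23.1; have := h30.1; have := h02.1
    grind
  · rw [bd_symmDiff]
    refine (card_symmDiff_le' _ _).trans ?_
    rw [card_bd_singleton, card_bd_singleton]

lemma exists_filling_four (h3 : K.NoBelt 3) {x : ZMod 4 → F} (hx : Function.Injective x)
    (hadj : ∀ i, K.Adj (x i) (x (i + 1))) (hb : ¬ K.IsBelt x) :
    ∃ T, #T ≤ 2 ∧ K.bd T = cycleEdges x := by
  rcases diagonal_of_not_isBelt hx hadj hb with h | h
  · exact exists_filling_four_aux h3 hx hadj h
  · obtain ⟨T, hT, hbd⟩ := exists_filling_four_aux h3 (x := fun i => x (i + 1))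
      (fun i j h => add_right_cancel (hx h)) (fun i => hadj (i + 1)) h
    exact ⟨T, hT, by rw [hbd, cycleEdges_shift]⟩

/-- The chord cuts off a triangle and leaves a 4-cycle, filled by at most two more triangles. -/
lemma exists_filling_five_aux (h3 : K.NoBelt 3) (h4 : K.NoBelt 4) {x : ZMod 5 → F}
    (hx : Function.Injective x) (hadj : ∀ i, K.Adj (x i) (x (i + 1)))
    (h02 : K.Adj (x 0) (x 2)) : ∃ T, #T ≤ 3 ∧ K.bd T = cycleEdges x := by
  have h01 : K.Adj (x 0) (x 1) := hadj 0
  have h12 : K.Adj (x 1) (x 2) := hadj 1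
  have h23 : K.Adj (x 2) (x 3) := hadj 2
  have h34 : K.Adj (x 3) (x 4) := hadj 3
  have h40 : K.Adj (x 4) (x 0) := hadj 4
  have hne : ∀ i j : ZMod 5, i ≠ j → x i ≠ x j := fun i j h h' => h (hx h')
  have h03 := hne 0 3 (by decide)
  have h13 := hne 1 3 (by decide)
  have h14 := hne 1 4 (by decide)
  have h24 := hne 2 4 (by decide)
  obtain ⟨v, hv⟩ := h3.exists_vertex h01 h12 h02.symm
  obtain ⟨y, hy, hy0, hy1, hy2, hy3⟩ := exists_four_cycle h02.1 h23.1 h34.1 h40.1 h03 h24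
  obtain ⟨T, hT, hbd⟩ := exists_filling_four h3 hy (by
    intro i
    rcases zmod_four_cases i with rfl | rfl | rfl | rfl
    · change K.Adj (y 0) (y 1); rwa [hy0, hy1]
    · change K.Adj (y 1) (y 2); rwa [hy1, hy2]
    · change K.Adj (y 2) (y 3); rwa [hy2, hy3]
    · change K.Adj (y 3) (y 0); rwa [hy3, hy0]) (h4 y)
  have hcard := card_cycleEdges (by omega) hy
  rw [← hbd] at hcard
  rw [cycleEdges_four, hy0, hy1, hy2, hy3] at hbd
  refine ⟨{v} ∆ T, (card_symmDiff_le' _ _).trans (by simp; omega),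
    bd_eq_cycleEdges (by omega) hx ?_ ?_⟩
  · rw [cycleEdges_five, bd_symmDiff, hbd]
    simp only [insert_subset_iff, singleton_subset_iff, mem_symmDiff,
      pair_mem_bd_singleton hv h01.1, pair_mem_bd_singleton hv h12.1,
      pair_mem_bd_singleton hv h23.1, pair_mem_bd_singleton hv h34.1,
      pair_mem_bd_singleton hv h40.1, mem_insert, mem_singleton, pair_eq_pair_iff]
    have := h01.1; have := h12.1; have := h23.1; have := h34.1; have := h40.1; have := h02.1
    grind
  · rw [bd_symmDiff]
    refine (card_symmDiff_le' _ _).trans ?_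
    rw [card_bd_singleton, hcard]

lemma exists_filling_five (h3 : K.NoBelt 3) (h4 : K.NoBelt 4) {x : ZMod 5 → F}
    (hx : Function.Injective x) (hadj : ∀ i, K.Adj (x i) (x (i + 1))) (hb : ¬ K.IsBelt x) :
    ∃ T, #T ≤ 3 ∧ K.bd T = cycleEdges x := by
  have hex : ∃ i, K.Adj (x i) (x (i + 2)) := by
    by_contra! hno
    refine hb ⟨hx, hadj, ?_, ?_⟩
    · intro i j hij
      have h1 : i ≠ j := fun h => hij.1 (by rw [h])
      have h2 : j ≠ i + 2 := fun h => hno i (h ▸ hij)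
      have h3 : i ≠ j + 2 := fun h => hno j (h ▸ hij.symm)
      clear hij
      revert i j
      decide
    · rintro ⟨v, h⟩
      exact hno 0 (adj_of_mem (fun h => absurd (hx h) (by decide)) (h 0) (h _))
  obtain ⟨i, hi⟩ := hex
  obtain ⟨T, hT, hbd⟩ := exists_filling_five_aux h3 h4 (x := fun j => x (j + i))
    (fun a b h => add_right_cancel (hx h))
    (fun j => by have := hadj (j + i); rwa [add_right_comm] at this)
    (by simpa [add_comm] using hi)
  exact ⟨T, hT, by rw [hbd, cycleEdges_shift]⟩

end TriangulatedSphere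

namespace TriangulatedSphere

variable {F V : Type*} [Fintype F] [Fintype V] [DecidableEq F] [DecidableEq V]
  {K : TriangulatedSphere F V}

/-! ### Fullerenes -/

/-- All facets are pentagons and hexagons. -/
def IsFullerene (K : TriangulatedSphere F V) : Prop := ∀ y, K.deg y = 5 ∨ K.deg y = 6

/-- The number of pentagons in a set of facets. -/
def pent (K : TriangulatedSphere F V) (S : Finset F) : ℕ := #{y ∈ S | K.deg y = 5}

lemma pent_le_card (S : Finset F) : K.pent S ≤ #S := card_filter_le _ _

lemma pent_mono {S S' : Finset F} (h : S ⊆ S') : K.pent S ≤ K.pent S' :=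
  card_le_card (filter_subset_filter _ h)

lemma pent_union {S S' : Finset F} (h : Disjoint S S') :
    K.pent (S ∪ S') = K.pent S + K.pent S' := by
  rw [pent, filter_union, card_union_of_disjoint (disjoint_filter_filter h)]
  rfl

lemma IsFullerene.sum_deg (hK : K.IsFullerene) (S : Finset F) :
    ∑ y ∈ S, K.deg y + K.pent S = 6 * #S := by
  rw [pent, card_filter, ← sum_add_distrib, mul_comm, ← smul_eq_mul, ← sum_const]
  refine sum_congr rfl fun y _ => ?_
  rcases hK y with h | h <;> simp [h]

lemma IsFullerene.pent_univ (hK : K.IsFullerene) : K.pent univ = 12 := by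
  have h1 := hK.sum_deg univ
  have h2 := sum_deg_inner (K := K) univ
  have h3 : K.inner univ = univ := by ext; simp [mem_inner]
  simp only [h3, inter_univ, K.card_inc, sum_const, smul_eq_mul, card_univ] at h1 h2
  have := K.euler
  omega

lemma inner_mono {S T : Finset V} (h : S ⊆ T) : K.inner S ⊆ K.inner T :=
  fun _ hy => mem_inner.2 ((mem_inner.1 hy).trans h)

lemma IsFullerene.pent_inner_compl (hK : K.IsFullerene) (T : Finset V) :
    K.pent (K.inner T) ≤ 6 ∨ K.pent (K.inner Tᶜ) ≤ 6 := by
  have h1 := pent_union (K := K) (disjoint_inner_inner_compl (K := K) T)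
  have h2 := pent_mono (K := K) (subset_univ (K.inner T ∪ K.inner Tᶜ))
  rw [hK.pent_univ] at h2
  omega

lemma mem_inner_of_mem_bd_core {T : Finset V} {e : Finset F} (he : e ∈ K.bd (K.core T)) {z : F}
    (hz : z ∈ e) : z ∈ K.inner T := by
  obtain ⟨w, hw, -, -, hew, -⟩ := exists_of_mem_bd he
  exact mem_core.1 hw (hew hz)

lemma cycle_mem_inner {j : ℕ} [NeZero j] {x : ZMod j → F} {T : Finset V}
    (h : K.bd (K.core T) = cycleEdges x) (i : ZMod j) : x i ∈ K.inner T :=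
  mem_inner_of_mem_bd_core (e := {x i, x (i + 1)}) (by rw [h]; exact mem_cycleEdges.2 ⟨i, rfl⟩)
    (by simp)

lemma adj_of_bd_eq {j : ℕ} [NeZero j] {x : ZMod j → F} {T : Finset V}
    (h : K.bd T = cycleEdges x) (i : ZMod j) : K.Adj (x i) (x (i + 1)) :=
  adj_of_mem_edges (T := T) (bd_subset_edges _ (by rw [h]; exact mem_cycleEdges.2 ⟨i, rfl⟩))

section

variable {k : ℕ} [NeZero k] {x : ZMod k → F} {T : Finset V}

/-- The middle equation controls the whole proof. It comes from comparing the degree sum inside, six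
times the number of facets minus the number of pentagons, with its count by levels. -/
lemma IsFullerene.count (hK : K.IsFullerene) (hk : 3 ≤ k) (hx : K.IsBelt x)
    (hT : K.bd T = cycleEdges x) :
    #(K.level T 2) + #(K.core T) + 2 = 2 * #(K.inner T) ∧
    K.pent (K.inner T) + k = 6 + #(K.level T 2) ∧ #T = k + #(K.level T 2) + #(K.core T) := by
  have h1 := hx.count hk hT
  have h2 := hK.sum_deg (K.inner T)
  have h3 := (hx.card_levels hk hT).1
  rw [hx.card_level_one hk hT, level_three_eq_core] at h3
  exact ⟨h1.1, by omega, h3⟩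

/-- A cycle bounding the core of a disc bounded by a belt does not bound few triangles. -/
lemma IsFullerene.false_of_filling (hK : K.IsFullerene) (hk : 3 ≤ k) (hk5 : k ≤ 5)
    (hx : K.IsBelt x) (hT : K.bd T = cycleEdges x) {j : ℕ} [NeZero j] (hj5 : j ≤ 5)
    {y : ZMod j → F} (hy : Function.Injective y)
    (hcore : K.bd (K.core T) = cycleEdges y) {T₀ : Finset V} (hT₀ : #T₀ + 2 ≤ j)
    (hbd : K.bd T₀ = cycleEdges y) : False := by
  obtain ⟨h1, h2, h3⟩ := hK.count hk hx hT
  have h4 := pent_le_card (K := K) (K.inner T)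
  have h5 : j ≤ #(K.inner T) := by
    have : univ.image y ⊆ K.inner T := by
      intro z hz
      obtain ⟨i, -, rfl⟩ := mem_image.1 hz
      exact cycle_mem_inner hcore i
    have := card_le_card this
    rwa [card_image_of_injective _ hy, card_univ, ZMod.card] at this
  -- If the filling is the core, the counts leave fewer than `j` inner facets, although the cycle
  -- alone has `j`. If it is the complement, it contains the at least five triangles around `x 0`,
  -- but it has at most three.
  rcases eq_or_eq_compl_of_bd_eq (hbd.trans hcore.symm) with rfl | rfl
  · omega
  · have h6 : K.star (x 0) ⊆ (K.core T)ᶜ := by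
      intro v hv
      rw [mem_compl, mem_core]
      exact fun h => notMem_inner_of_cycle hT 0 (h (mem_star.1 hv))
    have h7 := card_le_card h6
    have := hK (x 0)
    unfold deg at this
    omega

/-- At most six pentagons inside means at most `k` triangles of level 2, hence a core boundary of at
most `k` edges. It is empty, fillable (excluded by `false_of_filling`), or a belt; a belt shorter
than `k` is excluded by `hno`, and length `k` makes all inequalities sharp. -/
lemma IsFullerene.dichotomy (hK : K.IsFullerene) (hk : 3 ≤ k) (hk5 : k ≤ 5)
    (hno : ∀ j, 3 ≤ j → j < k → K.NoBelt j) (hx : K.IsBelt x) (hT : K.bd T = cycleEdges x)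
    (hp : K.pent (K.inner T) ≤ 6) :
    (k = 5 ∧ #(K.inner T) = 1) ∨
    ((∃ y : ZMod k → F, K.IsBelt y ∧ K.bd (K.core T) = cycleEdges y) ∧ #(K.level T 2) = k ∧
      K.pent (K.inner T) = 6) := by
  obtain ⟨h1, h2, h3⟩ := hK.count hk hx hT
  have h4 := pent_le_card (K := K) (K.inner T)
  rcases (K.bd (K.core T)).eq_empty_or_nonempty with h0 | hne
  · left
    rcases eq_empty_or_univ_of_bd_eq_empty h0 with h | h
    · rw [h, card_empty] at h1
      omega
    · obtain ⟨v, -, w, hw, -⟩ := exists_mem_notMem_of_cycle hT 0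
      exact absurd (core_subset (K := K) T (h ▸ mem_univ w)) hw
  · right
    have h5 := card_bd_core_le (K := K) T
    have final : ∀ (j : ℕ) [NeZero j], 3 ≤ j → ∀ y : ZMod j → F, Function.Injective y →
        K.bd (K.core T) = cycleEdges y → K.IsBelt y →
        ((∃ y : ZMod k → F, K.IsBelt y ∧ K.bd (K.core T) = cycleEdges y) ∧
          #(K.level T 2) = k ∧ K.pent (K.inner T) = 6) := by
      intro j _ hj y hy hbd hb
      have h6 := card_cycleEdges hj hy
      rw [← hbd] at h6
      have hjk : j = k := by
        by_contra h
        exact hno j hj (by omega) y hb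
      subst hjk
      exact ⟨⟨y, hb, by convert hbd⟩, by omega, by omega⟩
    rcases exists_cycle_of_even (fun _ => card_eq_two_of_mem_bd) (even_card_bd_filter (K.core T))
      hne (by omega) with ⟨y, hy, hbd⟩ | ⟨y, hy, hbd⟩ | ⟨y, hy, hbd⟩
    all_goals
      by_cases hb : K.IsBelt y
      · exact final _ (by norm_num) y hy hbd hb
      have h6 := card_cycleEdges (by norm_num) hy
      rw [← hbd] at h6
      exfalso
    · obtain ⟨T₀, hc, hbd₀⟩ := exists_filling_three hy (adj_of_bd_eq hbd) hb
      exact hK.false_of_filling hk hk5 hx hT (by norm_num) hy hbd (by omega) hbd₀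
    · obtain ⟨T₀, hc, hbd₀⟩ := exists_filling_four (hno 3 le_rfl (by omega)) hy
        (adj_of_bd_eq hbd) hb
      exact hK.false_of_filling hk hk5 hx hT (by norm_num) hy hbd (by omega) hbd₀
    · obtain ⟨T₀, hc, hbd₀⟩ := exists_filling_five (hno 3 le_rfl (by omega))
        (hno 4 (by omega) (by omega)) hy (adj_of_bd_eq hbd) hb
      exact hK.false_of_filling hk hk5 hx hT (by norm_num) hy hbd (by omega) hbd₀

/-- Infinite descent: the core is a strictly smaller disc bounded by a `k`-belt, still with at most
six pentagons inside, and the terminal case needs `k = 5`. -/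
lemma IsFullerene.noBelt_aux (hK : K.IsFullerene) (hk : 3 ≤ k) (hk4 : k ≤ 4)
    (hno : ∀ j, 3 ≤ j → j < k → K.NoBelt j) (n : ℕ) : ∀ (T : Finset V) (x : ZMod k → F), #T = n →
    K.IsBelt x → K.bd T = cycleEdges x → K.pent (K.inner T) ≤ 6 → False := by
  induction n using Nat.strong_induction_on with
  | _ n ih =>
    intro T x hn hx hT hp
    rcases hK.dichotomy hk (by omega) hno hx hT hp with ⟨h, -⟩ | ⟨⟨y, hy, hbd⟩, -⟩
    · omega
    · have := hK.count hk hx hT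
      exact ih #(K.core T) (by omega) (K.core T) y rfl hy hbd
        ((pent_mono (inner_mono (core_subset T))).trans hp)

lemma IsFullerene.noBelt_of (hK : K.IsFullerene) (hk : 3 ≤ k) (hk4 : k ≤ 4)
    (hno : ∀ j, 3 ≤ j → j < k → K.NoBelt j) : K.NoBelt k := by
  intro x hx
  obtain ⟨T, hT⟩ := hx.exists_region hk
  rcases hK.pent_inner_compl T with hp | hp
  · exact hK.noBelt_aux hk hk4 hno _ T x rfl hx hT hp
  · exact hK.noBelt_aux hk hk4 hno _ Tᶜ x rfl hx (by rw [bd_compl, hT]) hp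

end

lemma IsFullerene.noBelt_three (hK : K.IsFullerene) : K.NoBelt 3 :=
  hK.noBelt_of le_rfl (by omega) (by omega)

lemma IsFullerene.noBelt_four (hK : K.IsFullerene) : K.NoBelt 4 :=
  hK.noBelt_of (by omega) le_rfl fun j h1 h2 => by
    obtain rfl : j = 3 := by omega
    exact hK.noBelt_three

/-! ### Five-belts -/

/-- The number of vertices of a facet in `T`. -/
def degIn (K : TriangulatedSphere F V) (T : Finset V) (y : F) : ℕ := #{v ∈ T | y ∈ K.inc v}

section Five

variable {x : ZMod 5 → F} {T : Finset V}

lemma IsFullerene.five_dichotomy (hK : K.IsFullerene) (hx : K.IsBelt x)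
    (hT : K.bd T = cycleEdges x) (hp : K.pent (K.inner T) ≤ 6) :
    #(K.inner T) = 1 ∨
    ((∃ y : ZMod 5 → F, K.IsBelt y ∧ K.bd (K.core T) = cycleEdges y) ∧ #(K.level T 2) = 5 ∧
      K.pent (K.inner T) = 6) := by
  refine (hK.dichotomy (by omega) le_rfl ?_ hx hT hp).imp_left And.right
  intro j h1 h2
  obtain rfl | rfl : j = 3 ∨ j = 4 := by omega
  exacts [hK.noBelt_three, hK.noBelt_four]

/-- Count incidences of the belt with triangles of `T`: the five triangles of level 1 contribute two
each, those of level 2 one each. -/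
lemma IsBelt.sum_degIn (hx : K.IsBelt x) (hT : K.bd T = cycleEdges x) :
    ∑ i, K.degIn T (x i) = 10 + #(K.level T 2) := by
  have h1 : ∑ i, K.degIn T (x i) = ∑ v ∈ T, #(K.inc v \ K.inner T) := by
    have h := sum_card_bipartiteAbove_eq_sum_card_bipartiteBelow (s := univ) (t := T)
      (fun (i : ZMod 5) v => x i ∈ K.inc v)
    refine h.trans (sum_congr rfl fun v hv => ?_)
    rw [bipartiteBelow, ← card_image_of_injective _ hx.injective]
    congr 1
    ext y
    simp only [mem_image, mem_filter, mem_univ, true_and, mem_sdiff]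
    constructor
    · rintro ⟨i, hi, rfl⟩
      exact ⟨hi, notMem_inner_of_cycle hT i⟩
    · rintro ⟨hy, hyi⟩
      obtain ⟨i, rfl⟩ := (mem_inner_or_of_mem hT hv hy).resolve_left hyi
      exact ⟨i, hy, rfl⟩
  have h2 : ∑ v ∈ T, (#(K.inc v \ K.inner T) + #(K.inc v ∩ K.inner T)) = 3 * #T := by
    rw [mul_comm, ← smul_eq_mul, ← sum_const]
    refine sum_congr rfl fun v _ => ?_
    rw [card_sdiff_add_card_inter, K.card_inc]
  rw [sum_add_distrib, ← h1] at h2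
  obtain ⟨h3, h4⟩ := hx.card_levels (by omega) hT
  rw [hx.card_level_one (by omega) hT] at h3 h4
  omega

/-- The vertex of `T` on an edge of its boundary cycle. -/
lemma exists_vertex_on (hT : K.bd T = cycleEdges x) (i : ZMod 5) :
    ∃ v ∈ T, x i ∈ K.inc v ∧ x (i + 1) ∈ K.inc v := by
  obtain ⟨v, hv, -, -, hiv, -⟩ := exists_mem_notMem_of_cycle hT i
  exact ⟨v, hv, hiv (by simp), hiv (by simp)⟩

lemma IsBelt.not_three_mem (hx : K.IsBelt x) {v : V} {i : ZMod 5} (h1 : x i ∈ K.inc v)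
    (h2 : x (i + 1 + 1) ∈ K.inc v) : False := by
  have hne : x i ≠ x (i + 1 + 1) := fun h => cycle_ne_two (by omega) i (hx.injective h).symm
  have := hx.chordless _ _ (adj_of_mem hne h1 h2)
  clear h1 h2 hne
  revert i
  decide

lemma IsBelt.two_le_degIn (hx : K.IsBelt x) (hT : K.bd T = cycleEdges x) (i : ZMod 5) :
    2 ≤ K.degIn T (x (i + 1)) := by
  obtain ⟨v, hv, h1, h2⟩ := exists_vertex_on hT i
  obtain ⟨w, hw, h3, h4⟩ := exists_vertex_on hT (i + 1)
  have hvw : v ≠ w := by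
    rintro rfl
    exact hx.not_three_mem h1 h4
  rw [← card_pair hvw]
  refine card_le_card ?_
  simp [insert_subset_iff, *]

end Five

end TriangulatedSphere

/-! ### The layer between a 5-belt and the core of its disc. -/

namespace TriangulatedSphere

variable {F V : Type*} [Fintype F] [Fintype V] [DecidableEq F] [DecidableEq V]
  {K : TriangulatedSphere F V}

section Five

variable {x y : ZMod 5 → F} {T : Finset V}

/-- One inclusion is clear; Euler's formula for the two discs shows that the numbers of facets
agree. -/
lemma inner_eq_union (hK : K.IsFullerene) (hx : K.IsBelt x)
    (hT : K.bd T = cycleEdges x) (hy : K.IsBelt y) (hbd : K.bd (K.core T) = cycleEdges y)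
    (h5 : #(K.level T 2) = 5) :
    K.inner T = K.inner (K.core T) ∪ univ.image y ∧
      #(K.inner T) = #(K.inner (K.core T)) + 5 := by
  have h1 := (hK.count (by omega) hx hT).1
  have h2 := card_add_two_eq (by omega) hy.injective hbd
  have h3 : #(K.inner (K.core T) ∪ univ.image y) = #(K.inner (K.core T)) + 5 := by
    rw [card_union_of_disjoint (disjoint_inner_image hbd), card_image_of_injective _ hy.injective,
      card_univ, ZMod.card]
  have h4 : K.inner (K.core T) ∪ univ.image y ⊆ K.inner T := by
    refine union_subset (inner_mono (core_subset T)) ?_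
    intro z hz
    obtain ⟨i, -, rfl⟩ := mem_image.1 hz
    exact cycle_mem_inner hbd i
  have h6 : #(K.inner T) = #(K.inner (K.core T)) + 5 := by omega
  exact ⟨(eq_of_subset_of_card_le h4 (by omega)).symm, h6⟩

/-- The boundary facets of a disc have two or three vertices in the disc, according as the disc
has one inner facet or more. -/
def IsFlat (K : TriangulatedSphere F V) (T : Finset V) (x : ZMod 5 → F) : Prop :=
  ∀ i, K.degIn T (x i) = if #(K.inner T) = 1 then 2 else 3

/-- If the core has one inner facet, the six pentagons are all the six inner facets of `T`.
Otherwise six pentagons are already inside the core and none remains for its boundary. -/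
lemma deg_of_isFlat_core (hK : K.IsFullerene) (hx : K.IsBelt x) (hT : K.bd T = cycleEdges x)
    (hp : K.pent (K.inner T) = 6) (hy : K.IsBelt y) (hbd : K.bd (K.core T) = cycleEdges y)
    (h5 : #(K.level T 2) = 5) (i : ZMod 5) :
    K.deg (y i) = if #(K.inner (K.core T)) = 1 then 5 else 6 := by
  obtain ⟨h1, h2⟩ := inner_eq_union hK hx hT hy hbd h5
  split_ifs with h
  · have h3 : ({z ∈ K.inner T | K.deg z = 5} : Finset F) = K.inner T :=
      eq_of_subset_of_card_le (filter_subset _ _) (by unfold pent at hp; omega)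
    have h4 : y i ∈ ({z ∈ K.inner T | K.deg z = 5} : Finset F) := by
      rw [h3]
      exact cycle_mem_inner hbd i
    exact (mem_filter.1 h4).2
  · have hp' : K.pent (K.inner (K.core T)) ≤ 6 := hp ▸ pent_mono (inner_mono (core_subset T))
    have h3 := ((hK.five_dichotomy hy hbd hp').resolve_left h).2.2
    rw [h1, pent_union (disjoint_inner_image hbd), h3] at hp
    have h4 : K.pent (univ.image y) = 0 := by omega
    refine (hK (y i)).resolve_left fun h6 => ?_
    have : y i ∈ ({z ∈ univ.image y | K.deg z = 5} : Finset F) := by simp [h6]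
    rw [card_eq_zero.1 h4] at this
    simp at this

lemma inner_ne_cycle (hT : K.bd T = cycleEdges x) {X : F} (hX : X ∈ K.inner T) (i : ZMod 5) :
    X ≠ x i := by
  rintro rfl
  exact notMem_inner_of_cycle hT i hX

lemma inc_eq_of_mem {v : V} {a b c : F} (ha : a ∈ K.inc v) (hb : b ∈ K.inc v) (hc : c ∈ K.inc v)
    (hab : a ≠ b) (hac : a ≠ c) (hbc : b ≠ c) : K.inc v = {a, b, c} := by
  refine (eq_of_subset_of_card_le ?_ ?_).symm
  · simp [insert_subset_iff, *]
  · rw [K.card_inc, card_eq_three.2 ⟨a, b, c, hab, hac, hbc, rfl⟩]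

/-- The triangles on two successive boundary edges have different inner facets. -/
lemma inner_facet_ne (hK : K.IsFullerene) (hx : K.IsBelt x) (hT : K.bd T = cycleEdges x)
    (hp : K.pent (K.inner T) = 6) (hy : K.IsBelt y) (hbd : K.bd (K.core T) = cycleEdges y)
    (h5 : #(K.level T 2) = 5) (hflat : K.IsFlat (K.core T) y) {i : ZMod 5} {v w : V} {X : F}
    (hX : X ∈ K.inner T) (h1 : x i ∈ K.inc v) (h2 : x (i + 1) ∈ K.inc v) (h3 : X ∈ K.inc v)
    (h4 : x (i + 1) ∈ K.inc w) (h6 : x (i + 1 + 1) ∈ K.inc w) (h7 : X ∈ K.inc w) : False := by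
  have hvw : v ≠ w := by
    rintro rfl
    exact hx.not_three_mem h1 h6
  have hcore : ∀ u, ∀ j, x j ∈ K.inc u → u ∉ K.core T := fun u j h hu =>
    notMem_inner_of_cycle hT j (mem_core.1 hu h)
  have hXy : ∃ l, y (l + 1) = X := by
    rw [(inner_eq_union hK hx hT hy hbd h5).1, mem_union] at hX
    rcases hX with hX | hX
    · exact absurd (mem_inner.1 hX (mem_star.2 h3)) (hcore v i h1)
    · obtain ⟨l, -, rfl⟩ := mem_image.1 hX
      exact ⟨l - 1, by simp⟩
  obtain ⟨l, rfl⟩ := hXy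
  -- If both belt triangles had the same inner facet `X = y (l + 1)`, that facet would have four
  -- vertices outside the core: `v`, `w` and the outer triangles `c`, `d` on its two edges of the
  -- cycle `y`.
  obtain ⟨-, -, c, hc, -, hlc⟩ := exists_mem_notMem_of_cycle hbd l
  obtain ⟨-, -, d, hd, -, hld⟩ := exists_mem_notMem_of_cycle hbd (l + 1)
  have hcd : c ≠ d := by
    rintro rfl
    exact hy.not_three_mem (v := c) (i := l) (hlc (by simp)) (hld (by simp))
  -- A triangle on an edge of both cycles would have four facets; this separates `v`, `w` from `c`,
  -- `d`.
  have hfour : ∀ (u : V) (j m : ZMod 5), x j ∈ K.inc u → x (j + 1) ∈ K.inc u → y m ∈ K.inc u →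
      y (m + 1) ∈ K.inc u → False := by
    intro u j m ha hb hc hd
    have hin := fun m => cycle_mem_inner hbd m
    have hsub : ({x j, x (j + 1), y m, y (m + 1)} : Finset F) ⊆ K.inc u := by
      simp [insert_subset_iff, *]
    have hcard : #({x j, x (j + 1), y m, y (m + 1)} : Finset F) = 4 := by
      have e1 : x j ≠ x (j + 1) := (hx.adj j).1
      have e2 : y m ≠ y (m + 1) := (hy.adj m).1
      have e3 := inner_ne_cycle hT (hin m)
      have e4 := inner_ne_cycle hT (hin (m + 1))
      rw [card_insert_of_notMem, card_insert_of_notMem, card_pair e2]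
      · simp [(e3 _).symm, (e4 _).symm]
      · simp [e1, (e3 _).symm, (e4 _).symm]
    have := card_le_card hsub
    rw [K.card_inc] at this
    omega
  have hvc : v ≠ c := by
    rintro rfl
    exact hfour v i l h1 h2 (hlc (by simp)) (hlc (by simp))
  have hvd : v ≠ d := by
    rintro rfl
    exact hfour v i (l + 1) h1 h2 (hld (by simp)) (hld (by simp))
  have hwc : w ≠ c := by
    rintro rfl
    exact hfour w (i + 1) l h4 h6 (hlc (by simp)) (hlc (by simp))
  have hwd : w ≠ d := by
    rintro rfl
    exact hfour w (i + 1) (l + 1) h4 h6 (hld (by simp)) (hld (by simp))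
  have hsub : ({u ∈ K.core T | y (l + 1) ∈ K.inc u} : Finset V) ∪ {v, w, c, d} ⊆
      K.star (y (l + 1)) := by
    refine union_subset (fun u hu => mem_star.2 (mem_filter.1 hu).2) ?_
    have := hlc (by simp : y (l + 1) ∈ ({y l, y (l + 1)} : Finset F))
    have := hld (by simp : y (l + 1) ∈ ({y (l + 1), y (l + 1 + 1)} : Finset F))
    simp [insert_subset_iff, mem_star, *]
  have hdisj : Disjoint ({u ∈ K.core T | y (l + 1) ∈ K.inc u} : Finset V) {v, w, c, d} := by
    rw [disjoint_right]
    intro u hu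
    simp only [mem_insert, mem_singleton] at hu
    have : u ∉ K.core T := by
      rcases hu with rfl | rfl | rfl | rfl
      exacts [hcore _ i h1, hcore _ _ h4, hc, hd]
    simp [this]
  have hcard4 : #({v, w, c, d} : Finset V) = 4 := by
    rw [card_insert_of_notMem, card_insert_of_notMem, card_pair hcd] <;> simp [*]
  have h8 := card_le_card hsub
  rw [card_union_of_disjoint hdisj, hcard4] at h8
  have h9 := hflat (l + 1)
  have h10 := deg_of_isFlat_core hK hx hT hp hy hbd h5 (l + 1)
  unfold degIn at h9
  unfold deg at h10
  -- Flatness supplies two further vertices in the core where the degree is 5, or three where it is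
  -- 6, against the four outside.
  split_ifs at h9 h10 <;> omega

lemma exists_inner_facet (hx : K.IsBelt x) (hT : K.bd T = cycleEdges x) (i : ZMod 5) :
    ∃ v ∈ T, ∃ X ∈ K.inner T, K.inc v = {x i, x (i + 1), X} := by
  obtain ⟨v, hv, h1, h2⟩ := exists_vertex_on hT i
  obtain ⟨X, hX, hXi⟩ := hx.exists_inner (by omega) hT hv
  exact ⟨v, hv, X, hXi, inc_eq_of_mem h1 h2 hX (hx.adj i).1 (inner_ne_cycle hT hXi _).symm
    (inner_ne_cycle hT hXi _).symm⟩

lemma exists_other_of_inner {v : V} {a X : F} (ha : a ∈ K.inc v) (hX : X ∈ K.inc v) (haX : a ≠ X)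
    (hXi : X ∈ K.inner T) : ∃ u ∈ T, u ≠ v ∧ a ∈ K.inc u ∧ X ∈ K.inc u := by
  obtain ⟨u, huv, hu⟩ := exists_other (K := K) (e := {a, X}) (v := v) (card_pair haX)
    (by simp [insert_subset_iff, ha, hX])
  exact ⟨u, mem_inner.1 hXi (mem_star.2 (hu (by simp))), huv, hu (by simp), hu (by simp)⟩

/-- Induction along cores. The five values sum to 10 or 15 by `sum_degIn`, so it suffices that each
is at least 2 or 3. The third vertex exists because, by flatness of the core, neighbouring belt
triangles have different inner facets. -/
lemma IsFullerene.isFlat_aux (hK : K.IsFullerene) (n : ℕ) : ∀ (T : Finset V) (x : ZMod 5 → F),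
    #T = n → K.IsBelt x → K.bd T = cycleEdges x → K.pent (K.inner T) ≤ 6 → K.IsFlat T x := by
  induction n using Nat.strong_induction_on with
  | _ n ih =>
  intro T x hn hx hT hp
  have hcount := hK.count (by omega) hx hT
  have hsum := hx.sum_degIn hT
  have key : ∀ m, (∀ i, m ≤ K.degIn T (x i)) → ∑ i, K.degIn T (x i) = 5 * m →
      ∀ i, K.degIn T (x i) = m := by
    intro m hm hs i
    have h := (sum_eq_sum_iff_of_le (s := univ) (f := fun _ : ZMod 5 => m)
      (g := fun i => K.degIn T (x i)) (fun i _ => hm i)).1 (by rw [hs]; simp [ZMod.card])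
    exact (h i (mem_univ i)).symm
  by_cases h1 : #(K.inner T) = 1
  · intro i
    rw [if_pos h1]
    refine key 2 (fun i => ?_) (by omega) i
    have := hx.two_le_degIn hT (i - 1)
    rwa [sub_add_cancel] at this
  · obtain ⟨⟨y, hy, hbd⟩, h5, hp6⟩ := (hK.five_dichotomy hx hT hp).resolve_left h1
    have hflat := ih _ (by omega) (K.core T) y rfl hy hbd
      ((pent_mono (inner_mono (core_subset T))).trans hp)
    intro i
    rw [if_neg h1]
    refine key 3 (fun i => ?_) (by omega) i
    obtain ⟨v, hv, X, hX, hiv⟩ := exists_inner_facet hx hT (i - 1)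
    obtain ⟨w, hw, Y, hY, hiw⟩ := exists_inner_facet hx hT i
    rw [sub_add_cancel] at hiv
    obtain ⟨u, huT, huv, hxu, hXu⟩ := exists_other_of_inner (T := T) (a := x i) (v := v)
      (by simp [hiv]) (by simp [hiv]) (inner_ne_cycle hT hX _).symm hX
    have huw : u ≠ w := by
      rintro rfl
      refine inner_facet_ne hK hx hT hp6 hy hbd h5 hflat (i := i - 1) (v := v) (w := u) hX
        (by simp [hiv]) (by simp [hiv]) (by simp [hiv]) ?_ ?_ hXu
      · rwa [sub_add_cancel]
      · rw [sub_add_cancel, hiw]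
        simp
    have hvw : v ≠ w := by
      rintro rfl
      refine hx.not_three_mem (v := v) (i := i - 1) (by simp [hiv]) ?_
      rw [sub_add_cancel, hiw]
      simp
    rw [← card_eq_three.2 ⟨u, v, w, huv, huw, hvw, rfl⟩]
    refine card_le_card ?_
    simp [insert_subset_iff, huT, hv, hw, hxu]
    simp [hiv, hiw]

lemma IsFullerene.isFlat (hK : K.IsFullerene) (hx : K.IsBelt x) (hT : K.bd T = cycleEdges x)
    (hp : K.pent (K.inner T) ≤ 6) : K.IsFlat T x :=
  hK.isFlat_aux _ T x rfl hx hT hp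

/-- A cycle with the same edges as a belt is a belt. -/
lemma IsBelt.of_cycleEdges_eq (hy : K.IsBelt y) {z : ZMod 5 → F} (hz : Function.Injective z)
    (h : cycleEdges z = cycleEdges y) : K.IsBelt z := by
  have hr : ∀ i, ∃ a, y a = z i := by
    intro i
    have : ({z i, z (i + 1)} : Finset F) ∈ cycleEdges y := by
      rw [← h]
      exact mem_cycleEdges.2 ⟨i, rfl⟩
    obtain ⟨a, ha⟩ := mem_cycleEdges.1 this
    rcases pair_eq_pair_iff.1 ha with h | h
    exacts [⟨a, h.1⟩, ⟨a + 1, h.2⟩]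
  have hedge : ∀ i j, K.Adj (z i) (z j) ↔ {z i, z j} ∈ cycleEdges z := by
    intro i j
    obtain ⟨a, ha⟩ := hr i
    obtain ⟨b, hb⟩ := hr j
    rw [h, ← ha, ← hb]
    constructor
    · intro hab
      rcases hy.chordless a b hab with rfl | rfl
      · exact mem_cycleEdges.2 ⟨a, rfl⟩
      · exact mem_cycleEdges.2 ⟨b, pair_comm _ _⟩
    · intro hab
      obtain ⟨c, hc⟩ := mem_cycleEdges.1 hab
      rcases pair_eq_pair_iff.1 hc with h | h
      · rw [← h.1, ← h.2]
        exact hy.adj c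
      · rw [← h.1, ← h.2]
        exact (hy.adj c).symm
  have hch : ∀ i j, K.Adj (z i) (z j) → j = i + 1 ∨ i = j + 1 := by
    intro i j hij
    obtain ⟨c, hc⟩ := mem_cycleEdges.1 ((hedge i j).1 hij)
    rcases pair_eq_pair_iff.1 hc with h | h
    · rw [← hz h.1, ← hz h.2]
      exact Or.inl rfl
    · rw [← hz h.1, ← hz h.2]
      exact Or.inr rfl
  refine ⟨hz, fun i => (hedge _ _).2 (mem_cycleEdges.2 ⟨i, rfl⟩), hch, ?_⟩
  rintro ⟨v, hv⟩
  have := hch 0 2 (adj_of_mem (fun h => absurd (hz h) (by decide)) (hv 0) (hv 2))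
  revert this
  decide

/-- A disc with several inner facets consists of a smaller disc and a ring of ten vertices. -/
lemma IsFullerene.exists_ring (hK : K.IsFullerene) (hx : K.IsBelt x)
    (hT : K.bd T = cycleEdges x) (hp : K.pent (K.inner T) ≤ 6) (h1 : #(K.inner T) ≠ 1) :
    ∃ z : ZMod 5 → F, K.IsBelt z ∧ K.bd (K.core T) = cycleEdges z ∧
      (∀ i, ∃ v, K.inc v = {x i, x (i + 1), z (i + 1)}) ∧
      (∀ i, ∃ v, K.inc v = {x i, z i, z (i + 1)}) ∧
      (∀ v ∈ T, v ∈ K.core T ∨ (∃ i, K.inc v = {x i, x (i + 1), z (i + 1)}) ∨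
        ∃ i, K.inc v = {x i, z i, z (i + 1)}) := by
  obtain ⟨⟨y, hy, hbd⟩, h5, hp6⟩ := (hK.five_dichotomy hx hT hp).resolve_left h1
  have hflat := hK.isFlat hy hbd ((pent_mono (inner_mono (core_subset T))).trans hp)
  have hflat3 : ∀ i, K.degIn T (x i) = 3 := fun i => by
    have := hK.isFlat hx hT hp i
    rwa [if_neg h1] at this
  choose v hvT X hX hv using exists_inner_facet hx hT
  have hxi : ∀ i : ZMod 5, i - 1 + 1 = i := fun i => sub_add_cancel i 1
  have hXne : ∀ i, X i ≠ X (i + 1) := by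
    intro i h
    exact inner_facet_ne hK hx hT hp6 hy hbd h5 hflat (i := i) (v := v i) (w := v (i + 1)) (hX i)
      (by simp [hv]) (by simp [hv]) (by simp [hv]) (by simp [hv]) (by simp [hv])
      (by simp [hv, h])
  have hvne : ∀ i, v i ≠ v (i + 1) := by
    intro i h
    refine hx.not_three_mem (v := v i) (i := i) (by simp [hv]) ?_
    rw [h, hv]
    simp
  -- The facet `x (i + 1)` has three vertices in `T`, two of them on belt edges. The triangles
  -- across its edges with `X i` and with `X (i + 1)` must both be the third one.
  have hu : ∀ i, ∃ u ∈ T, K.inc u = {x (i + 1), X i, X (i + 1)} ∧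
      ({u ∈ T | x (i + 1) ∈ K.inc u} : Finset V) = {u, v i, v (i + 1)} := by
    intro i
    obtain ⟨u, huT, huv, hxu, hXu⟩ := exists_other_of_inner (T := T) (a := x (i + 1)) (v := v i)
      (by simp [hv]) (by simp [hv]) (inner_ne_cycle hT (hX i) _).symm (hX i)
    obtain ⟨u', huT', huv', hxu', hXu'⟩ := exists_other_of_inner (T := T) (a := x (i + 1))
      (v := v (i + 1)) (X := X (i + 1))
      (by simp [hv]) (by simp [hv]) (inner_ne_cycle hT (hX (i + 1)) _).symm (hX (i + 1))
    have huw : u ≠ v (i + 1) := by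
      rintro rfl
      exact inner_facet_ne hK hx hT hp6 hy hbd h5 hflat (i := i) (v := v i) (w := v (i + 1))
        (hX i) (by simp [hv]) (by simp [hv]) (by simp [hv]) (by simp [hv]) (by simp [hv]) hXu
    have huw' : u' ≠ v i := by
      rintro rfl
      exact inner_facet_ne hK hx hT hp6 hy hbd h5 hflat (i := i) (v := v i) (w := v (i + 1))
        (hX (i + 1)) (by simp [hv]) (by simp [hv]) hXu' (by simp [hv]) (by simp [hv])
        (by simp [hv])
    have heq : ({u ∈ T | x (i + 1) ∈ K.inc u} : Finset V) = {u, v i, v (i + 1)} := by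
      refine (eq_of_subset_of_card_le ?_ ?_).symm
      · simp [insert_subset_iff, huT, hvT, hxu, hv]
      · rw [card_eq_three.2 ⟨u, v i, v (i + 1), huv, huw, hvne i, rfl⟩]
        exact (hflat3 (i + 1)).le
    have huu : u' = u := by
      have : u' ∈ ({u ∈ T | x (i + 1) ∈ K.inc u} : Finset V) := by simp [huT', hxu']
      rw [heq] at this
      simpa [huv', huw'] using this
    rw [huu] at hXu'
    exact ⟨u, huT, inc_eq_of_mem hxu hXu hXu' (inner_ne_cycle hT (hX i) _).symm
      (inner_ne_cycle hT (hX _) _).symm (hXne i), heq⟩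
  choose u huT hu hfil using hu
  have hcard5 : #(K.bd (K.core T)) = 5 := by rw [hbd, card_cycleEdges (by omega) hy.injective]
  have hsub := bd_core_subset (K := K) T
  have hcardi := card_image_le (s := K.level T 2) (f := fun v => K.inc v ∩ K.inner T)
  -- The core boundary has five edges and there are five triangles of level 2, so these correspond
  -- bijectively.
  have hlev := eq_of_subset_of_card_le hsub (by omega)
  have hinj : Set.InjOn (fun v => K.inc v ∩ K.inner T) (K.level T 2 : Set V) :=
    card_image_iff.1 (by rw [← hlev]; omega)
  have hinter : ∀ i, K.inc (u i) ∩ K.inner T = {X i, X (i + 1)} := by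
    intro i
    rw [hu]
    ext a
    simp only [mem_inter, mem_insert, mem_singleton]
    constructor
    · rintro ⟨rfl | h, ha⟩
      · exact absurd ha (notMem_inner_of_cycle hT _)
      · exact h
    · rintro (rfl | rfl)
      · exact ⟨by simp, hX _⟩
      · exact ⟨by simp, hX _⟩
  have hul : ∀ i, u i ∈ K.level T 2 := by
    intro i
    simp only [level, mem_filter, huT, hinter, true_and]
    exact card_pair (hXne i)
  have hEinj : Function.Injective fun i => ({X i, X (i + 1)} : Finset F) := by
    intro i j hij
    have huij : u i = u j := hinj (hul i) (hul j) (by simpa only [hinter] using hij)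
    have hmem : x (i + 1) ∈ K.inc (u j) := by rw [← huij, hu]; simp
    rw [hu] at hmem
    simp only [mem_insert, mem_singleton] at hmem
    rcases hmem with h | h | h
    · exact add_right_cancel (hx.injective h)
    · exact absurd h.symm (inner_ne_cycle hT (hX _) _)
    · exact absurd h.symm (inner_ne_cycle hT (hX _) _)
  have hcyc : cycleEdges X = K.bd (K.core T) := by
    refine eq_of_subset_of_card_le ?_ ?_
    · intro e he
      obtain ⟨i, rfl⟩ := mem_cycleEdges.1 he
      rw [hlev]
      exact mem_image.2 ⟨u i, hul i, hinter i⟩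
    · rw [hcard5, cycleEdges, card_image_of_injective _ hEinj, card_univ, ZMod.card]
  -- The `X i` cover the five different facets of `y`.
  have hXinj : Function.Injective X := by
    have hsub : univ.image y ⊆ univ.image X := by
      intro a ha
      obtain ⟨j, -, rfl⟩ := mem_image.1 ha
      have : ({y j, y (j + 1)} : Finset F) ∈ cycleEdges X := by
        rw [hcyc, hbd]
        exact mem_cycleEdges.2 ⟨j, rfl⟩
      obtain ⟨i, hi⟩ := mem_cycleEdges.1 this
      rcases pair_eq_pair_iff.1 hi with h | h
      · exact mem_image.2 ⟨i, mem_univ _, h.1⟩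
      · exact mem_image.2 ⟨i + 1, mem_univ _, h.2⟩
    have h6 := card_le_card hsub
    rw [card_image_of_injective _ hy.injective] at h6
    have := card_image_iff.1 (card_image_le.antisymm h6)
    rwa [coe_univ, Set.injOn_univ] at this
  have hzc : ∀ i : ZMod 5, i + 1 + -1 = i := fun i => add_neg_cancel_right i 1
  -- The shift matches the indexing of `D_k`, where `side r i` meets `side (r + 1) i` and `side (r +
  -- 1) (i + 1)`.
  refine ⟨fun i => X (i + -1), ?_, ?_, ?_, ?_, ?_⟩
  · refine hy.of_cycleEdges_eq (fun i j h => add_right_cancel (hXinj h)) ?_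
    rw [cycleEdges_shift, hcyc, hbd]
  · rw [cycleEdges_shift, hcyc]
  · intro i
    exact ⟨v i, by simp only [hzc, hv]⟩
  · intro i
    refine ⟨u (i + -1), ?_⟩
    simp only [hu, hzc, neg_add_cancel_right]
  · intro w hw
    by_cases hwc : w ∈ K.core T
    · exact Or.inl hwc
    right
    rw [mem_core, not_subset] at hwc
    obtain ⟨a, ha, hai⟩ := hwc
    obtain ⟨i, rfl⟩ := (mem_inner_or_of_mem hT hw ha).resolve_left hai
    have hmem : w ∈ ({w ∈ T | x (i + -1 + 1) ∈ K.inc w} : Finset V) := by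
      rw [neg_add_cancel_right]
      simp [hw, ha]
    rw [hfil] at hmem
    simp only [mem_insert, mem_singleton] at hmem
    rcases hmem with rfl | rfl | rfl
    · refine Or.inr ⟨i, ?_⟩
      simp only [hu, hzc, neg_add_cancel_right]
    · refine Or.inl ⟨i + -1, ?_⟩
      simp only [hv, hzc]
    · refine Or.inl ⟨i, ?_⟩
      simp only [neg_add_cancel_right, hv, hzc]

end Five

end TriangulatedSphere

/-! ### Towers of rings, and the sphere as a tube. -/

namespace TriangulatedSphere

variable {F V : Type*} [Fintype F] [Fintype V] [DecidableEq F] [DecidableEq V]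
  {K : TriangulatedSphere F V}

/-- The disc `T` consists of concentric rings `f 0 = x, f 1, …, f n` of five facets around `t`. -/
structure IsTower (K : TriangulatedSphere F V) (T : Finset V) (x : ZMod 5 → F) (n : ℕ) (t : F)
    (f : ℕ → ZMod 5 → F) : Prop where
  zero : f 0 = x
  lower : ∀ r < n, ∀ i, ∃ v, K.inc v = {f r i, f r (i + 1), f (r + 1) (i + 1)}
  upper : ∀ r < n, ∀ i, ∃ v, K.inc v = {f r i, f (r + 1) i, f (r + 1) (i + 1)}
  top : ∀ i, ∃ v, K.inc v = {f n i, f n (i + 1), t}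
  vertex : ∀ v ∈ T, (∃ r < n, ∃ i, K.inc v = {f r i, f r (i + 1), f (r + 1) (i + 1)}) ∨
    (∃ r < n, ∃ i, K.inc v = {f r i, f (r + 1) i, f (r + 1) (i + 1)}) ∨
    ∃ i, K.inc v = {f n i, f n (i + 1), t}
  facet : ∀ y ∈ K.inner T, y = t ∨ ∃ r ≤ n, ∃ i, y = f r i
  card_inner : #(K.inner T) = 5 * n + 1
  belt : ∀ r ≤ n, K.IsBelt (f r)
  region : ∀ r ≤ n, ∃ T', K.bd T' = cycleEdges (f r) ∧ #(K.inner T') + 5 * r = 5 * n + 1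
  deg_top : K.deg t = 5
  deg_last : 1 ≤ n → ∀ i, K.deg (f n i) = 5
  deg_mid : ∀ r, 1 ≤ r → r < n → ∀ i, K.deg (f r i) = 6

section

variable {x : ZMod 5 → F} {T : Finset V}

lemma IsFullerene.isTower_zero (hK : K.IsFullerene) (hx : K.IsBelt x)
    (hT : K.bd T = cycleEdges x) {t : F} (ht : K.inner T = {t}) :
    K.IsTower T x 0 t (fun _ => x) := by
  have hcard : #(K.inner T) = 1 := by rw [ht, card_singleton]
  have hp : K.pent (K.inner T) ≤ 6 := (pent_le_card _).trans (by omega)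
  have hflat : ∀ i, K.degIn T (x i) = 2 := fun i => by
    have := hK.isFlat hx hT hp i
    rwa [if_pos hcard] at this
  choose v hvT X hX hv using exists_inner_facet hx hT
  have hXt : ∀ i, X i = t := fun i => by simpa [ht] using hX i
  simp only [hXt] at hv
  have hvert : ∀ w ∈ T, ∃ i, K.inc w = {x i, x (i + 1), t} := by
    intro w hw
    obtain ⟨a, ha, hai⟩ : ∃ a ∈ K.inc w, a ∉ K.inner T := by
      by_contra! h
      have := card_le_card (show K.inc w ⊆ K.inner T from h)
      rw [K.card_inc, hcard] at this
      omega
    obtain ⟨i, rfl⟩ := (mem_inner_or_of_mem hT hw ha).resolve_left hai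
    have hvne : v (i - 1) ≠ v i := by
      intro h
      refine hx.not_three_mem (v := v i) (i := i - 1) ?_ ?_
      · rw [← h, hv]
        simp
      · rw [sub_add_cancel, hv]
        simp
    have heq : ({w ∈ T | x i ∈ K.inc w} : Finset V) = {v (i - 1), v i} := by
      refine (eq_of_subset_of_card_le ?_ ?_).symm
      · simp [insert_subset_iff, hvT, hv]
      · rw [card_pair hvne]
        exact (hflat i).le
    have hmem : w ∈ ({w ∈ T | x i ∈ K.inc w} : Finset V) := by simp [hw, ha]
    rw [heq] at hmem
    simp only [mem_insert, mem_singleton] at hmem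
    rcases hmem with rfl | rfl
    · exact ⟨i - 1, hv _⟩
    · exact ⟨i, hv _⟩
  refine ⟨rfl, by simp, by simp, fun i => ⟨v i, hv i⟩, fun w hw => Or.inr (Or.inr (hvert w hw)),
    fun y hy => Or.inl (by simpa [ht] using hy), by rw [hcard], fun _ _ => hx, ?_, ?_, by simp,
    by simp⟩
  · intro r hr
    exact ⟨T, hT, by omega⟩
  -- All of `T` surrounds `t`, so its degree is the number of triangles, which the disc formula
  -- gives as 2 · 1 + 5 - 2.
  · have hstar : K.star t = T := by
      refine Subset.antisymm (mem_inner.1 (by simp [ht])) fun w hw => ?_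
      obtain ⟨i, hi⟩ := hvert w hw
      rw [mem_star, hi]
      simp
    have := card_add_two_eq (by omega) hx.injective hT
    rw [deg, hstar]
    omega

/-- Induction on the disc: a tower in the core, with the ring of `exists_ring` placed in front and
indices raised by one. -/
lemma IsFullerene.exists_tower_aux (hK : K.IsFullerene) (m : ℕ) :
    ∀ (T : Finset V) (x : ZMod 5 → F), #T = m → K.IsBelt x → K.bd T = cycleEdges x →
      K.pent (K.inner T) ≤ 6 → ∃ n t f, K.IsTower T x n t f := by
  induction m using Nat.strong_induction_on with
  | _ m ih =>
  intro T x hm hx hT hp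
  by_cases h1 : #(K.inner T) = 1
  · obtain ⟨t, ht⟩ := card_eq_one.1 h1
    exact ⟨0, t, _, hK.isTower_zero hx hT ht⟩
  obtain ⟨z, hz, hbd, hlow, hup, hvert⟩ := hK.exists_ring hx hT hp h1
  obtain ⟨-, h5, hp6⟩ := (hK.five_dichotomy hx hT hp).resolve_left h1
  have hcount := hK.count (by omega) hx hT
  obtain ⟨n, t, f, hf⟩ := ih #(K.core T) (by omega) (K.core T) z rfl hz hbd
    ((pent_mono (inner_mono (core_subset T))).trans hp)
  obtain ⟨hunion, hcard⟩ := inner_eq_union hK hx hT hz hbd h5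
  have hdeg := deg_of_isFlat_core hK hx hT hp6 hz hbd h5
  let g : ℕ → ZMod 5 → F := fun r => match r with
    | 0 => x
    | r + 1 => f r
  have hci := hf.card_inner
  refine ⟨n + 1, t, g, rfl, ?_, ?_, hf.top, ?_, ?_, by omega, ?_, ?_, hf.deg_top, ?_, ?_⟩
  · intro r hr i
    rcases r with _ | r
    · obtain ⟨v, hv⟩ := hlow i
      exact ⟨v, by simp only [g, hf.zero, hv]⟩
    · exact hf.lower r (by omega) i
  · intro r hr i
    rcases r with _ | r
    · obtain ⟨v, hv⟩ := hup i
      exact ⟨v, by simp only [g, hf.zero, hv]⟩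
    · exact hf.upper r (by omega) i
  · intro v hv
    rcases hvert v hv with h | ⟨i, h⟩ | ⟨i, h⟩
    · rcases hf.vertex v h with ⟨r, hr, i, h⟩ | ⟨r, hr, i, h⟩ | ⟨i, h⟩
      · exact Or.inl ⟨r + 1, by omega, i, h⟩
      · exact Or.inr (Or.inl ⟨r + 1, by omega, i, h⟩)
      · exact Or.inr (Or.inr ⟨i, h⟩)
    · exact Or.inl ⟨0, by omega, i, by simp only [g, hf.zero, h]⟩
    · exact Or.inr (Or.inl ⟨0, by omega, i, by simp only [g, hf.zero, h]⟩)
  · intro y hy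
    rw [hunion, mem_union] at hy
    rcases hy with hy | hy
    · rcases hf.facet y hy with h | ⟨r, hr, i, h⟩
      · exact Or.inl h
      · exact Or.inr ⟨r + 1, by omega, i, h⟩
    · obtain ⟨i, -, rfl⟩ := mem_image.1 hy
      exact Or.inr ⟨1, by omega, i, by simp only [g, hf.zero]⟩
  · intro r hr
    rcases r with _ | r
    · exact hx
    · exact hf.belt r (by omega)
  · intro r hr
    rcases r with _ | r
    · exact ⟨T, hT, by omega⟩
    · obtain ⟨T', h, h'⟩ := hf.region r (by omega)
      exact ⟨T', h, by omega⟩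
  · intro _ i
    rcases n with _ | n
    · simp only [g, hf.zero]
      rw [hdeg, if_pos (by omega)]
    · exact hf.deg_last (by omega) i
  · intro r hr hrn i
    obtain ⟨r, rfl⟩ : ∃ s, r = s + 1 := ⟨r - 1, by omega⟩
    rcases r with _ | r
    · simp only [g, hf.zero]
      rw [hdeg, if_neg (by omega)]
    · exact hf.deg_mid (r + 1) (by omega) (by omega) i

lemma IsFullerene.exists_tower (hK : K.IsFullerene) (hx : K.IsBelt x)
    (hT : K.bd T = cycleEdges x) (hp : K.pent (K.inner T) ≤ 6) :
    ∃ n t f, K.IsTower T x n t f :=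
  hK.exists_tower_aux _ T x rfl hx hT hp

end

/-- The sphere consists of rings `f 0, …, f n` of five facets between the facets `b` and `t`. -/
structure IsTube (K : TriangulatedSphere F V) (n : ℕ) (b t : F) (f : ℕ → ZMod 5 → F) : Prop where
  bottom : ∀ i, ∃ v, K.inc v = {f 0 i, f 0 (i + 1), b}
  lower : ∀ r < n, ∀ i, ∃ v, K.inc v = {f r i, f r (i + 1), f (r + 1) (i + 1)}
  upper : ∀ r < n, ∀ i, ∃ v, K.inc v = {f r i, f (r + 1) i, f (r + 1) (i + 1)}
  top : ∀ i, ∃ v, K.inc v = {f n i, f n (i + 1), t}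
  vertex : ∀ v, (∃ i, K.inc v = {f 0 i, f 0 (i + 1), b}) ∨
    (∃ r < n, ∃ i, K.inc v = {f r i, f r (i + 1), f (r + 1) (i + 1)}) ∨
    (∃ r < n, ∃ i, K.inc v = {f r i, f (r + 1) i, f (r + 1) (i + 1)}) ∨
    ∃ i, K.inc v = {f n i, f n (i + 1), t}
  facet : ∀ y, y = b ∨ y = t ∨ ∃ r ≤ n, ∃ i, y = f r i
  card_eq : Fintype.card F = 5 * n + 7
  belt : ∀ r ≤ n, K.IsBelt (f r)
  region : ∀ r ≤ n, ∃ T', K.bd T' = cycleEdges (f r) ∧ #(K.inner T') + 5 * r = 5 * n + 1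
  deg_bottom : K.deg b = 5
  deg_top : K.deg t = 5
  deg_first : ∀ i, K.deg (f 0 i) = 5
  deg_last : ∀ i, K.deg (f n i) = 5

section

variable {x : ZMod 5 → F} {T : Finset V}

lemma IsFullerene.pent_add (hK : K.IsFullerene) (hT : K.bd T = cycleEdges x) :
    K.pent (K.inner T) + K.pent (K.inner Tᶜ) + K.pent (univ.image x) = 12 := by
  have hT' : K.bd Tᶜ = cycleEdges x := by rw [bd_compl, hT]
  rw [← hK.pent_univ, ← pent_union (disjoint_inner_inner_compl T), ← pent_union]
  · congr 1
    ext y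
    simp only [mem_union, mem_image, mem_univ, true_and, iff_true]
    by_cases hy : ∃ i, x i = y
    · exact Or.inr hy
    · push Not at hy
      exact Or.inl (mem_inner_or_of_notMem_cycle hT hy)
  · exact disjoint_union_left.2 ⟨disjoint_inner_image hT, disjoint_inner_image hT'⟩

/-- The tower over `x` is only used to find a cap, one pentagon ringed by five. The disc outside
that cap then contains 12 - 1 - 5 = 6 pentagons, so it is itself a tower, and together they cover
the sphere. -/
lemma IsFullerene.exists_tube_aux (hK : K.IsFullerene) (hx : K.IsBelt x)
    (hT : K.bd T = cycleEdges x) (hp : K.pent (K.inner T) ≤ 6) (h1 : #(K.inner T) ≠ 1) :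
    ∃ n b t f, 1 ≤ n ∧ K.IsTube n b t f := by
  obtain ⟨m, b₀, g, hg⟩ := hK.exists_tower hx hT hp
  have hm : 1 ≤ m := by
    have := hg.card_inner
    omega
  obtain ⟨S, hS, hSc⟩ := hg.region m le_rfl
  have hb := hg.belt m le_rfl
  obtain ⟨b, hSb⟩ := card_eq_one.1 (by omega : #(K.inner S) = 1)
  have hcap := hK.isTower_zero hb hS hSb
  have hS' : K.bd Sᶜ = cycleEdges (g m) := by rw [bd_compl, hS]
  have hpS : K.pent (K.inner S) = 1 := by
    have := hK.count (by omega) hb hS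
    omega
  have hpx : K.pent (univ.image (g m)) = 5 := by
    unfold pent
    rw [filter_true_of_mem, card_image_of_injective _ hb.injective, card_univ, ZMod.card]
    intro y hy
    obtain ⟨i, -, rfl⟩ := mem_image.1 hy
    exact hg.deg_last hm i
  have hadd := hK.pent_add hS
  have hle := pent_le_card (K := K) (K.inner Sᶜ)
  obtain ⟨n, t, f, hf⟩ := hK.exists_tower hb hS' (by omega)
  have hci := hf.card_inner
  have hn : 1 ≤ n := by omega
  have hcard := card_inner_add_card_inner_compl hb.injective hS
  refine ⟨n, b, t, f, hn, ?_, hf.lower, hf.upper, hf.top, ?_, ?_, by omega, hf.belt, hf.region,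
    hcap.deg_top, hf.deg_top, ?_, hf.deg_last hn⟩
  · rw [hf.zero]
    exact hcap.top
  · intro v
    by_cases hv : v ∈ S
    · left
      rw [hf.zero]
      rcases hcap.vertex v hv with ⟨r, hr, -⟩ | ⟨r, hr, -⟩ | h
      · omega
      · omega
      · exact h
    · exact Or.inr (hf.vertex v (mem_compl.2 hv))
  · intro y
    by_cases hy : ∃ i, g m i = y
    · obtain ⟨i, rfl⟩ := hy
      exact Or.inr (Or.inr ⟨0, by omega, i, by rw [hf.zero]⟩)
    · push Not at hy
      rcases mem_inner_or_of_notMem_cycle hS hy with h | h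
      · exact Or.inl (by simpa [hSb] using h)
      · exact Or.inr (hf.facet y h)
  · rw [hf.zero]
    exact hg.deg_last hm

lemma IsFullerene.exists_tube (hK : K.IsFullerene) (hx : K.IsBelt x)
    (hT : K.bd T = cycleEdges x) (h1 : #(K.inner T) ≠ 1) (h2 : #(K.inner Tᶜ) ≠ 1) :
    ∃ n b t f, 1 ≤ n ∧ K.IsTube n b t f := by
  rcases hK.pent_inner_compl T with h | h
  · exact hK.exists_tube_aux hx hT h h1
  · exact hK.exists_tube_aux hx (by rw [bd_compl, hT]) h h2

/-- A belt with several facets on both sides consists of hexagons. -/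
lemma IsFullerene.nontrivial_belt (hK : K.IsFullerene) (hx : K.IsBelt x)
    (hT : K.bd T = cycleEdges x) (h1 : #(K.inner T) ≠ 1) (h2 : #(K.inner Tᶜ) ≠ 1) :
    K.pent (K.inner T) ≤ 6 ∧ K.pent (K.inner Tᶜ) ≤ 6 ∧ ∀ i, K.deg (x i) = 6 := by
  have hT' : K.bd Tᶜ = cycleEdges x := by rw [bd_compl, hT]
  have hadd := hK.pent_add hT
  -- If one side has at most six pentagons, the dichotomy gives it exactly six. So the other has at
  -- most six, hence six as well, and none is left for the belt.
  have key : ∀ S, K.bd S = cycleEdges x → #(K.inner S) ≠ 1 → #(K.inner Sᶜ) ≠ 1 →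
      K.pent (K.inner S) ≤ 6 → K.pent (K.inner S) = 6 ∧ K.pent (K.inner Sᶜ) = 6 := by
    intro S hS hS1 hS2 hp
    have h6 := ((hK.five_dichotomy hx hS hp).resolve_left hS1).2.2
    have hadd := hK.pent_add hS
    exact ⟨h6, ((hK.five_dichotomy hx (by rw [bd_compl, hS]) (by omega)).resolve_left hS2).2.2⟩
  have h66 : K.pent (K.inner T) = 6 ∧ K.pent (K.inner Tᶜ) = 6 := by
    rcases hK.pent_inner_compl T with h | h
    · exact key T hT h1 h2 h
    · have := key Tᶜ hT' h2 (by rwa [compl_compl]) h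
      rw [compl_compl] at this
      exact this.symm
  refine ⟨h66.1.le, h66.2.le, fun i => (hK (x i)).resolve_left fun h => ?_⟩
  have h0 : K.pent (univ.image x) = 0 := by omega
  have : x i ∈ ({z ∈ univ.image x | K.deg z = 5} : Finset F) := by simp [h]
  rw [card_eq_zero.1 h0] at this
  simp at this

end

end TriangulatedSphere

namespace TriangulatedSphere

variable {F V : Type*} [Fintype F] [Fintype V] [DecidableEq F] [DecidableEq V]
  {K : TriangulatedSphere F V}

/-! ### Belts around pentagons -/

lemma mem_bd_star {y : F} {e : Finset F} :
    e ∈ K.bd (K.star y) ↔ ∃ v, y ∈ K.inc v ∧ e = (K.inc v).erase y := by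
  constructor
  · intro he
    obtain ⟨v, hv, w, hw, hev, hew⟩ := exists_of_mem_bd he
    rw [mem_star] at hv hw
    have hye : y ∉ e := fun h => hw (hew h)
    refine ⟨v, hv, eq_of_subset_of_card_le (subset_erase.2 ⟨hev, hye⟩) ?_⟩
    rw [card_erase_of_mem hv, K.card_inc, card_eq_two_of_mem_bd he]
  · rintro ⟨v, hv, rfl⟩
    have h2 : #((K.inc v).erase y) = 2 := by rw [card_erase_of_mem hv, K.card_inc]
    obtain ⟨w, hwv, hw⟩ := exists_other (K := K) h2 (erase_subset _ _)
    rw [mem_bd_iff h2 hwv.symm (erase_subset _ _) hw]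
    simp only [mem_star, hv, true_iff]
    intro hyw
    refine hwv (K.inc_injective (eq_of_subset_of_card_le ?_ (by simp [K.card_inc]))).symm
    rw [← insert_erase hv]
    exact insert_subset hyw hw

lemma card_bd_star (y : F) : #(K.bd (K.star y)) = K.deg y := by
  have h : K.bd (K.star y) = (K.star y).image fun v => (K.inc v).erase y := by
    ext e
    rw [mem_bd_star, mem_image]
    simp only [mem_star, eq_comm]
  rw [h, card_image_of_injOn, deg]
  intro v hv w hw hvw
  rw [mem_coe, mem_star] at hv hw
  refine K.inc_injective ?_
  rw [← insert_erase hv, ← insert_erase hw]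
  exact congrArg _ hvw

lemma IsBelt.mem_cycleEdges_iff {x : ZMod 5 → F} (hx : K.IsBelt x) {e : Finset F} :
    e ∈ cycleEdges x ↔ ∃ a b, K.Adj a b ∧ a ∈ Set.range x ∧ b ∈ Set.range x ∧ e = {a, b} := by
  constructor
  · intro he
    obtain ⟨i, rfl⟩ := mem_cycleEdges.1 he
    exact ⟨_, _, hx.adj i, ⟨i, rfl⟩, ⟨i + 1, rfl⟩, rfl⟩
  · rintro ⟨_, _, hab, ⟨i, rfl⟩, ⟨j, rfl⟩, rfl⟩
    rcases hx.chordless i j hab with rfl | rfl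
    · exact mem_cycleEdges.2 ⟨i, rfl⟩
    · exact mem_cycleEdges.2 ⟨j, pair_comm _ _⟩

lemma IsBelt.cycleEdges_eq {x y : ZMod 5 → F} (hx : K.IsBelt x) (hy : K.IsBelt y)
    (h : Set.range x = Set.range y) : cycleEdges x = cycleEdges y := by
  ext e
  rw [hx.mem_cycleEdges_iff, hy.mem_cycleEdges_iff, h]

lemma card_inner_star {x : ZMod 5 → F} {y : F} (hy : K.deg y = 5) (hx : Function.Injective x)
    (hbd : K.bd (K.star y) = cycleEdges x) : #(K.inner (K.star y)) = 1 := by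
  have h := card_add_two_eq (by omega) hx hbd
  unfold deg at hy
  omega

/-- The boundary of the star is an even set of five edges, hence a 5-cycle. A chord together with
`y` would be a 3-cycle, which bounds a triangle at `y`, so the chord is a cycle edge. -/
lemma NoBelt.exists_belt_around (h3 : K.NoBelt 3) {y : F} (hy : K.deg y = 5) :
    ∃ x : ZMod 5 → F, K.IsBelt x ∧ K.bd (K.star y) = cycleEdges x ∧
      Set.range x = {z | K.Adj z y} := by
  have hcard := card_bd_star (K := K) y
  have hcyc : ∃ x : ZMod 5 → F, Function.Injective x ∧ K.bd (K.star y) = cycleEdges x := by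
    rcases exists_cycle_of_even (fun _ => card_eq_two_of_mem_bd) (even_card_bd_filter (K.star y))
      (card_pos.1 (by rw [hcard, hy]; norm_num)) (by omega) with ⟨x, hx, h⟩ | ⟨x, hx, h⟩ | h
    · rw [h, card_cycleEdges (by omega) hx] at hcard
      omega
    · rw [h, card_cycleEdges (by omega) hx] at hcard
      omega
    · exact h
  obtain ⟨x, hx, hbd⟩ := hcyc
  have hrange : Set.range x = {z | K.Adj z y} := by
    ext z
    simp only [Set.mem_range, Set.mem_ofPred_eq]
    constructor
    · rintro ⟨i, rfl⟩
      have he : ({x i, x (i + 1)} : Finset F) ∈ K.bd (K.star y) := by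
        rw [hbd]
        exact mem_cycleEdges.2 ⟨i, rfl⟩
      obtain ⟨v, hv, heq⟩ := mem_bd_star.1 he
      have hxi : x i ∈ (K.inc v).erase y := by rw [← heq]; simp
      rw [mem_erase] at hxi
      exact ⟨hxi.1, v, hxi.2, hv⟩
    · rintro ⟨hzy, v, hz, hv⟩
      have he : (K.inc v).erase y ∈ K.bd (K.star y) := mem_bd_star.2 ⟨v, hv, rfl⟩
      rw [hbd] at he
      obtain ⟨i, hi⟩ := mem_cycleEdges.1 he
      have hz' : z ∈ (K.inc v).erase y := mem_erase.2 ⟨hzy, hz⟩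
      rw [← hi] at hz'
      simp only [mem_insert, mem_singleton] at hz'
      rcases hz' with rfl | rfl
      exacts [⟨_, rfl⟩, ⟨_, rfl⟩]
  have hadj : ∀ i, K.Adj (x i) y := fun i => by
    have : x i ∈ Set.range x := ⟨i, rfl⟩
    rwa [hrange] at this
  refine ⟨x, ⟨hx, adj_of_bd_eq hbd, ?_, ?_⟩, hbd, hrange⟩
  · intro i j hij
    obtain ⟨v, hv⟩ := h3.exists_vertex hij (hadj j) (hadj i).symm
    have he : (K.inc v).erase y ∈ K.bd (K.star y) := mem_bd_star.2 ⟨v, by simp [hv], rfl⟩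
    have heq : (K.inc v).erase y = {x i, x j} := by
      rw [hv]
      have h1 := (hadj i).1
      have h2 := (hadj j).1
      ext z
      simp only [mem_erase, mem_insert, mem_singleton]
      constructor
      · tauto
      · rintro (rfl | rfl) <;> tauto
    rw [heq, hbd] at he
    obtain ⟨l, hl⟩ := mem_cycleEdges.1 he
    rcases pair_eq_pair_iff.1 hl with h | h
    · rw [← hx h.1, ← hx h.2]
      exact Or.inl rfl
    · rw [← hx h.1, ← hx h.2]
      exact Or.inr rfl
  · rintro ⟨v, hv⟩
    have := card_le_card (show univ.image x ⊆ K.inc v from fun z hz => by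
      obtain ⟨i, -, rfl⟩ := mem_image.1 hz
      exact hv i)
    rw [card_image_of_injective _ hx, card_univ, ZMod.card, K.card_inc] at this
    omega

lemma IsFullerene.twelve_le (hK : K.IsFullerene) : 12 ≤ Fintype.card F := by
  rw [← hK.pent_univ, ← card_univ]
  exact pent_le_card _

/-- Stars with equal boundary are equal or complementary. Equal stars of different facets would make
`z` its own neighbour; complementary ones leave only ten triangles, but there are at least twenty.
-/
lemma IsFullerene.eq_of_neighbors_eq (hK : K.IsFullerene) {y z : F} (hy : K.deg y = 5)
    (hz : K.deg z = 5) (h : {a | K.Adj a y} = {a | K.Adj a z}) : y = z := by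
  obtain ⟨x, hx, hbd, hr⟩ := hK.noBelt_three.exists_belt_around hy
  obtain ⟨x', hx', hbd', hr'⟩ := hK.noBelt_three.exists_belt_around hz
  have heq : K.bd (K.star y) = K.bd (K.star z) := by
    rw [hbd, hbd', hx.cycleEdges_eq hx' (by rw [hr, hr', h])]
  rcases eq_or_eq_compl_of_bd_eq heq with h1 | h1
  · by_contra hne
    obtain ⟨v, hv⟩ := star_nonempty (K := K) y
    have hv' := hv
    rw [h1, mem_star] at hv'
    rw [mem_star] at hv
    have : z ∈ {a | K.Adj a y} := adj_of_mem (Ne.symm hne) hv' hv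
    rw [h] at this
    exact this.1 rfl
  · have h2 := card_add_card_compl (K.star z)
    rw [← h1] at h2
    unfold deg at hy hz
    have := hK.twelve_le
    have := K.euler
    omega

/-- The sets of facets of five-belts. -/
def beltSets (K : TriangulatedSphere F V) : Set (Set F) :=
  {B | ∃ x : ZMod 5 → F, K.IsBelt x ∧ Set.range x = B}

/-- The sets of neighbours of pentagons. -/
def pentagonLinks (K : TriangulatedSphere F V) : Set (Set F) :=
  {B | ∃ y, K.deg y = 5 ∧ B = {z | K.Adj z y}}

lemma IsFullerene.pentagonLinks_subset (hK : K.IsFullerene) : K.pentagonLinks ⊆ K.beltSets := by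
  rintro _ ⟨y, hy, rfl⟩
  obtain ⟨x, hx, -, hr⟩ := hK.noBelt_three.exists_belt_around hy
  exact ⟨x, hx, hr⟩

lemma IsFullerene.ncard_pentagonLinks (hK : K.IsFullerene) : K.pentagonLinks.ncard = 12 := by
  have h : K.pentagonLinks =
      (fun y => {z | K.Adj z y}) '' (({y | K.deg y = 5} : Finset F) : Set F) := by
    ext B
    simp only [pentagonLinks, Set.mem_ofPred_eq, Set.mem_image, coe_filter, mem_univ, true_and]
    exact ⟨fun ⟨y, h1, h2⟩ => ⟨y, h1, h2.symm⟩, fun ⟨y, h1, h2⟩ => ⟨y, h1, h2.symm⟩⟩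
  rw [h, Set.InjOn.ncard_image, Set.ncard_coe_finset, ← hK.pent_univ, pent]
  intro y hy z hz hyz
  exact hK.eq_of_neighbors_eq (by simpa using hy) (by simpa using hz) hyz

/-- A belt around a pentagon has a single facet on one side. -/
lemma IsFullerene.card_inner_of_mem_pentagonLinks (hK : K.IsFullerene) {x : ZMod 5 → F}
    {T : Finset V} (hx : K.IsBelt x) (hT : K.bd T = cycleEdges x)
    (h : Set.range x ∈ K.pentagonLinks) : #(K.inner T) = 1 ∨ #(K.inner Tᶜ) = 1 := by
  obtain ⟨y, hy, hr⟩ := h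
  obtain ⟨x', hx', hbd, hr'⟩ := hK.noBelt_three.exists_belt_around hy
  have h1 := card_inner_star hy hx'.injective hbd
  rcases eq_or_eq_compl_of_bd_eq (hT.trans ((hx.cycleEdges_eq hx' (hr.trans hr'.symm)).trans
    hbd.symm)) with rfl | rfl
  · exact Or.inl h1
  · right
    rwa [compl_compl]

lemma IsFullerene.mem_pentagonLinks_of_card_inner (hK : K.IsFullerene) {x : ZMod 5 → F}
    {T : Finset V} (hx : K.IsBelt x) (hT : K.bd T = cycleEdges x) (h : #(K.inner T) = 1) :
    Set.range x ∈ K.pentagonLinks := by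
  obtain ⟨t, ht⟩ := card_eq_one.1 h
  have htow := hK.isTower_zero hx hT ht
  refine ⟨t, htow.deg_top, ?_⟩
  ext z
  simp only [Set.mem_range, Set.mem_ofPred_eq]
  have hxt : ∀ i, x i ≠ t := by
    rintro i rfl
    exact notMem_inner_of_cycle hT i (by simp [ht])
  constructor
  · rintro ⟨i, rfl⟩
    obtain ⟨v, hv⟩ := htow.top i
    exact adj_of_mem (v := v) (hxt i) (by simp [hv]) (by simp [hv])
  · rintro ⟨hzt, v, hz, hv⟩
    have hvT : v ∈ T := mem_inner.1 (by simp [ht] : t ∈ K.inner T) (mem_star.2 hv)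
    rcases htow.vertex v hvT with ⟨r, hr, -⟩ | ⟨r, hr, -⟩ | ⟨i, hi⟩
    · omega
    · omega
    · rw [hi] at hz
      simp only [mem_insert, mem_singleton] at hz
      rcases hz with rfl | rfl | rfl
      exacts [⟨_, rfl⟩, ⟨_, rfl⟩, absurd rfl hzt]

/-! ### The rings of a tube -/

section Tube

open DPolytope

/-- The facets of `D_k` as a sum. -/
def _root_.DPolytope.facetEquiv (k : ℕ) : Facet k ≃ Unit ⊕ Unit ⊕ (Fin (k + 2) × ZMod 5) where
  toFun
    | .bottom => .inl ()
    | .top => .inr (.inl ())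
    | .side r i => .inr (.inr (r, i))
  invFun
    | .inl _ => .bottom
    | .inr (.inl _) => .top
    | .inr (.inr (r, i)) => .side r i
  left_inv := by rintro (_ | _ | _) <;> rfl
  right_inv := by rintro (_ | _ | _) <;> rfl

/-- The vertices of `D_k` as a sum. -/
def _root_.DPolytope.vertexEquiv (k : ℕ) :
    Vertex k ≃ ZMod 5 ⊕ ZMod 5 ⊕ (Fin (k + 1) × ZMod 5) ⊕ (Fin (k + 1) × ZMod 5) where
  toFun
    | .bottom i => .inl i
    | .top i => .inr (.inl i)
    | .lower r i => .inr (.inr (.inl (r, i)))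
    | .upper r i => .inr (.inr (.inr (r, i)))
  invFun
    | .inl i => .bottom i
    | .inr (.inl i) => .top i
    | .inr (.inr (.inl (r, i))) => .lower r i
    | .inr (.inr (.inr (r, i))) => .upper r i
  left_inv := by rintro (_ | _ | _ | _) <;> rfl
  right_inv := by rintro (_ | _ | _ | _) <;> rfl

instance (k : ℕ) : Finite (Facet k) := Finite.of_equiv _ (facetEquiv k).symm

instance (k : ℕ) : Finite (Vertex k) := Finite.of_equiv _ (vertexEquiv k).symm

lemma _root_.DPolytope.card_facet (k : ℕ) : Nat.card (Facet k) = 5 * k + 12 := by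
  rw [Nat.card_congr (facetEquiv k)]
  simp [ZMod.card]
  ring

lemma _root_.DPolytope.card_vertex (k : ℕ) : Nat.card (Vertex k) = 10 * k + 20 := by
  rw [Nat.card_congr (vertexEquiv k)]
  simp [ZMod.card]
  ring

variable {k : ℕ} {b t : F} {f : ℕ → ZMod 5 → F}

/-- The facets of `D_k` in a tube. -/
def tubeFacet (b t : F) (f : ℕ → ZMod 5 → F) : Facet k → F
  | .bottom => b
  | .top => t
  | .side r i => f r i

lemma IsTube.bijective (h : K.IsTube (k + 1) b t f) :
    Function.Bijective (tubeFacet (k := k) b t f) := by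
  have hs : Function.Surjective (tubeFacet (k := k) b t f) := by
    intro y
    rcases h.facet y with rfl | rfl | ⟨r, hr, i, rfl⟩
    · exact ⟨.bottom, rfl⟩
    · exact ⟨.top, rfl⟩
    · exact ⟨.side ⟨r, by omega⟩ i, rfl⟩
  refine hs.bijective_of_nat_card_le ?_
  rw [card_facet, Nat.card_eq_fintype_card, h.card_eq]
  omega

lemma IsTube.injective (h : K.IsTube (k + 1) b t f) {r s : ℕ} (hr : r ≤ k + 1) (hs : s ≤ k + 1)
    {i j : ZMod 5} (heq : f r i = f s j) : r = s ∧ i = j := by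
  have := h.bijective.1 (a₁ := .side ⟨r, by omega⟩ i) (a₂ := .side ⟨s, by omega⟩ j) heq
  simpa using this

/-- Surjectivity on facets and on vertices is part of the tube structure; injectivity follows by
counting, for vertices through Euler's formula. A tube with last ring `k + 1` is `D_k`. -/
lemma IsTube.exists_equiv (h : K.IsTube (k + 1) b t f) :
    ∃ (g : Facet k ≃ F) (e : Vertex k ≃ V), ∀ v φ, g φ ∈ K.inc (e v) ↔ φ ∈ facetsAt v := by
  let g : Facet k ≃ F := Equiv.ofBijective _ h.bijective
  have hex : ∀ v : Vertex k, ∃ w, ((K.inc w : Finset F) : Set F) = g '' facetsAt v := by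
    rintro (i | i | ⟨r, i⟩ | ⟨r, i⟩)
    · obtain ⟨w, hw⟩ := h.bottom i
      refine ⟨w, ?_⟩
      rw [hw]
      ext z
      simp [facetsAt, g, tubeFacet, Set.image_insert_eq]
      tauto
    · obtain ⟨w, hw⟩ := h.top i
      refine ⟨w, ?_⟩
      rw [hw]
      ext z
      simp [facetsAt, g, tubeFacet, Set.image_insert_eq]
      tauto
    · obtain ⟨w, hw⟩ := h.lower r (by omega) i
      refine ⟨w, ?_⟩
      rw [hw]
      simp [facetsAt, g, tubeFacet, Set.image_insert_eq]
    · obtain ⟨w, hw⟩ := h.upper r (by omega) i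
      refine ⟨w, ?_⟩
      rw [hw]
      simp [facetsAt, g, tubeFacet, Set.image_insert_eq]
  choose e he using hex
  have hs : Function.Surjective e := by
    intro w
    have key : ∀ v : Vertex k, (K.inc w : Set F) = g '' facetsAt v → ∃ v, e v = w :=
      fun v hv => ⟨v, K.inc_injective (coe_injective ((he v).trans hv.symm))⟩
    rcases h.vertex w with ⟨i, hi⟩ | ⟨r, hr, i, hi⟩ | ⟨r, hr, i, hi⟩ | ⟨i, hi⟩
    · refine key (.bottom i) ?_
      rw [hi]
      ext z
      simp [facetsAt, g, tubeFacet, Set.image_insert_eq]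
      tauto
    · refine key (.lower ⟨r, hr⟩ i) ?_
      rw [hi]
      simp [facetsAt, g, tubeFacet, Set.image_insert_eq]
    · refine key (.upper ⟨r, hr⟩ i) ?_
      rw [hi]
      simp [facetsAt, g, tubeFacet, Set.image_insert_eq]
    · refine key (.top i) ?_
      rw [hi]
      ext z
      simp [facetsAt, g, tubeFacet, Set.image_insert_eq]
      tauto
  have hb : Function.Bijective e := by
    refine hs.bijective_of_nat_card_le ?_
    have := K.euler
    rw [card_vertex, Nat.card_eq_fintype_card]
    rw [h.card_eq] at this
    omega
  refine ⟨g, Equiv.ofBijective e hb, fun v φ => ?_⟩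
  rw [Equiv.ofBijective_apply, ← mem_coe, he, g.injective.mem_set_image]

lemma mem_iff_mem_of_notMem_range {x : ZMod 5 → F} {T : Finset V} (hT : K.bd T = cycleEdges x)
    {a c : F} (hac : a ≠ c) (hc : c ∉ Set.range x) {v w : V} (hav : a ∈ K.inc v)
    (hcv : c ∈ K.inc v) (haw : a ∈ K.inc w) (hcw : c ∈ K.inc w) : v ∈ T ↔ w ∈ T := by
  refine mem_iff_mem_of_notMem_bd (K := K) (e := {a, c}) (card_pair hac)
    (by simp [insert_subset_iff, *]) (by simp [insert_subset_iff, *]) fun he => ?_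
  rw [hT] at he
  obtain ⟨i, hi⟩ := mem_cycleEdges.1 he
  have : c ∈ ({x i, x (i + 1)} : Finset F) := by simp [hi]
  simp only [mem_insert, mem_singleton] at this
  rcases this with rfl | rfl
  exacts [hc ⟨_, rfl⟩, hc ⟨_, rfl⟩]

/-- The belts which do not surround a pentagon are rings of the tube. -/
lemma IsTube.eq_ring (hK : K.IsFullerene) (h : K.IsTube (k + 1) b t f) {x : ZMod 5 → F}
    (hx : K.IsBelt x) (hnt : Set.range x ∉ K.pentagonLinks) :
    ∃ r, 1 ≤ r ∧ r ≤ k ∧ Set.range x = Set.range (f r) := by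
  obtain ⟨T, hT⟩ := hx.exists_region (by omega)
  have hT' : K.bd Tᶜ = cycleEdges x := by rw [bd_compl, hT]
  have h1 : #(K.inner T) ≠ 1 := fun h1 => hnt (hK.mem_pentagonLinks_of_card_inner hx hT h1)
  have h2 : #(K.inner Tᶜ) ≠ 1 := fun h1 => hnt (hK.mem_pentagonLinks_of_card_inner hx hT' h1)
  obtain ⟨hp, hp', hdeg⟩ := hK.nontrivial_belt hx hT h1 h2
  have hflat : ∀ i, K.degIn T (x i) = 3 := fun i => by
    have := hK.isFlat hx hT hp i
    rwa [if_neg h1] at this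
  have hflat' : ∀ i, K.degIn Tᶜ (x i) = 3 := fun i => by
    have := hK.isFlat hx hT' hp' i
    rwa [if_neg h2] at this
  have hmem : ∀ y ∈ Set.range x, ∃ r, 1 ≤ r ∧ r ≤ k ∧ ∃ i, y = f r i := by
    rintro y ⟨j, rfl⟩
    have h6 := hdeg j
    rcases h.facet (x j) with h5 | h5 | ⟨r, hr, i, hi⟩
    · rw [h5, h.deg_bottom] at h6
      omega
    · rw [h5, h.deg_top] at h6
      omega
    · rw [hi] at h6
      refine ⟨r, ?_, ?_, i, hi⟩
      · by_contra hr0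
        obtain rfl : r = 0 := by omega
        rw [h.deg_first] at h6
        omega
      · by_contra hr0
        obtain rfl : r = k + 1 := by omega
        rw [h.deg_last] at h6
        omega
  classical
  -- Choose the last ring `r` met by the belt. The aim is that the belt contains this whole ring.
  let R : Finset ℕ := {r ∈ Icc 1 k | ∃ i, f r i ∈ Set.range x}
  have hR : R.Nonempty := by
    obtain ⟨r, hr1, hrk, i, hi⟩ := hmem (x 0) ⟨0, rfl⟩
    exact ⟨r, mem_filter.2 ⟨mem_Icc.2 ⟨hr1, hrk⟩, i, hi ▸ ⟨0, rfl⟩⟩⟩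
  obtain ⟨r, hrR, hmax⟩ := R.exists_max_image id hR
  obtain ⟨hr, i₀, hi₀⟩ := mem_filter.1 hrR
  obtain ⟨hr1, hrk⟩ := mem_Icc.1 hr
  have hnext : ∀ i, f (r + 1) i ∉ Set.range x := by
    intro i hi
    obtain ⟨s, hs1, hsk, j, hj⟩ := hmem _ hi
    have hrs := (h.injective (by omega) (by omega) hj).1
    have := hmax s (mem_filter.2 ⟨mem_Icc.2 ⟨hs1, hsk⟩, j, hj ▸ hi⟩)
    simp only [id] at this
    omega
  have hne : ∀ {p q : ℕ} {i j : ZMod 5}, p ≤ k + 1 → q ≤ k + 1 → ¬ (p = q ∧ i = j) →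
      f p i ≠ f q j := fun hp hq hn he => hn (h.injective hp hq he)
  have hii : ∀ i : ZMod 5, i + 1 ≠ i := cycle_ne (by omega)
  have hstep : ∀ i, f r i ∈ Set.range x → f r (i + 1) ∈ Set.range x := by
    intro i hi
    by_contra hn
    -- `D`, `A`, `B`, `C` are successive vertices around `f r i`. Between them lie its edges with `f
    -- r (i + 1)`, `f (r + 1) (i + 1)` and `f (r + 1) i`, none of which belongs to the belt.
    obtain ⟨A, hA⟩ := h.lower r (by omega) i
    obtain ⟨B, hB⟩ := h.upper r (by omega) i
    obtain ⟨C, hC⟩ := h.lower r (by omega) (i - 1)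
    obtain ⟨D, hD⟩ := h.upper (r - 1) (by omega) i
    rw [sub_add_cancel] at hC
    rw [Nat.sub_add_cancel hr1] at hD
    have n1 : f r (i + 1) ≠ f r i := hne (by omega) (by omega) (by simp [hii])
    have n2 : f r (i + 1) ≠ f (r + 1) i := hne (by omega) (by omega) (by omega)
    have n3 : f r (i + 1) ≠ f (r + 1) (i + 1) := hne (by omega) (by omega) (by omega)
    have n4 : f (r + 1) (i + 1) ≠ f r (i - 1) := hne (by omega) (by omega) (by omega)
    have n5 : f (r + 1) (i + 1) ≠ f r i := hne (by omega) (by omega) (by omega)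
    have n6 : f (r + 1) (i + 1) ≠ f (r + 1) i := hne (by omega) (by omega) (by simp [hii])
    have n7 : f (r + 1) (i + 1) ≠ f (r - 1) i := hne (by omega) (by omega) (by omega)
    have n8 : f (r + 1) i ≠ f (r - 1) i := hne (by omega) (by omega) (by omega)
    have n9 : f (r + 1) i ≠ f r i := hne (by omega) (by omega) (by omega)
    have hAB : A ≠ B := by
      rintro rfl
      have : f r (i + 1) ∈ K.inc A := by simp [hA]
      simp [hB, n1, n2, n3] at this
    have hAC : A ≠ C := by
      rintro rfl
      have : f (r + 1) (i + 1) ∈ K.inc A := by simp [hA]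
      simp [hC, n4, n5, n6] at this
    have hBC : B ≠ C := by
      rintro rfl
      have : f (r + 1) (i + 1) ∈ K.inc B := by simp [hB]
      simp [hC, n4, n5, n6] at this
    have hDA : D ≠ A := by
      rintro rfl
      have : f (r + 1) (i + 1) ∈ K.inc D := by simp [hA]
      simp [hD, n7, n5, n3.symm] at this
    have hDB : D ≠ B := by
      rintro rfl
      have : f (r + 1) (i + 1) ∈ K.inc D := by simp [hB]
      simp [hD, n7, n5, n3.symm] at this
    have hDC : D ≠ C := by
      rintro rfl
      have : f (r + 1) i ∈ K.inc D := by simp [hC]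
      simp [hD, n8, n9, n2.symm] at this
    have e1 := mem_iff_mem_of_notMem_range hT (a := f r i) n5.symm (hnext (i + 1)) (v := A)
      (w := B) (by simp [hA]) (by simp [hA]) (by simp [hB]) (by simp [hB])
    have e2 := mem_iff_mem_of_notMem_range hT (a := f r i) n9.symm (hnext i) (v := B)
      (w := C) (by simp [hB]) (by simp [hB]) (by simp [hC]) (by simp [hC])
    have e3 := mem_iff_mem_of_notMem_range hT (a := f r i) n1.symm hn (v := A)
      (w := D) (by simp [hA]) (by simp [hA]) (by simp [hD]) (by simp [hD])
    have hcard : #({D, A, B, C} : Finset V) = 4 := by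
      rw [card_insert_of_notMem (by simp [hDA, hDB, hDC]),
        card_eq_three.2 ⟨A, B, C, hAB, hAC, hBC, rfl⟩]
    obtain ⟨j, hj⟩ := hi
    -- No belt edge separates the four vertices, so they are on the same side, where flatness allows
    -- only three.
    have key : ∀ S : Finset V, A ∈ S → B ∈ S → C ∈ S → D ∈ S → 4 ≤ K.degIn S (x j) := by
      intro S h1 h2 h3 h4
      rw [← hcard]
      refine card_le_card ?_
      simp [insert_subset_iff, hj, hA, hB, hC, hD, h1, h2, h3, h4]
    by_cases hAT : A ∈ T
    · have := key T hAT (e1.1 hAT) (e2.1 (e1.1 hAT)) (e3.1 hAT)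
      have := hflat j
      omega
    · have := key Tᶜ (by simpa) (by rw [mem_compl]; tauto) (by rw [mem_compl]; tauto)
        (by rw [mem_compl]; tauto)
      have := hflat' j
      omega
  have hall : ∀ i, f r i ∈ Set.range x := by
    have : ∀ m : ℕ, f r (i₀ + m) ∈ Set.range x := by
      intro m
      induction m with
      | zero => simpa using hi₀
      | succ m ih =>
        rw [Nat.cast_succ, ← add_assoc]
        exact hstep _ ih
    intro i
    have hm := this (i - i₀).val
    rwa [ZMod.natCast_zmod_val, add_sub_cancel] at hm
  refine ⟨r, hr1, hrk, ?_⟩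
  have hsub : univ.image (f r) ⊆ univ.image x := by
    intro z hz
    obtain ⟨i, -, rfl⟩ := mem_image.1 hz
    obtain ⟨j, hj⟩ := hall i
    exact mem_image.2 ⟨j, mem_univ _, hj⟩
  have heq := eq_of_subset_of_card_le hsub (by
    rw [card_image_of_injective _ hx.injective,
      card_image_of_injective _ (h.belt r (by omega)).injective])
  have := congrArg (fun s : Finset F => (s : Set F)) heq
  simpa using this.symm

/-- Ring `r` has 5(k + 1 - r) + 1 facets on one side and 5r + 1 on the other, both more than one. -/
lemma IsTube.ring_mem (hK : K.IsFullerene) (h : K.IsTube (k + 1) b t f) {r : ℕ} (hr1 : 1 ≤ r)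
    (hrk : r ≤ k) : Set.range (f r) ∈ K.beltSets \ K.pentagonLinks := by
  have hb := h.belt r (by omega)
  refine ⟨⟨f r, hb, rfl⟩, fun hmem => ?_⟩
  obtain ⟨T, hT, hc⟩ := h.region r (by omega)
  have h2 := card_inner_add_card_inner_compl hb.injective hT
  rw [h.card_eq] at h2
  rcases hK.card_inner_of_mem_pentagonLinks hb hT hmem with h1 | h1 <;> omega

lemma IsTube.ncard_beltSets (hK : K.IsFullerene) (h : K.IsTube (k + 1) b t f) :
    K.beltSets.ncard = 12 + k := by
  have hd : K.beltSets \ K.pentagonLinks = (fun r => Set.range (f r)) '' Set.Icc 1 k := by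
    ext B
    constructor
    · rintro ⟨⟨x, hx, rfl⟩, hn⟩
      obtain ⟨r, hr1, hrk, hr⟩ := h.eq_ring hK hx hn
      exact ⟨r, ⟨hr1, hrk⟩, hr.symm⟩
    · rintro ⟨r, ⟨hr1, hrk⟩, rfl⟩
      exact h.ring_mem hK hr1 hrk
  rw [← Set.ncard_sdiff_add_ncard_of_subset hK.pentagonLinks_subset, hd,
    Set.InjOn.ncard_image, hK.ncard_pentagonLinks, Set.ncard_eq_toFinset_card']
  · simp
    omega
  · rintro r ⟨hr1, hrk⟩ s ⟨hs1, hsk⟩ hrs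
    have : f r 0 ∈ Set.range (f s) := by
      rw [← show Set.range (f r) = Set.range (f s) from hrs]
      exact ⟨0, rfl⟩
    obtain ⟨j, hj⟩ := this
    exact (h.injective (by omega) (by omega) hj).1.symm

end Tube

/-- The classification of the five-belts of a fullerene. -/
theorem IsFullerene.five_belts (hK : K.IsFullerene) {x : ZMod 5 → F} (hx : K.IsBelt x)
    (hnt : Set.range x ∉ K.pentagonLinks) :
    (∀ i, K.deg (x i) = 6) ∧ ∃ k, 1 ≤ k ∧
      (∃ (g : DPolytope.Facet k ≃ F) (e : DPolytope.Vertex k ≃ V),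
        ∀ v φ, g φ ∈ K.inc (e v) ↔ φ ∈ DPolytope.facetsAt v) ∧ K.beltSets.ncard = 12 + k := by
  obtain ⟨T, hT⟩ := hx.exists_region (by omega)
  have hT' : K.bd Tᶜ = cycleEdges x := by rw [bd_compl, hT]
  have h1 : #(K.inner T) ≠ 1 := fun h1 => hnt (hK.mem_pentagonLinks_of_card_inner hx hT h1)
  have h2 : #(K.inner Tᶜ) ≠ 1 := fun h1 => hnt (hK.mem_pentagonLinks_of_card_inner hx hT' h1)
  refine ⟨(hK.nontrivial_belt hx hT h1 h2).2.2, ?_⟩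
  obtain ⟨n, b, t, f, hn, h⟩ := hK.exists_tube hx hT h1 h2
  obtain ⟨k, rfl⟩ : ∃ k, n = k + 1 := ⟨n - 1, by omega⟩
  obtain ⟨r, hr1, hrk, -⟩ := h.eq_ring hK hx hnt
  exact ⟨k, by omega, h.exists_equiv, h.ncard_beltSets hK⟩

end TriangulatedSphere

namespace ConvexPolytope

variable {n : ℕ} {P : ConvexPolytope n}

/-! ### Vertices and the directions of edges -/

open Classical in
/-- The facets containing `x`. -/
noncomputable def active (P : ConvexPolytope n) (x : EuclideanSpace ℝ (Fin n)) : Finset (Fin P.m) :=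
  {i | inner ℝ (P.a i) x + P.b i = 0}

lemma mem_active {x : EuclideanSpace ℝ (Fin n)} {i : Fin P.m} :
    i ∈ P.active x ↔ inner ℝ (P.a i) x + P.b i = 0 := by simp [active]

/-- A point of `P` at which the normals of the active facets span. -/
def IsNode (P : ConvexPolytope n) (v : EuclideanSpace ℝ (Fin n)) : Prop :=
  v ∈ P.carrier ∧ ∀ u : EuclideanSpace ℝ (Fin n), (∀ i ∈ P.active v, inner ℝ (P.a i) u = 0) → u = 0

/-- The points of `P` in all the facets of `S`. -/
def face (P : ConvexPolytope n) (S : Set (Fin P.m)) : Set (EuclideanSpace ℝ (Fin n)) :=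
  {x | x ∈ P.carrier ∧ ∀ i ∈ S, i ∈ P.active x}

lemma height_add_smul (i : Fin P.m) (x u : EuclideanSpace ℝ (Fin n)) (t : ℝ) :
    inner ℝ (P.a i) (x + t • u) + P.b i = (inner ℝ (P.a i) x + P.b i) + t * inner ℝ (P.a i) u := by
  rw [inner_add_right, inner_smul_right]
  ring

lemma exists_pos_add_smul_mem {x u : EuclideanSpace ℝ (Fin n)} (hx : x ∈ P.carrier)
    (hu : ∀ i ∈ P.active x, 0 ≤ inner ℝ (P.a i) u) : ∃ ε : ℝ, 0 < ε ∧ x + ε • u ∈ P.carrier := by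
  have h : ∀ i, ∀ᶠ t : ℝ in nhdsWithin 0 (Set.Ioi 0),
      0 ≤ inner ℝ (P.a i) (x + t • u) + P.b i := by
    intro i
    simp only [height_add_smul]
    by_cases hi : i ∈ P.active x
    · filter_upwards [self_mem_nhdsWithin] with t ht
      rw [mem_active.1 hi, zero_add]
      exact mul_nonneg (le_of_lt ht) (hu i hi)
    · have hpos : 0 < inner ℝ (P.a i) x + P.b i :=
        lt_of_le_of_ne (hx i) fun h => hi (mem_active.2 h.symm)
      have hc : Continuous fun t : ℝ => inner ℝ (P.a i) x + P.b i + t * inner ℝ (P.a i) u := by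
        fun_prop
      have := (hc.tendsto 0).eventually (lt_mem_nhds (by simpa using hpos))
      exact (this.filter_mono nhdsWithin_le_nhds).mono fun t ht => ht.le
  obtain ⟨ε, h1, h2⟩ := ((Filter.eventually_all.2 h).and self_mem_nhdsWithin).exists
  exact ⟨ε, h2, h1⟩

lemma IsNode.eq_of_active_subset {v x : EuclideanSpace ℝ (Fin n)} (hv : P.IsNode v)
    (hx : P.active v ⊆ P.active x) :
    x = v := by
  refine sub_eq_zero.1 (hv.2 _ fun i hi => ?_)
  have h1 := mem_active.1 hi
  have h2 := mem_active.1 (hx hi)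
  rw [inner_sub_right]
  linarith

lemma face_eq (S : Set (Fin P.m)) : P.face S = P.carrier ∩ ⋂ i ∈ S, P.facet i := by
  ext x
  simp only [face, facet, mem_active, Set.mem_inter_iff, Set.mem_iInter, Set.mem_ofPred_eq]
  exact ⟨fun h => ⟨h.1, fun i hi => ⟨h.1, h.2 i hi⟩⟩, fun h => ⟨h.1, fun i hi => (h.2 i hi).2⟩⟩

lemma face_mem_faces (S : Set (Fin P.m)) : P.face S ∈ P.faces := ⟨S, face_eq S⟩

lemma IsNode.isVertex {v : EuclideanSpace ℝ (Fin n)} (hv : P.IsNode v) : P.IsVertex {v} := by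
  refine ⟨?_, Set.singleton_nonempty v, by simp⟩
  have : ({v} : Set (EuclideanSpace ℝ (Fin n))) = P.face (P.active v) := by
    ext x
    simp only [Set.mem_singleton_iff]
    constructor
    · rintro rfl
      exact ⟨hv.1, fun i hi => hi⟩
    · intro hx
      exact hv.eq_of_active_subset fun i hi => hx.2 i hi
  rw [this]
  exact face_mem_faces _

lemma IsSimple.card_active (hP : P.IsSimple) {v : EuclideanSpace ℝ (Fin n)} (hv : P.IsNode v) :
    #(P.active v) = n := by
  have h := hP.2 _ hv.isVertex
  have h' : {i : Fin P.m | {v} ⊆ P.facet i} = (P.active v : Set (Fin P.m)) := by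
    ext i
    simp [facet, hv.1, mem_active]
  rwa [h', Set.ncard_coe_finset] at h

/-- The active normals span and there are exactly `n` of them, so they form a basis, and it has a
dual basis. -/
lemma IsSimple.exists_dual (hP : P.IsSimple) {v : EuclideanSpace ℝ (Fin n)} (hv : P.IsNode v) :
    ∃ d : Fin P.m → EuclideanSpace ℝ (Fin n), ∀ i ∈ P.active v, ∀ j ∈ P.active v,
      inner ℝ (P.a j) (d i) = if j = i then 1 else 0 := by
  classical
  let Φ : (EuclideanSpace ℝ (Fin n)) →ₗ[ℝ] (P.active v → ℝ) :=
    LinearMap.pi fun i => (innerSL ℝ (P.a i) : (EuclideanSpace ℝ (Fin n)) →L[ℝ] ℝ).toLinearMap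
  have hΦ : ∀ u i, Φ u i = inner ℝ (P.a i) u := fun u i => rfl
  have hinj : Function.Injective Φ := by
    rw [← LinearMap.ker_eq_bot, eq_bot_iff]
    intro u hu
    refine hv.2 u fun i hi => ?_
    exact congrFun (LinearMap.mem_ker.1 hu) ⟨i, hi⟩
  have hsurj : Function.Surjective Φ := by
    refine (LinearMap.injective_iff_surjective_of_finrank_eq_finrank ?_).1 hinj
    rw [finrank_euclideanSpace_fin, Module.finrank_fintype_fun_eq_card, Fintype.card_coe,
      hP.card_active hv]
  have hex : ∀ i : Fin P.m, ∃ u, ∀ j ∈ P.active v, inner ℝ (P.a j) u = if j = i then 1 else 0 := by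
    intro i
    obtain ⟨u, hu⟩ := hsurj fun j => if j.1 = i then 1 else 0
    exact ⟨u, fun j hj => congrFun hu ⟨j, hj⟩⟩
  choose d hd using hex
  exact ⟨d, fun i _ j hj => hd i j hj⟩

/-- The direction of the edge leaving the facet `i` at the vertex `v`. -/
noncomputable def dir (P : ConvexPolytope n) (v : EuclideanSpace ℝ (Fin n)) :
    Fin P.m → EuclideanSpace ℝ (Fin n) :=
  Classical.epsilon fun d => ∀ i ∈ P.active v, ∀ j ∈ P.active v,
    inner ℝ (P.a j) (d i) = if j = i then 1 else 0

lemma IsSimple.inner_dir (hP : P.IsSimple) {v : EuclideanSpace ℝ (Fin n)} (hv : P.IsNode v)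
    {i j : Fin P.m}
    (hi : i ∈ P.active v) (hj : j ∈ P.active v) :
    inner ℝ (P.a j) (P.dir v i) = if j = i then 1 else 0 :=
  Classical.epsilon_spec (hP.exists_dual hv) i hi j hj

lemma IsSimple.eq_sum_dir (hP : P.IsSimple) {v : EuclideanSpace ℝ (Fin n)} (hv : P.IsNode v)
    (u : EuclideanSpace ℝ (Fin n)) :
    u = ∑ i ∈ P.active v, inner ℝ (P.a i) u • P.dir v i := by
  refine sub_eq_zero.1 (hv.2 _ fun j hj => ?_)
  rw [inner_sub_right, inner_sum, sum_congr rfl fun i hi => by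
    rw [inner_smul_right, hP.inner_dir hv hi hj]]
  simp [hj]

lemma IsSimple.sub_eq_sum_dir (hP : P.IsSimple) {v : EuclideanSpace ℝ (Fin n)} (hv : P.IsNode v)
    (x : EuclideanSpace ℝ (Fin n)) :
    x - v = ∑ i ∈ P.active v, (inner ℝ (P.a i) x + P.b i) • P.dir v i := by
  rw [hP.eq_sum_dir hv (x - v)]
  refine sum_congr rfl fun i hi => ?_
  have := mem_active.1 hi
  rw [inner_sub_right]
  congr 1
  linarith

lemma IsSimple.dir_ne_zero (hP : P.IsSimple) {v : EuclideanSpace ℝ (Fin n)} (hv : P.IsNode v)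
    {i : Fin P.m}
    (hi : i ∈ P.active v) : P.dir v i ≠ 0 := by
  intro h
  have := hP.inner_dir hv hi hi
  simp [h] at this

/-- Each edge at a vertex has another end. -/
lemma IsSimple.exists_end (hP : P.IsSimple) {v : EuclideanSpace ℝ (Fin n)} (hv : P.IsNode v)
    {i : Fin P.m}
    (hi : i ∈ P.active v) : ∃ c : ℝ, 0 < c ∧ P.IsNode (v + c • P.dir v i) ∧
      (P.active v).erase i ⊆ P.active (v + c • P.dir v i) ∧
      i ∉ P.active (v + c • P.dir v i) := by
  classical
  set d := P.dir v i with hd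
  -- Ratio test: some inequality decreases along `d` because `P` is bounded, and the first of these
  -- to become tight marks the other end.
  let J : Finset (Fin P.m) := {l | inner ℝ (P.a l) d < 0}
  have hJ : J.Nonempty := by
    by_contra hJ
    rw [not_nonempty_iff_eq_empty] at hJ
    have hpos : ∀ l, 0 ≤ inner ℝ (P.a l) d := by
      intro l
      by_contra! h
      have : l ∈ J := by simp [J, h]
      simp [hJ] at this
    obtain ⟨R, hR⟩ := P.bounded.exists_norm_le
    have hmem : ∀ t : ℝ, 0 ≤ t → ‖v + t • d‖ ≤ R := by
      intro t ht
      refine hR _ fun l => ?_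
      rw [height_add_smul]
      exact add_nonneg (hv.1 l) (mul_nonneg ht (hpos l))
    have hdpos : 0 < ‖d‖ := norm_pos_iff.2 (hP.dir_ne_zero hv hi)
    have hR0 : ‖v‖ ≤ R := by simpa using hmem 0 le_rfl
    have ht : 0 ≤ (R + ‖v‖ + 1) / ‖d‖ := div_nonneg (by linarith [norm_nonneg v]) hdpos.le
    have h1 := hmem _ ht
    have h2 : ‖((R + ‖v‖ + 1) / ‖d‖) • d‖ = R + ‖v‖ + 1 := by
      rw [norm_smul, Real.norm_of_nonneg ht]
      field_simp
    have h3 := norm_sub_le (v + ((R + ‖v‖ + 1) / ‖d‖) • d) v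
    rw [add_sub_cancel_left, h2] at h3
    linarith
  obtain ⟨l, hl, hmin⟩ := J.exists_min_image
    (fun l => (inner ℝ (P.a l) v + P.b l) / (-inner ℝ (P.a l) d)) hJ
  have hlneg : inner ℝ (P.a l) d < 0 := by simpa [J] using hl
  have hactive : ∀ j ∈ P.active v, 0 ≤ inner ℝ (P.a j) d := by
    intro j hj
    rw [hd, hP.inner_dir hv hi hj]
    split_ifs <;> norm_num
  have hlv : l ∉ P.active v := fun h => absurd (hactive l h) (not_le.2 hlneg)
  set c := (inner ℝ (P.a l) v + P.b l) / (-inner ℝ (P.a l) d) with hc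
  have hcpos : 0 < c := by
    refine div_pos (lt_of_le_of_ne (hv.1 l) fun h => hlv (mem_active.2 h.symm)) ?_
    linarith
  have hcar : v + c • d ∈ P.carrier := by
    intro j
    rw [height_add_smul]
    by_cases hj : inner ℝ (P.a j) d < 0
    · have h1 := hmin j (by simp [J, hj])
      rw [le_div_iff₀ (by linarith)] at h1
      change c * _ ≤ _ at h1
      linarith
    · exact add_nonneg (hv.1 j) (mul_nonneg hcpos.le (not_lt.1 hj))
  have hsub : (P.active v).erase i ⊆ P.active (v + c • d) := by
    intro j hj
    obtain ⟨hji, hj⟩ := mem_erase.1 hj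
    rw [mem_active, height_add_smul, mem_active.1 hj, hd, hP.inner_dir hv hi hj, if_neg hji]
    ring
  have hlact : l ∈ P.active (v + c • d) := by
    have h1 : c * -inner ℝ (P.a l) d = inner ℝ (P.a l) v + P.b l :=
      div_mul_cancel₀ _ (neg_ne_zero.2 hlneg.ne)
    rw [mem_active, height_add_smul]
    linarith
  refine ⟨c, hcpos, ⟨hcar, fun u hu => ?_⟩, hsub, ?_⟩
  · have h1 : u = inner ℝ (P.a i) u • d := by
      nth_rewrite 1 [hP.eq_sum_dir hv u]
      refine (sum_eq_single_of_mem i hi fun j hj hji => ?_)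
      rw [hu j (hsub (mem_erase.2 ⟨hji, hj⟩)), zero_smul]
    have h2 := hu l hlact
    rw [h1, inner_smul_right] at h2
    rw [h1, (mul_eq_zero.1 h2).resolve_right hlneg.ne, zero_smul]
  · rw [mem_active, height_add_smul, mem_active.1 hi, hd, hP.inner_dir hv hi hi, if_pos rfl]
    linarith

/-- A vertex is not in the interior of a segment in `P`. -/
lemma IsNode.not_between {w d : EuclideanSpace ℝ (Fin n)} {s t : ℝ} (hw : P.IsNode w) (hs : 0 < s)
    (ht : 0 < t)
    (hd : d ≠ 0) (h1 : w + s • d ∈ P.carrier) (h2 : w + (-t) • d ∈ P.carrier) : False := by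
  refine hd (hw.2 d fun i hi => ?_)
  have e1 := h1 i
  have e2 := h2 i
  rw [height_add_smul, mem_active.1 hi, zero_add] at e1 e2
  nlinarith [(mul_nonneg_iff_of_pos_left hs).1 e1, (mul_nonneg_iff_of_pos_left ht).1
    (by linarith : 0 ≤ t * -inner ℝ (P.a i) d)]

/-- An edge has only two ends. -/
lemma IsSimple.end_unique (hP : P.IsSimple) {v w : EuclideanSpace ℝ (Fin n)} (hv : P.IsNode v)
    (hw : P.IsNode w)
    {i : Fin P.m} (hi : i ∈ P.active v) {c : ℝ} (hc : 0 < c)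
    (hcn : P.IsNode (v + c • P.dir v i)) (hsub : (P.active v).erase i ⊆ P.active w) :
    w = v ∨ w = v + c • P.dir v i := by
  set d := P.dir v i with hd
  -- In the coordinates of the edge directions only the one for `i` is nonzero, so `w` lies on the
  -- edge line; neither of `w` and the known end can lie strictly between other points of `P`.
  set c' := inner ℝ (P.a i) w + P.b i with hc'
  have hw' : w = v + c' • d := by
    rw [← sub_eq_iff_eq_add', hP.sub_eq_sum_dir hv w]
    refine sum_eq_single_of_mem i hi fun j hj hji => ?_
    rw [mem_active.1 (hsub (mem_erase.2 ⟨hji, hj⟩)), zero_smul]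
  have hd0 := hP.dir_ne_zero hv hi
  have hc0 : 0 ≤ c' := hw.1 i
  rcases hc0.eq_or_lt with h0 | h0
  · left
    rw [hw', ← h0, zero_smul, add_zero]
  right
  rcases lt_trichotomy c' c with h | h | h
  · exfalso
    refine hw.not_between (s := c - c') (t := c') (sub_pos.2 h) h0 hd0 ?_ ?_
    · convert hcn.1 using 1
      rw [hw']
      module
    · convert hv.1 using 1
      rw [hw']
      module
  · rw [hw', h]
  · exfalso
    refine hcn.not_between (s := c' - c) (t := c) (sub_pos.2 h) hc hd0 ?_ ?_
    · convert hw.1 using 1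
      rw [hw']
      module
    · convert hv.1 using 1
      module

/-! ### Faces are the convex hulls of their vertices -/

lemma isCompact_face (S : Set (Fin P.m)) : IsCompact (P.face S) := by
  refine Metric.isCompact_of_isClosed_isBounded ?_ (P.bounded.subset fun x hx => hx.1)
  have h : P.face S = (⋂ i, {x | 0 ≤ inner ℝ (P.a i) x + P.b i}) ∩
      ⋂ i ∈ S, {x | inner ℝ (P.a i) x + P.b i = 0} := by
    ext x
    simp [face, carrier, mem_active]
  rw [h]
  refine (isClosed_iInter fun i => isClosed_le (by fun_prop) (by fun_prop)).inter
    (isClosed_biInter fun i _ => isClosed_eq (by fun_prop) (by fun_prop))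

lemma convex_face (S : Set (Fin P.m)) : Convex ℝ (P.face S) := by
  have key : ∀ (i : Fin P.m) (x y : EuclideanSpace ℝ (Fin n)) (s t : ℝ), s + t = 1 →
      inner ℝ (P.a i) (s • x + t • y) + P.b i =
        s * (inner ℝ (P.a i) x + P.b i) + t * (inner ℝ (P.a i) y + P.b i) := by
    intro i x y s t hst
    rw [inner_add_right, inner_smul_right, inner_smul_right]
    linear_combination (-P.b i) * hst
  intro x hx y hy s t hs ht hst
  refine ⟨fun i => ?_, fun i hi => mem_active.2 ?_⟩
  · rw [key i x y s t hst]
    exact add_nonneg (mul_nonneg hs (hx.1 i)) (mul_nonneg ht (hy.1 i))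
  · rw [key i x y s t hst, mem_active.1 (hx.2 i hi), mem_active.1 (hy.2 i hi)]
    ring

/-- A direction orthogonal to all active normals can be followed a little both ways inside the face,
so at an extreme point it must be zero. -/
lemma isNode_of_mem_extremePoints {S : Set (Fin P.m)} {x : EuclideanSpace ℝ (Fin n)}
    (hx : x ∈ (P.face S).extremePoints ℝ) : P.IsNode x := by
  refine ⟨hx.1.1, fun u hu => ?_⟩
  obtain ⟨s, hs, h1⟩ := exists_pos_add_smul_mem hx.1.1 fun i hi => (hu i hi).ge
  obtain ⟨t, ht, h2⟩ := exists_pos_add_smul_mem (u := -u) hx.1.1 fun i hi => by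
    rw [inner_neg_right, hu i hi, neg_zero]
  have h1' : x + s • u ∈ P.face S := ⟨h1, fun i hi => by
    have := hx.1.2 i hi
    rw [mem_active, height_add_smul, hu i this, mem_active.1 this]
    ring⟩
  have h2' : x + t • -u ∈ P.face S := ⟨h2, fun i hi => by
    have := hx.1.2 i hi
    rw [mem_active, height_add_smul, inner_neg_right, hu i this, mem_active.1 this]
    ring⟩
  have hseg : x ∈ openSegment ℝ (x + s • u) (x + t • -u) := by
    refine ⟨t / (s + t), s / (s + t), by positivity, by positivity, by field_simp; ring, ?_⟩
    have : s + t ≠ 0 := by positivity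
    have e : t / (s + t) = 1 - s / (s + t) := by field_simp; ring
    have e' : t * (s / (s + t)) = s * (t / (s + t)) := by ring
    have e'' : (t / (s + t)) • (x + s • u) + (s / (s + t)) • (x + t • -u) =
        (t / (s + t) + s / (s + t)) • x + (s * (t / (s + t)) - t * (s / (s + t))) • u := by
      module
    rw [e'', e', e]
    simp
  have h3 := hx.2 h1' h2' hseg
  simpa [hs.ne'] using h3

lemma exists_isNode {S : Set (Fin P.m)} (h : (P.face S).Nonempty) :
    ∃ v, P.IsNode v ∧ v ∈ P.face S := by
  obtain ⟨v, hv⟩ := (isCompact_face S).extremePoints_nonempty h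
  exact ⟨v, isNode_of_mem_extremePoints hv, hv.1⟩

/-- Inclusion of faces is seen on their vertices. -/
lemma face_subset_face {S T : Set (Fin P.m)}
    (h : ∀ v, P.IsNode v → v ∈ P.face S → v ∈ P.face T) :
    P.face S ⊆ P.face T := by
  rw [← closure_convexHull_extremePoints (isCompact_face S) (convex_face S)]
  refine closure_minimal (convexHull_min (fun v hv => ?_) (convex_face T))
    (isCompact_face T).isClosed
  exact h v (isNode_of_mem_extremePoints hv) hv.1

/-- Irredundancy gives a point violating only inequality `i`. The segment to it from a point of `P`
crosses the hyperplane inside `P`. -/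
lemma face_singleton_nonempty (hP : P.IsFullDim) (i : Fin P.m) : (P.face {i}).Nonempty := by
  obtain ⟨x, hx⟩ := hP
  have hx : x ∈ P.carrier := interior_subset hx
  have h : ∃ y, (∀ j, j ≠ i → 0 ≤ inner ℝ (P.a j) y + P.b j) ∧ inner ℝ (P.a i) y + P.b i < 0 := by
    by_contra! h
    refine P.irredundant i (Set.Subset.antisymm (fun y hy j => ?_) fun y hy j _ => hy j)
    by_cases hj : j = i
    · subst hj
      exact h y hy
    · exact hy j hj
  obtain ⟨y, hy, hyi⟩ := h
  set p := inner ℝ (P.a i) x + P.b i with hp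
  set q := inner ℝ (P.a i) y + P.b i with hq
  have hp0 : 0 ≤ p := hx i
  have hpq : 0 < p - q := by linarith
  have key : ∀ j, inner ℝ (P.a j) (x + (p / (p - q)) • (y - x)) + P.b j =
      (-q / (p - q)) * (inner ℝ (P.a j) x + P.b j) +
        (p / (p - q)) * (inner ℝ (P.a j) y + P.b j) := by
    intro j
    rw [height_add_smul, inner_sub_right]
    field_simp
    ring
  have hz : inner ℝ (P.a i) (x + (p / (p - q)) • (y - x)) + P.b i = 0 := by
    rw [key, ← hp, ← hq]
    ring
  refine ⟨x + (p / (p - q)) • (y - x), fun j => ?_, ?_⟩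
  · by_cases hj : j = i
    · rw [hj, hz]
    · rw [key]
      exact add_nonneg (mul_nonneg (div_nonneg (by linarith) hpq.le) (hx j))
        (mul_nonneg (div_nonneg hp0 hpq.le) (hy j hj))
  · rintro j rfl
    exact mem_active.2 hz

/-! ### Linear functionals on the vertices -/

/-- The type of vertices of `P`. -/
abbrev Node (P : ConvexPolytope n) := {v : EuclideanSpace ℝ (Fin n) // P.IsNode v}

lemma active_injective : Function.Injective fun v : P.Node => P.active v :=
  fun _ w h => Subtype.ext (w.2.eq_of_active_subset (Eq.ge h))

instance : Finite P.Node := Finite.of_injective _ active_injective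

noncomputable instance : Fintype P.Node := Fintype.ofFinite _

noncomputable instance : DecidableEq P.Node := Classical.decEq _

lemma exists_generic (P : ConvexPolytope n) : ∃ f : EuclideanSpace ℝ (Fin n) →ₗ[ℝ] ℝ,
    Function.Injective fun v : P.Node => f v := by
  obtain ⟨f, hf⟩ := Module.exists_dual_forall_apply_ne_zero (K := ℝ)
    (fun p : {p : P.Node × P.Node // p.1 ≠ p.2} => (p.1.1.1 - p.1.2.1))
    fun p h => p.2 (Subtype.ext (sub_eq_zero.1 h))
  refine ⟨f, fun v w h => ?_⟩
  by_contra hne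
  refine hf ⟨(v, w), hne⟩ ?_
  rw [map_sub]
  exact sub_eq_zero.2 h

lemma IsSimple.apply_dir_ne_zero (hP : P.IsSimple) {f : EuclideanSpace ℝ (Fin n) →ₗ[ℝ] ℝ}
    (hf : Function.Injective fun v : P.Node => f v) (v : P.Node) {i : Fin P.m}
    (hi : i ∈ P.active v) : f (P.dir v i) ≠ 0 := by
  intro h
  obtain ⟨c, hc, hn, -⟩ := hP.exists_end v.2 hi
  have h1 := congrArg Subtype.val (@hf ⟨_, hn⟩ v (by simp [h]))
  simp [hc.ne', hP.dir_ne_zero v.2 hi] at h1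

/-- `v` is the highest vertex of the face `S` with respect to `f`. -/
def IsTop (P : ConvexPolytope n) (f : EuclideanSpace ℝ (Fin n) →ₗ[ℝ] ℝ) (S : Set (Fin P.m))
    (v : EuclideanSpace ℝ (Fin n)) : Prop :=
  (∀ i ∈ S, i ∈ P.active v) ∧ ∀ i ∈ P.active v, i ∉ S → f (P.dir v i) < 0

/-- Maximise `f` among the vertices of the face satisfying `Q`. As `Q` passes along edges of the
face, this is a local maximum of the whole face. -/
lemma IsSimple.exists_isTop (hP : P.IsSimple) {f : EuclideanSpace ℝ (Fin n) →ₗ[ℝ] ℝ}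
    (hf : Function.Injective fun v : P.Node => f v) {S : Set (Fin P.m)} {Q : P.Node → Prop}
    (hQ : ∀ v w : P.Node, (∀ j ∈ S, j ∈ P.active v) → (∀ j ∈ S, j ∈ P.active w) →
      ∀ i ∈ P.active v, (P.active v).erase i ⊆ P.active w → Q v → Q w)
    {v₀ : P.Node} (h₀ : ∀ j ∈ S, j ∈ P.active v₀) (hQ₀ : Q v₀) :
    ∃ v : P.Node, P.IsTop f S v ∧ Q v := by
  classical
  obtain ⟨v, hv, hmax⟩ := exists_max_image
    ({v | (∀ j ∈ S, j ∈ P.active v) ∧ Q v} : Finset P.Node) (fun v => f v)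
    ⟨v₀, by simpa using ⟨h₀, hQ₀⟩⟩
  obtain ⟨hvS, hvQ⟩ : (∀ j ∈ S, j ∈ P.active v) ∧ Q v := by simpa using hv
  refine ⟨v, ⟨hvS, fun i hi hiS => ?_⟩, hvQ⟩
  obtain ⟨c, hc, hn, hsub, -⟩ := hP.exists_end v.2 hi
  have hwS : ∀ j ∈ S, j ∈ P.active (v + c • P.dir v i) := fun j hj =>
    hsub (mem_erase.2 ⟨fun h => hiS (h ▸ hj), hvS j hj⟩)
  have h1 := hmax ⟨_, hn⟩ (by simpa using ⟨hwS, hQ v ⟨_, hn⟩ hvS hwS i hi hsub hvQ⟩)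
  simp only [map_add, map_smul, smul_eq_mul, add_le_iff_nonpos_right] at h1
  exact lt_of_le_of_ne (nonpos_of_mul_nonpos_right h1 hc) (hP.apply_dir_ne_zero hf v hi)

/-- The face lies in the cone spanned at `v` by its edge directions, all descending, so a local
maximum is global. -/
lemma IsSimple.isTop_unique (hP : P.IsSimple) {f : EuclideanSpace ℝ (Fin n) →ₗ[ℝ] ℝ}
    (hf : Function.Injective fun v : P.Node => f v) {S : Set (Fin P.m)} {v w : P.Node}
    (hv : P.IsTop f S v) (hw : P.IsTop f S w) : v = w := by
  have key : ∀ v w : P.Node, P.IsTop f S v → P.IsTop f S w → f w ≤ f v := by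
    intro v w hv hw
    rw [← sub_nonpos, ← map_sub, hP.sub_eq_sum_dir v.2 w, map_sum]
    refine sum_nonpos fun i hi => ?_
    rw [map_smul, smul_eq_mul]
    by_cases hiS : i ∈ S
    · rw [mem_active.1 (hw.1 i hiS), zero_mul]
    · exact mul_nonpos_of_nonneg_of_nonpos (w.2.1 i) (hv.2 i hi hiS).le
  exact hf (le_antisymm (key w v hw hv) (key v w hv hw))

/-- The graph of a face is connected. -/
lemma IsSimple.face_connected (hP : P.IsSimple) {S : Set (Fin P.m)} {Q : P.Node → Prop}
    (hQ : ∀ v w : P.Node, (∀ j ∈ S, j ∈ P.active v) → (∀ j ∈ S, j ∈ P.active w) →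
      ∀ i ∈ P.active v, (P.active v).erase i ⊆ P.active w → (Q v ↔ Q w))
    {v w : P.Node} (hv : ∀ j ∈ S, j ∈ P.active v) (hw : ∀ j ∈ S, j ∈ P.active w) (h : Q v) :
    Q w := by
  -- Otherwise `Q` and its negation each reach a local maximum of a generic functional, and these
  -- coincide.
  by_contra hn
  obtain ⟨f, hf⟩ := exists_generic P
  obtain ⟨a, ha, haQ⟩ := hP.exists_isTop hf
    (fun v w h1 h2 i hi h3 => (hQ v w h1 h2 i hi h3).1) hv h
  obtain ⟨b, hb, hbQ⟩ := hP.exists_isTop (Q := fun v => ¬ Q v) hf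
    (fun v w h1 h2 i hi h3 => mt (hQ v w h1 h2 i hi h3).2) hw hn
  rw [hP.isTop_unique hf ha hb] at haQ
  exact hbQ haQ

lemma IsSimple.card_isTop (hP : P.IsSimple) {f : EuclideanSpace ℝ (Fin n) →ₗ[ℝ] ℝ}
    (hf : Function.Injective fun v : P.Node => f v) {S : Set (Fin P.m)} (hS : (P.face S).Nonempty)
    [DecidablePred fun v : P.Node => P.IsTop f S v] : #{v : P.Node | P.IsTop f S v} = 1 := by
  obtain ⟨v₀, hn, hv₀⟩ := exists_isNode hS
  obtain ⟨v, hv, -⟩ := hP.exists_isTop (Q := fun _ => True) hf (fun _ _ _ _ _ _ _ _ => trivial)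
    (v₀ := ⟨v₀, hn⟩) hv₀.2 trivial
  rw [card_eq_one]
  refine ⟨v, ?_⟩
  ext w
  simp only [mem_filter_univ, mem_singleton]
  exact ⟨fun hw => hP.isTop_unique hf hw hv, fun h => h ▸ hv⟩

/-- The local count for Euler's formula: at a vertex, `i` counts when both other edges go down, or
both go up. That is one `i` for mixed edges and all three at the extreme vertices. -/
lemma card_filter_add_card_filter_not {α : Type*} [DecidableEq α] {s : Finset α} (hs : #s = 3)
    (p : α → Prop) [DecidablePred p] :
    #{i ∈ s | ∀ j ∈ s, j ≠ i → p j} + #{i ∈ s | ∀ j ∈ s, j ≠ i → ¬ p j} =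
      1 + 2 * (if ∀ j ∈ s, p j then 1 else 0) + 2 * (if ∀ j ∈ s, ¬ p j then 1 else 0) := by
  obtain ⟨a, b, c, hab, hac, hbc, rfl⟩ := card_eq_three.1 hs
  by_cases ha : p a <;> by_cases hb : p b <;> by_cases hc : p c <;>
    simp [filter_insert, filter_singleton, ha, hb, hc, hab, hac, hbc, hab.symm, hac.symm, hbc.symm]

/-- Euler's formula. -/
lemma IsSimple.card_node {P : ConvexPolytope 3} (hP : P.IsSimple) :
    Fintype.card P.Node + 4 = 2 * P.m := by
  classical
  obtain ⟨f, hf⟩ := exists_generic P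
  have hfneg : Function.Injective fun v : P.Node => (-f) v := fun v w h => hf (by simpa using h)
  have hall : P.carrier.Nonempty := hP.1.mono interior_subset
  have hempty : (P.face ∅).Nonempty := hall.mono fun x hx => ⟨hx, by simp⟩
  have hneg : ∀ (v : P.Node) (S : Set (Fin P.m)), P.IsTop (-f) S v ↔
      (∀ i ∈ S, i ∈ P.active v) ∧ ∀ i ∈ P.active v, i ∉ S → ¬ f (P.dir v i) < 0 := by
    intro v S
    refine and_congr_right fun _ => forall₃_congr fun i hi hiS => ?_
    rw [LinearMap.neg_apply, neg_lt_zero, not_lt]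
    exact ⟨le_of_lt, fun h => lt_of_le_of_ne h (hP.apply_dir_ne_zero hf v hi).symm⟩
  -- Each facet has exactly one top vertex. Doing this for `f` and `-f` counts 2m, against V + 2 + 2
  -- from the vertices.
  have count : ∀ g : EuclideanSpace ℝ (Fin 3) →ₗ[ℝ] ℝ,
      (Function.Injective fun v : P.Node => g v) →
      ∑ v : P.Node, #{i | P.IsTop g {i} v} = P.m := by
    intro g hg
    simp_rw [card_filter]
    rw [sum_comm]
    simp_rw [← card_filter, hP.card_isTop hg (face_singleton_nonempty hP.1 _)]
    simp
  have h1 := count f hf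
  have h2 := count (-f) hfneg
  have h3 := hP.card_isTop hf hempty
  have h4 := hP.card_isTop hfneg hempty
  rw [card_filter] at h3 h4
  have h5 : ∀ v : P.Node, #{i | P.IsTop f {i} v} + #{i | P.IsTop (-f) {i} v} =
      1 + 2 * (if P.IsTop f ∅ v then 1 else 0) + 2 * (if P.IsTop (-f) ∅ v then 1 else 0) := by
    intro v
    have := card_filter_add_card_filter_not (hP.card_active v.2) fun i => f (P.dir v i) < 0
    simp only [hneg]
    convert this using 2
    · exact congrArg card (by ext i; simp [IsTop])
    · exact congrArg card (by ext i; simp)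
    all_goals simp [IsTop]
  have h6 := sum_congr (rfl : (univ : Finset P.Node) = univ) fun v _ => h5 v
  rw [sum_add_distrib, sum_add_distrib, sum_add_distrib, ← mul_sum, ← mul_sum, h1, h2, h3, h4] at h6
  simp only [sum_const, card_univ, smul_eq_mul, mul_one] at h6
  omega

end ConvexPolytope

namespace TriangulatedSphere

variable {F V : Type*} [Fintype F] [Fintype V] [DecidableEq F] [DecidableEq V]
  {K : TriangulatedSphere F V}

/-- A vertex has as many neighbours as its degree. -/
lemma ncard_adj (y : F) : {z | K.Adj z y}.ncard = K.deg y := by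
  classical
  have h := card_mul_eq_card_mul (s := ({z | K.Adj z y} : Finset F)) (t := K.star y)
    (m := 2) (n := 2) (fun z v => z ∈ K.inc v) (fun z hz => ?_) fun v hv => ?_
  · rw [Set.ncard_eq_toFinset_card']
    simp only [Set.toFinset_ofPred]
    exact Nat.eq_of_mul_eq_mul_right two_pos h
  · obtain ⟨hzy, v, hzv, hyv⟩ : K.Adj z y := by simpa using hz
    rw [← K.card_cofaces v {z, y} (by simp [insert_subset_iff, hzv, hyv]) (card_pair hzy)]
    congr 1
    ext w
    simp [bipartiteAbove, mem_star, insert_subset_iff, and_comm]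
  · have hv' := mem_star.1 hv
    have h2 : #((K.inc v).erase y) = 2 := by rw [card_erase_of_mem hv', K.card_inc]
    rw [← h2]
    congr 1
    ext z
    simp only [bipartiteBelow, mem_filter, mem_univ, true_and, mem_erase]
    exact ⟨fun h => ⟨h.1.1, h.2⟩, fun h => ⟨⟨h.1, v, h.2, hv'⟩, h.2⟩⟩

end TriangulatedSphere

/-! ### The dual sphere of a simple 3-polytope. -/

namespace ConvexPolytope

variable {P : ConvexPolytope 3}

lemma facet_inter_facet (i j : Fin P.m) : P.facet i ∩ P.facet j = P.face {i, j} := by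
  ext x
  simp only [facet, face, mem_active, Set.mem_inter_iff, Set.mem_ofPred_eq, Set.mem_insert_iff,
    Set.mem_singleton_iff, forall_eq_or_imp, forall_eq]
  tauto

lemma facet_eq_face (i : Fin P.m) : P.facet i = P.face {i} := by
  ext x
  simp [facet, face, mem_active]

/-- The dual triangulated sphere of a simple polytope. -/
noncomputable def sphere (P : ConvexPolytope 3) (hP : P.IsSimple) :
    TriangulatedSphere (Fin P.m) P.Node where
  inc v := P.active v
  card_inc v := hP.card_active v.2
  inc_injective := active_injective
  card_cofaces v e he hcard := by
    obtain ⟨i, hi⟩ : ∃ i, P.active v \ e = {i} := by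
      rw [← card_eq_one, card_sdiff_of_subset he, hP.card_active v.2, hcard]
    have hiv : i ∈ P.active v ∧ i ∉ e := mem_sdiff.1 (hi ▸ mem_singleton_self i)
    have hee : (P.active v).erase i = e := by
      rw [← sdiff_singleton_eq_erase, ← hi, sdiff_sdiff_right_self]
      exact inter_eq_right.2 he
    obtain ⟨c, hc, hn, hsub, hnot⟩ := hP.exists_end v.2 hiv.1
    have hne : v ≠ ⟨_, hn⟩ := fun h =>
      hnot ((congrArg (fun w : P.Node => i ∈ P.active w) h).mp hiv.1)
    rw [← card_pair hne]
    congr 1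
    ext w
    simp only [mem_filter_univ, mem_insert, mem_singleton]
    rw [← hee]
    constructor
    · exact fun h => (hP.end_unique v.2 w.2 hiv.1 hc hn h).imp Subtype.ext Subtype.ext
    · rintro (rfl | rfl)
      · exact erase_subset _ _
      · exact hsub
  star_connected x Q hQ v w hv hw h := by
    refine hP.face_connected (S := {x}) (fun v w hv hw i hi hsub => ?_) (by simpa using hv)
      (by simpa using hw) h
    have h2 : 2 ≤ #(P.active v ∩ P.active w) := by
      refine le_trans ?_ (card_le_card (subset_inter (erase_subset i _) hsub))
      rw [card_erase_of_mem hi, hP.card_active v.2]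
    exact ⟨hQ v w (hv x rfl) (hw x rfl) h2,
      hQ w v (hw x rfl) (hv x rfl) (by rwa [inter_comm])⟩
  connected Q hQ v w h := by
    refine hP.face_connected (S := ∅) (fun v w hv hw i hi hsub => ?_) (by simp) (by simp) h
    have h2 : 2 ≤ #(P.active v ∩ P.active w) := by
      refine le_trans ?_ (card_le_card (subset_inter (erase_subset i _) hsub))
      rw [card_erase_of_mem hi, hP.card_active v.2]
    exact ⟨hQ v w h2, hQ w v (by rwa [inter_comm])⟩
  exists_mem_inc x := by
    obtain ⟨v, hv, h⟩ := exists_isNode (face_singleton_nonempty hP.1 x)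
    exact ⟨⟨v, hv⟩, h.2 x rfl⟩
  euler := by simpa using hP.card_node

/-! ### Edges -/

lemma IsSimple.exists_mem_face (hP : P.IsSimple) {S : Set (Fin P.m)}
    {v : EuclideanSpace ℝ (Fin 3)} (hv : P.IsNode v) (hS : ∀ i ∈ S, i ∈ P.active v) {i : Fin P.m}
    (hi : i ∈ P.active v) (hiS : i ∉ S) :
    ∃ c : ℝ, 0 < c ∧ v + c • P.dir v i ∈ P.face S ∧ i ∉ P.active (v + c • P.dir v i) := by
  obtain ⟨c, hc, hn, hsub, hnot⟩ := hP.exists_end hv hi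
  exact ⟨c, hc, ⟨hn.1, fun j hj => hsub (mem_erase.2 ⟨fun h => hiS (h ▸ hj), hS j hj⟩)⟩, hnot⟩

lemma IsSimple.dir_mem_vectorSpan (hP : P.IsSimple) {S : Set (Fin P.m)}
    {v : EuclideanSpace ℝ (Fin 3)} (hv : P.IsNode v) (hS : ∀ i ∈ S, i ∈ P.active v) {i : Fin P.m}
    (hi : i ∈ P.active v) (hiS : i ∉ S) : P.dir v i ∈ vectorSpan ℝ (P.face S) := by
  obtain ⟨c, hc, hmem, -⟩ := hP.exists_mem_face hv hS hi hiS
  have h := vsub_mem_vectorSpan ℝ hmem (⟨hv.1, hS⟩ : v ∈ P.face S)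
  rw [vsub_eq_sub, add_sub_cancel_left] at h
  exact (Submodule.smul_mem_iff _ hc.ne').1 h

/-- The directions `dir v i` with `i ∉ S` are independent vectors in the span of the face, so
dimension one means that exactly one active facet is missing from `S`. -/
lemma IsSimple.isEdge_face_iff (hP : P.IsSimple) {S : Set (Fin P.m)}
    {v : EuclideanSpace ℝ (Fin 3)} (hv : P.IsNode v) (hS : ∀ i ∈ S, i ∈ P.active v) :
    P.IsEdge (P.face S) ↔ ∃ i ∈ P.active v, S = (P.active v).erase i := by
  have hvS : v ∈ P.face S := ⟨hv.1, hS⟩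
  constructor
  · rintro ⟨-, -, h⟩
    obtain ⟨u, -, hu⟩ := finrank_eq_one_iff'.1 h
    have h2 : ∀ i ∈ P.active v, i ∉ S → ∃ s : ℝ, s • (u : EuclideanSpace ℝ (Fin 3)) =
        P.dir v i := by
      intro i hi hiS
      obtain ⟨s, hs⟩ := hu ⟨_, hP.dir_mem_vectorSpan hv hS hi hiS⟩
      exact ⟨s, congrArg Subtype.val hs⟩
    obtain ⟨i, hi, hiS⟩ : ∃ i ∈ P.active v, i ∉ S := by
      by_contra! hall
      have h3 : P.face S = {v} := Set.eq_singleton_iff_unique_mem.2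
        ⟨hvS, fun x hx => hv.eq_of_active_subset fun i hi => hx.2 i (hall i hi)⟩
      have h4 : Module.finrank ℝ (vectorSpan ℝ (P.face S)) = 0 := by
        rw [h3, vectorSpan_singleton, finrank_bot]
      omega
    refine ⟨i, hi, Set.Subset.antisymm (fun j hj => ?_) fun j hj => ?_⟩
    · exact mem_coe.2 (mem_erase.2 ⟨fun h => hiS (h ▸ hj), hS j hj⟩)
    · obtain ⟨hji, hj⟩ := mem_erase.1 (mem_coe.1 hj)
      by_contra hjS
      obtain ⟨s, hs⟩ := h2 i hi hiS
      obtain ⟨t, ht⟩ := h2 j hj hjS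
      have e1 := hP.inner_dir hv hi hi
      have e2 := hP.inner_dir hv hj hi
      have e3 := hP.inner_dir hv hj hj
      rw [← hs, inner_smul_right, if_pos rfl] at e1
      rw [← ht, inner_smul_right, if_neg hji.symm] at e2
      rw [← ht, inner_smul_right, if_pos rfl] at e3
      rcases mul_eq_zero.1 e2 with h0 | h0
      · simp [h0] at e3
      · simp [h0] at e1
  · rintro ⟨i, hi, rfl⟩
    refine ⟨face_mem_faces _, ⟨v, hvS⟩, ?_⟩
    have : vectorSpan ℝ (P.face ((P.active v).erase i)) = Submodule.span ℝ {P.dir v i} := by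
      refine le_antisymm ?_ ?_
      · rw [vectorSpan_eq_span_vsub_set_right ℝ hvS, Submodule.span_le]
        rintro _ ⟨x, hx, rfl⟩
        refine Submodule.mem_span_singleton.2 ⟨inner ℝ (P.a i) x + P.b i, ?_⟩
        simp only [vsub_eq_sub]
        rw [hP.sub_eq_sum_dir hv x, sum_eq_single_of_mem i hi fun j hj hji => ?_]
        rw [mem_active.1 (hx.2 j (mem_coe.2 (mem_erase.2 ⟨hji, hj⟩))), zero_smul]
      · rw [Submodule.span_singleton_le_iff_mem]
        exact hP.dir_mem_vectorSpan hv hS hi (by simp)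
    rw [this, finrank_span_singleton (hP.dir_ne_zero hv hi)]

/-! ### Adjacency, polygons, belts and face lattices read on the dual sphere. -/

variable (hP : P.IsSimple)
include hP

lemma IsSimple.facet_inter_nonempty_iff {i j : Fin P.m} (hij : i ≠ j) :
    (P.facet i ∩ P.facet j).Nonempty ↔ (P.sphere hP).Adj i j := by
  rw [facet_inter_facet]
  constructor
  · intro h
    obtain ⟨v, hv, h⟩ := exists_isNode h
    exact ⟨hij, ⟨v, hv⟩, h.2 i (by simp), h.2 j (by simp)⟩
  · rintro ⟨-, v, hi, hj⟩
    refine ⟨v, v.2.1, ?_⟩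
    rintro k (rfl | rfl)
    exacts [hi, hj]

lemma IsSimple.isEdge_facet_inter_iff {i j : Fin P.m} :
    P.IsEdge (P.facet i ∩ P.facet j) ↔ (P.sphere hP).Adj i j := by
  rw [facet_inter_facet]
  constructor
  · intro h
    obtain ⟨v, hv, hm⟩ := exists_isNode h.2.1
    obtain ⟨k, hk, hS⟩ := (hP.isEdge_face_iff hv hm.2).1 h
    refine ⟨?_, ⟨v, hv⟩, hm.2 i (by simp), hm.2 j (by simp)⟩
    rintro rfl
    have h1 := congrArg Set.ncard hS
    rw [Set.ncard_coe_finset, card_erase_of_mem hk, hP.card_active hv] at h1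
    simp at h1
  · rintro ⟨hij, v, hi, hj⟩
    have hsub : ({i, j} : Finset (Fin P.m)) ⊆ P.active v := by
      rw [insert_subset_iff, singleton_subset_iff]
      exact ⟨hi, hj⟩
    obtain ⟨k, hk⟩ : ∃ k, P.active v \ {i, j} = {k} := by
      rw [← card_eq_one, card_sdiff_of_subset hsub, hP.card_active v.2, card_pair hij]
    rw [hP.isEdge_face_iff v.2 (by rintro l (rfl | rfl) <;> assumption)]
    refine ⟨k, (mem_sdiff.1 (hk ▸ mem_singleton_self k)).1, ?_⟩
    rw [← sdiff_singleton_eq_erase, ← hk, sdiff_sdiff_right_self, inf_eq_inter,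
      inter_eq_right.2 hsub]
    simp

/-- The edges of a facet correspond to its neighbours. -/
lemma IsSimple.edges_facet (i : Fin P.m) : {e | P.IsEdge e ∧ e ⊆ P.facet i} =
    (fun j => P.facet j ∩ P.facet i) '' {j | (P.sphere hP).Adj j i} := by
  ext e
  constructor
  · rintro ⟨he, hei⟩
    obtain ⟨S, rfl⟩ := he.1
    rw [← face_eq] at he hei ⊢
    obtain ⟨v, hv, hm⟩ := exists_isNode he.2.1
    have hi : i ∈ P.active v := mem_active.2 (hei hm).2
    obtain ⟨k, hk, hS⟩ := (hP.isEdge_face_iff hv hm.2).1 he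
    have hik : i ≠ k := by
      rintro rfl
      obtain ⟨c, -, h1, h2⟩ := hP.exists_mem_face hv hm.2 hk (by simp [hS])
      exact h2 (mem_active.2 (hei h1).2)
    obtain ⟨j, hj⟩ : ∃ j, ((P.active v).erase k).erase i = {j} := by
      rw [← card_eq_one, card_erase_of_mem (mem_erase.2 ⟨hik, hi⟩), card_erase_of_mem hk,
        hP.card_active hv]
    have hj' : j ∈ ((P.active v).erase k).erase i := hj ▸ mem_singleton_self j
    refine ⟨j, ⟨(mem_erase.1 hj').1, ⟨v, hv⟩, (mem_erase.1 (mem_erase.1 hj').2).2, hi⟩, ?_⟩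
    have hS' : S = {j, i} := by
      rw [hS, ← insert_erase (mem_erase.2 ⟨hik, hi⟩), hj]
      simp [Set.pair_comm]
    simp only [facet_inter_facet, hS']
  · rintro ⟨j, hj, rfl⟩
    exact ⟨hP.isEdge_facet_inter_iff.2 hj, Set.inter_subset_right⟩

/-- Different neighbours give different edges: moving from a common vertex in the direction that
leaves `j'` stays on the edge with `j`. -/
lemma IsSimple.isGon_iff {k : ℕ} {i : Fin P.m} : P.IsGon k i ↔ (P.sphere hP).deg i = k := by
  rw [IsGon, hP.edges_facet, Set.InjOn.ncard_image, TriangulatedSphere.ncard_adj]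
  rintro j ⟨hji, v, hj, hi⟩ j' ⟨hji', v', hj', hi'⟩ h
  by_contra hne
  simp only [facet_inter_facet] at h
  have hm : ∀ l ∈ ({j, i} : Set (Fin P.m)), l ∈ P.active v := by
    rintro l (rfl | rfl) <;> assumption
  have hv : v.1 ∈ P.face {j', i} := h ▸ ⟨v.2.1, hm⟩
  obtain ⟨c, -, h1, h2⟩ := hP.exists_mem_face v.2 hm (hv.2 j' (by simp))
    (by simp [hji', Ne.symm hne])
  rw [h] at h1
  exact h2 (h1.2 j' (by simp))

lemma IsSimple.isBeltLoop_iff {k : ℕ} {L : ZMod k → Fin P.m} :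
    P.IsBeltLoop L ↔ (P.sphere hP).IsBelt L := by
  have hcap : (⋂ p, P.facet (L p)) = ∅ ↔ ¬ ∃ v, ∀ p, L p ∈ (P.sphere hP).inc v := by
    have : (⋂ p, P.facet (L p)) = P.face (Set.range L) := by
      ext x
      simp only [Set.mem_iInter, facet, face, mem_active, Set.mem_ofPred_eq, Set.forall_mem_range]
      exact ⟨fun h => ⟨(h 0).1, fun p => (h p).2⟩, fun h p => ⟨h.1, h.2 p⟩⟩
    rw [this, ← Set.not_nonempty_iff_eq_empty, not_iff_not]
    constructor
    · intro h
      obtain ⟨v, hv, hm⟩ := exists_isNode h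
      exact ⟨⟨v, hv⟩, fun p => hm.2 _ ⟨p, rfl⟩⟩
    · rintro ⟨v, hv⟩
      refine ⟨v, v.2.1, ?_⟩
      rintro _ ⟨p, rfl⟩
      exact hv p
  constructor
  · rintro ⟨h1, h2, h3⟩
    have hadj : ∀ p, (P.sphere hP).Adj (L p) (L (p + 1)) := fun p =>
      hP.isEdge_facet_inter_iff.1 (h1 p)
    refine ⟨fun p q hpq => ?_, hadj, fun p q hpq => ?_, hcap.1 h2⟩
    -- Facets are nonempty, so a repeated facet meets itself and the two positions are successive.
    -- But successive facets meet in an edge and are different.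
    · by_contra hne
      have hmeet : (P.facet (L p) ∩ P.facet (L q)).Nonempty := by
        rw [hpq, Set.inter_self, facet_eq_face]
        exact face_singleton_nonempty hP.1 _
      rcases (h3 p q hne).1 hmeet with rfl | rfl
      · exact (hadj p).1 hpq
      · exact (hadj q).1 hpq.symm
    · exact (h3 p q (fun h => hpq.1 (h ▸ rfl))).1 ((hP.facet_inter_nonempty_iff hpq.1).2 hpq)
  · intro h
    refine ⟨fun p => hP.isEdge_facet_inter_iff.2 (h.adj p), hcap.2 h.not_common, fun p q hpq => ?_⟩
    rw [hP.facet_inter_nonempty_iff fun h' => hpq (h.injective h')]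
    refine ⟨h.chordless p q, ?_⟩
    rintro (rfl | rfl)
    · exact h.adj p
    · exact (h.adj q).symm

lemma IsSimple.setOf_isBelt : {B | P.IsBelt 5 B} = (P.sphere hP).beltSets := by
  ext B
  exact exists_congr fun L => and_congr_left fun _ => hP.isBeltLoop_iff

lemma IsSimple.surrounds_iff {B : Set (Fin P.m)} {i : Fin P.m} :
    P.Surrounds B i ↔ B = {z | (P.sphere hP).Adj z i} := by
  simp only [Surrounds, hP.isEdge_facet_inter_iff]

lemma IsSimple.surroundsPentagon_iff {B : Set (Fin P.m)} :
    P.SurroundsPentagon B ↔ B ∈ (P.sphere hP).pentagonLinks :=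
  exists_congr fun _ => and_congr hP.isGon_iff hP.surrounds_iff

/-- Simple polytopes are equivalent if their vertices lie on corresponding facets. -/
lemma IsSimple.combEquiv {k : ℕ} (g : DPolytope.Facet k ≃ Fin P.m) (e : DPolytope.Vertex k ≃ P.Node)
    (h : ∀ v φ, g φ ∈ (P.sphere hP).inc (e v) ↔ φ ∈ DPolytope.facetsAt v) :
    CombEquiv P.faces (DPolytope.faces k) := by
  have key : ∀ S : Set (Fin P.m), {v | (e v : EuclideanSpace ℝ (Fin 3)) ∈ P.face S} =
      ⋂ f ∈ g ⁻¹' S, {v : DPolytope.Vertex k | f ∈ DPolytope.facetsAt v} := by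
    intro S
    ext v
    simp only [Set.mem_ofPred_eq, Set.mem_iInter, Set.mem_preimage, ← h]
    exact ⟨fun hv f hf => hv.2 _ hf, fun hv => ⟨(e v).2.1, fun i hi => by
      have := hv (g.symm i) (by simpa using hi)
      rwa [g.apply_symm_apply] at this⟩⟩
  let Φ : P.faces → DPolytope.faces k := fun G => ⟨{v | (e v : EuclideanSpace ℝ (Fin 3)) ∈ G.1}, by
    obtain ⟨S, hS⟩ := G.2
    rw [hS, ← face_eq, key]
    exact ⟨_, rfl⟩⟩
  -- A face is the closed convex hull of its vertices, so inclusion can be tested on vertex sets.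
  have hΦ : ∀ G H, Φ G ≤ Φ H ↔ G ≤ H := by
    rintro ⟨G, S, rfl⟩ ⟨H, T, rfl⟩
    constructor
    · intro hle
      change P.carrier ∩ ⋂ i ∈ S, P.facet i ⊆ P.carrier ∩ ⋂ i ∈ T, P.facet i
      rw [← face_eq, ← face_eq]
      refine face_subset_face fun v hv hvS => ?_
      obtain ⟨w, hw⟩ := e.surjective ⟨v, hv⟩
      have h1 : w ∈ (Φ ⟨_, S, rfl⟩).1 := by
        change (e w : EuclideanSpace ℝ (Fin 3)) ∈ P.carrier ∩ ⋂ i ∈ S, P.facet i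
        rwa [← face_eq, hw]
      have h2 : (e w : EuclideanSpace ℝ (Fin 3)) ∈ P.carrier ∩ ⋂ i ∈ T, P.facet i := hle h1
      rwa [← face_eq, hw] at h2
    · exact fun hle v hv => hle hv
  refine ⟨RelIso.ofSurjective (OrderEmbedding.ofMapLEIff Φ hΦ) ?_⟩
  rintro ⟨_, S, rfl⟩
  refine ⟨⟨P.face (g '' S), face_mem_faces _⟩, Subtype.ext ?_⟩
  change {v | (e v : EuclideanSpace ℝ (Fin 3)) ∈ P.face (g '' S)} = _
  rw [key, Equiv.preimage_image]

end ConvexPolytope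

/-! ### Conclusion for fullerenes. -/

theorem mainTheorem5 (P : ConvexPolytope 3) (hP : P.IsFullerene) :
    ((∀ i, P.IsGon 5 i → ∃ B, P.IsBelt 5 B ∧ P.Surrounds B i) ∧
      {B | P.IsBelt 5 B ∧ P.SurroundsPentagon B}.ncard = 12) ∧
    (∀ B, P.IsBelt 5 B → ¬ P.SurroundsPentagon B →
      (∀ i ∈ B, P.IsGon 6 i) ∧
      ∃ k : ℕ, 1 ≤ k ∧ CombEquiv P.faces (DPolytope.faces k) ∧
        {C | P.IsBelt 5 C}.ncard = 12 + k) := by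
  obtain ⟨hS, hgon⟩ := hP
  set K := P.sphere hS with hK
  have hfull : K.IsFullerene := fun i => (hgon i).imp hS.isGon_iff.1 hS.isGon_iff.1
  have hbelt : ∀ B, P.IsBelt 5 B ↔ B ∈ K.beltSets := fun B => by rw [← hS.setOf_isBelt]; rfl
  refine ⟨⟨fun i hi => ?_, ?_⟩, fun B hB hnt => ?_⟩
  · refine ⟨{z | K.Adj z i}, (hbelt _).2 (hfull.pentagonLinks_subset ?_), hS.surrounds_iff.2 rfl⟩
    exact ⟨i, hS.isGon_iff.1 hi, rfl⟩
  · rw [← hfull.ncard_pentagonLinks]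
    congr 1
    ext B
    simp only [Set.mem_ofPred_eq, hbelt, hS.surroundsPentagon_iff]
    exact and_iff_right_of_imp fun h => hfull.pentagonLinks_subset h
  · rw [hS.surroundsPentagon_iff] at hnt
    obtain ⟨x, hx, rfl⟩ := (hbelt B).1 hB
    obtain ⟨h6, k, hk, ⟨g, e, hge⟩, hcard⟩ := hfull.five_belts hx hnt
    refine ⟨?_, k, hk, hS.combEquiv g e hge, ?_⟩
    · rintro _ ⟨p, rfl⟩
      exact hS.isGon_iff.2 (h6 p)
    · rw [hS.setOf_isBelt, hcard]
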